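/- Let $p$ be a prime, $e\ge 1$ and $q=p^e$. Let $\mathcal A_q$ be the algebra of Steenrod $q$th powers: the $\mathbb F_q$-algebra generated by $P^r$, $r\ge 0$, subject to $P^0=1$ and the Adem relations $$P^aP^b=\sum_{j=0}^{\lfloor a/q\rfloor}(-1)^{a+j}\binom{(q-1)(b-j)-1}{a-qj}P^{a+b-j}P^j,\qquad a<qb .$$ It acts on $\mathbb F_q[x_0,x_1,\dots]$, the operation $P^r$ being the coefficient of $X^r$ in the algebra homomorphism $x_i\mapsto x_i+x_i^qX$. For a sequence $R=(r_1,r_2,\dots)$ of integers $\ge 0$, almost all zero, the Milnor basis element $P(R)\in\mathcal A_q$ is the unique element which acts as the coefficient of $\xi_1^{r_1}\xi_2^{r_2}\cdots$ in the algebra homomorphism $x_i\mapsto x_i+\sum_{t\ge1}x_i^{q^t}\xi_t$. For $s\ge0$, $t\ge1$ let $P^s_t=P(0,\dots,0,p^s)$ with $p^s$ in position $t$. Write $s=s'e+s''$ with $0\le s''<e$. The Y-order on the pairs $(s,t)$ is the left lexicographic order on the triples $(s',t,s'')$, and the Z-order is the left lexicographic order on the triples $(s'+t,s',s'')$. For a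 finitely supported function $k$ on the pairs $(s,t)$ with values in $\{0,\dots,p-1\}$, let $Y_k$ and $Z_k$ be the products of the elements $P^s_t$, each repeated $k(s,t)$ times, in increasing Y-order and Z-order respectively; let $R(k)=(r_1,r_2,\dots)$ with $r_t=\sum_s k(s,t)p^s$, and let $c_k=\prod_{s,t}k(s,t)!$, considered in $\mathbb F_p\subseteq\mathbb F_q$. Let $\mathcal A_q^+$ be the augmentation ideal, let $M(\theta)=\sup\{m:\theta\in(\mathcal A_q^+)^m\}$ be the May filtration of $\theta$, and let $E^0(\mathcal A_q)=\bigoplus_{m\ge0}(\mathcal A_q^+)^m/(\mathcal A_q^+)^{m+1}$. Then the elements $P(R)$ exist, are unique, and form an $\mathbb F_q$-basis of $\mathcal A_q$; the elements $Y_k$ form a basis of $\mathcal A_q$ (the Y-$P^s_t$ basis), and so do the elements $Z_k$ (the Z-$P^s_t$ basis). The map $k\mapsto R(k)$ is a bijection onto the set of all sequences $R$, every scalar $c_k$ is nonzero, and for all $k$ $$M\bigl(Y_k-c_kP(R(k))\bigr)>M\bigl(P(R(k))\bigr),\qquad M\bigl(Z_k-c_kP(R(k))\bigr)>M\bigl(P(R(k))\bigr).$$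 Thus, up to the nonzero scalars $c_k$ (all equal to $1$ when $p=2$), the Y- and Z-$P^s_t$ bases coincide with the Milnor basis modulo elements of higher May filtration. Hence the classes of each of the three bases, each element being taken in the graded piece of degree its May filtration, form an $\mathbb F_q$-basis of $E^0(\mathcal A_q)$; the classes of $Y_k$ and $Z_k$ are equal, and both are equal to $c_k$ times the class of $P(R(k))$. -/

import Mathlib

/-!
The algebra of Steenrod `q`th powers, `q = p ^ e`, given by generators and Adem relations; its action
on polynomials; Milnor basis elements; the ordered products of the elements `P^s_t`; the May
filtration and the associated graded vector space.
-/

namespace Steenrod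

/-- The defining relations: `P^0 = 1`, and the Adem relations for `a < q * b`. In the sum
`j ≤ a / q < b`, so (for `q ≥ 2`) none of the natural number subtractions truncates. -/
inductive AdemRel (K : Type*) [Field K] (q : ℕ) : FreeAlgebra K ℕ → FreeAlgebra K ℕ → Prop
  | zero : AdemRel K q (FreeAlgebra.ι K 0) 1
  | adem (a b : ℕ) (h : a < q * b) :
      AdemRel K q (FreeAlgebra.ι K a * FreeAlgebra.ι K b)
        (∑ j ∈ Finset.range (a / q + 1),
          ((-1 : K) ^ (a + j) * (((q - 1) * (b - j) - 1).choose (a - q * j) : K)) •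
            (FreeAlgebra.ι K (a + b - j) * FreeAlgebra.ι K j))

/-- The algebra of Steenrod `q`th powers, `q = p ^ e`, over the Galois field with `q` elements. -/
def SteenrodAlgebra (p e : ℕ) [Fact p.Prime] : Type :=
  RingQuot (AdemRel (GaloisField p e) (p ^ e))

noncomputable instance (p e : ℕ) [Fact p.Prime] : Ring (SteenrodAlgebra p e) :=
  inferInstanceAs (Ring (RingQuot (AdemRel (GaloisField p e) (p ^ e))))

noncomputable instance (p e : ℕ) [Fact p.Prime] :
    Algebra (GaloisField p e) (SteenrodAlgebra p e) :=
  inferInstanceAs (Algebra (GaloisField p e) (RingQuot (AdemRel (GaloisField p e) (p ^ e))))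

/-- The generator `P^r`. -/
noncomputable def power (p e : ℕ) [Fact p.Prime] (r : ℕ) : SteenrodAlgebra p e :=
  RingQuot.mkAlgHom (GaloisField p e) (AdemRel (GaloisField p e) (p ^ e))
    (FreeAlgebra.ι (GaloisField p e) r)

/-! ### The action on polynomials -/

open Polynomial in
/-- The total Steenrod `q`th power on `K[x₀, x₁, …]`: the `K`-algebra homomorphism
`xᵢ ↦ xᵢ + xᵢ ^ q * X`, where the variable `X` records the index of the operation. -/
noncomputable def totalPower (K : Type*) [Field K] (q : ℕ) :
    MvPolynomial ℕ K →ₐ[K] (MvPolynomial ℕ K)[X] :=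
  MvPolynomial.aeval fun i => C (MvPolynomial.X i) + C (MvPolynomial.X i ^ q) * X

/-- The operation `P^r` on `K[x₀, x₁, …]`: the coefficient of `X ^ r` in the total power. -/
noncomputable def powerOp (K : Type*) [Field K] (q r : ℕ) : Module.End K (MvPolynomial ℕ K) :=
  (Polynomial.lcoeff (MvPolynomial ℕ K) r).restrictScalars K ∘ₗ (totalPower K q).toLinearMap

/-! The operations `powerOp` satisfy the defining relations. -/

/-- The binomial coefficient with integer entries, zero when the lower entry is negative
(used only to check the Adem relations for the action on polynomials). -/
def chooseZ (r k : ℤ) : ℤ := if 0 ≤ k then Ring.choose r k.toNat else 0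

theorem chooseZ_natCast (r : ℤ) (k : ℕ) : chooseZ r k = Ring.choose r k := by simp [chooseZ]

theorem chooseZ_of_neg {r k : ℤ} (h : k < 0) : chooseZ r k = 0 := by
  simp [chooseZ, h]

theorem chooseZ_pascal (r k : ℤ) : chooseZ (r + 1) k = chooseZ r (k - 1) + chooseZ r k := by
  rcases lt_trichotomy k 0 with h | h | h
  · simp [chooseZ_of_neg h, chooseZ_of_neg (show k - 1 < 0 by omega)]
  · subst h; simp [chooseZ]
  · obtain ⟨m, rfl⟩ : ∃ m : ℕ, k = (m + 1 : ℕ) := ⟨(k - 1).toNat, by omega⟩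
    rw [show ((m + 1 : ℕ) : ℤ) - 1 = (m : ℕ) by push_cast; ring]
    simp only [chooseZ_natCast, Ring.choose_succ_succ]

theorem chooseZ_frobenius (K : Type*) [Field K] (p e : ℕ) [Fact p.Prime] [CharP K p]
    (r k : ℤ) :
    (chooseZ (r + (p ^ e : ℕ)) k : K) = chooseZ r (k - (p ^ e : ℕ)) + chooseZ r k := by
  have hq : 0 < p ^ e := pow_pos (Fact.out : p.Prime).pos e
  have hdvd : ∀ j, j ≠ 0 → j ≠ p ^ e → (((p ^ e).choose j : ℕ) : K) = 0 := fun j h1 h2 => by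
    rw [CharP.cast_eq_zero_iff K p]
    exact (Fact.out : p.Prime).dvd_choose_pow h1 h2
  generalize p ^ e = q at *
  rcases lt_or_ge k 0 with h | h
  · simp [chooseZ_of_neg h, chooseZ_of_neg (show k - (q : ℕ) < 0 by omega)]
  obtain ⟨n, rfl⟩ : ∃ n : ℕ, k = n := ⟨k.toNat, by omega⟩
  rw [chooseZ_natCast, Ring.add_choose_eq _ (Commute.all _ _), Int.cast_sum]
  have key : ∀ x ∈ Finset.HasAntidiagonal.antidiagonal n,
      ((Ring.choose r x.1 * Ring.choose (q : ℤ) x.2 : ℤ) : K) =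
        (if x = (n, 0) then ((Ring.choose r n : ℤ) : K) else 0) +
        (if x = (n - q, q) then ((Ring.choose r (n - q) : ℤ) : K) else 0) := by
    rintro ⟨i, j⟩ hx
    rw [Finset.HasAntidiagonal.mem_antidiagonal] at hx
    simp only at hx
    simp only [Ring.choose_natCast, Int.cast_mul, Int.cast_natCast]
    rcases Nat.eq_zero_or_pos j with rfl | hj
    · have : i = n := by omega
      subst this
      simp [Prod.ext_iff, hq.ne]
    by_cases hj2 : j = q
    · have : i = n - q := by omega
      subst this; subst hj2
      simp [hq.ne']
    · rw [hdvd j hj.ne' hj2]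
      simp [Prod.ext_iff, hj.ne', hj2]
  rw [Finset.sum_congr rfl key, Finset.sum_add_distrib, Finset.sum_ite_eq', Finset.sum_ite_eq',
    if_pos (by simp), add_comm]
  congr 1
  by_cases hn : q ≤ n
  · rw [if_pos (by simp; omega), ← Nat.cast_sub hn, chooseZ_natCast]
  · rw [if_neg (by simp; omega), chooseZ_of_neg (by omega)]
    simp

theorem choose_mul_self_cast (K : Type*) [Field K] (p e : ℕ) [Fact p.Prime] [NeZero e] [CharP K p]
    (a : ℕ) (ha : a ≠ 0) : (((p ^ e * a).choose a : ℕ) : K) = 0 := by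
  have hp := (Fact.out : p.Prime)
  have hq : 0 < p ^ e := pow_pos hp.pos e
  obtain ⟨m, rfl⟩ := Nat.exists_eq_succ_of_ne_zero ha
  obtain ⟨N, hN⟩ : ∃ N, p ^ e * (m + 1) = N + 1 := ⟨p ^ e * (m + 1) - 1, by
    have : 0 < p ^ e * (m + 1) := Nat.mul_pos hq (Nat.succ_pos m)
    omega⟩
  have h := Nat.add_one_mul_choose_eq N m
  rw [← hN] at h
  have h2 : (p ^ e * (m + 1)).choose (m + 1) = p ^ e * N.choose m := by
    apply Nat.eq_of_mul_eq_mul_right (Nat.succ_pos m)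
    rw [Nat.succ_eq_add_one, ← h]; ring
  rw [Nat.succ_eq_add_one, h2, CharP.cast_eq_zero_iff K p]
  exact Dvd.dvd.mul_right (dvd_pow_self p (NeZero.ne e)) _

theorem adem_chooseZ (K : Type*) [Field K] (p e : ℕ) [Fact p.Prime] [NeZero e] [CharP K p]
    (a : ℕ) : ∀ (b : ℤ) (M : ℕ), a < M →
    ∑ j ∈ Finset.range M, (-1 : K) ^ (a + j) *
      (chooseZ (((p ^ e : ℕ) - 1) * (b - j) - 1) (a - (p ^ e : ℕ) * j) : K) *
      (chooseZ (a + b) j : K) = (chooseZ (a + b) a : K) := by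
  have hq : 0 < p ^ e := pow_pos (Fact.out : p.Prime).pos e
  have hfrob := chooseZ_frobenius K p e
  have hself := choose_mul_self_cast K p e
  generalize p ^ e = q at *
  have hneg : ∀ (a : ℕ) (j : ℕ), a < j → (a : ℤ) - q * j < 0 := by
    intro a j h
    have : (j : ℤ) ≤ q * j := le_mul_of_one_le_left (by omega) (by omega)
    omega
  induction a with
  | zero =>
    intro b M hM
    rw [Finset.sum_eq_single_of_mem 0 (by simpa using hM)]
    · simp [chooseZ]
    · intro j _ hj
      rw [chooseZ_of_neg (k := ((0 : ℕ) : ℤ) - q * j) (hneg 0 j (by omega))]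
      simp
  | succ a ih =>
    intro b M hM
    set G : ℤ → K := fun b => ∑ j ∈ Finset.range M, (-1 : K) ^ (a + 1 + j) *
      (chooseZ (((q : ℤ) - 1) * (b - j) - 1) ((a + 1 : ℕ) - q * j) : K) *
      (chooseZ ((a + 1 : ℕ) + b) j : K) with hG
    have hstep : ∀ b, G b = G (b - 1) + (chooseZ (a + b) a : K) := by
      intro b
      rw [← ih b M (by omega)]
      set f : ℤ → K := fun j =>
        (chooseZ (((q : ℤ) - 1) * (b - 1 - j) - 1) ((a + 1 : ℕ) - q * j - q) : K) *
          (chooseZ (a + b) j : K) with hf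
      have hterm : ∀ j ∈ Finset.range M,
          (-1 : K) ^ (a + 1 + j) *
            (chooseZ (((q : ℤ) - 1) * (b - j) - 1) ((a + 1 : ℕ) - q * j) : K) *
            (chooseZ ((a + 1 : ℕ) + b) j : K) =
          (-1 : K) ^ (a + 1 + j) *
            (chooseZ (((q : ℤ) - 1) * (b - 1 - j) - 1) ((a + 1 : ℕ) - q * j) : K) *
            (chooseZ ((a + 1 : ℕ) + (b - 1)) j : K) +
          (-1 : K) ^ (a + j) * (chooseZ (((q : ℤ) - 1) * (b - j) - 1) (a - q * j) : K) *
            (chooseZ (a + b) j : K) +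
          ((-1 : K) ^ (a + (j + 1 : ℕ)) * f ((j + 1 : ℕ) - 1) - (-1 : K) ^ (a + j) * f (j - 1)) := by
        intro j _
        have p1 := chooseZ_pascal (a + b) j
        have p2 := chooseZ_pascal (((q : ℤ) - 1) * (b - j) - 1) ((a + 1 : ℕ) - q * j)
        have p3 := hfrob (((q : ℤ) - 1) * (b - 1 - j) - 1) ((a + 1 : ℕ) - q * j)
        rw [show ((q : ℤ) - 1) * (b - 1 - j) - 1 + q = ((q : ℤ) - 1) * (b - j) - 1 + 1 by ring,
          p2] at p3
        rw [show (((a + 1 : ℕ) : ℤ) - q * j - 1) = a - q * j by push_cast; ring] at p3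
        push_cast at p3
        simp only [hf]
        rw [show ((a + 1 : ℕ) : ℤ) + b = a + b + 1 by push_cast; ring, p1,
          show ((a + 1 : ℕ) : ℤ) + (b - 1) = a + b by push_cast; ring]
        rw [show ((j + 1 : ℕ) : ℤ) - 1 = j by push_cast; ring,
          show b - 1 - ((j : ℤ) - 1) = b - j by ring,
          show ((a + 1 : ℕ) : ℤ) - q * ((j : ℤ) - 1) - q = (a + 1 : ℕ) - q * j by ring]
        push_cast
        rw [pow_add _ a (j + 1), pow_add _ a j, pow_add _ (a + 1) j, pow_succ, pow_succ]
        linear_combination (-1 : K) ^ a * (-1 : K) ^ j * (-1) * (chooseZ (a + b) j : K) * p3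
      have htel := Finset.sum_range_sub (fun j : ℕ => (-1 : K) ^ (a + j) * f ((j : ℤ) - 1)) M
      have h0 : f ((M : ℤ) - 1) = 0 := by
        have := hneg (a + 1) M hM
        simp only [hf]
        rw [chooseZ_of_neg (k := ((a + 1 : ℕ) : ℤ) - q * ((M : ℤ) - 1) - q) (by
          linarith)]
        simp
      have h1 : f (((0 : ℕ) : ℤ) - 1) = 0 := by
        simp only [hf]
        rw [chooseZ_of_neg (r := a + b) (k := ((0 : ℕ) : ℤ) - 1) (by simp)]
        simp
      rw [hG]
      simp only
      rw [Finset.sum_congr rfl hterm, Finset.sum_add_distrib, Finset.sum_add_distrib, htel, h0, h1]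
      ring
    have hpas : ∀ b : ℤ, (chooseZ ((a + 1 : ℕ) + b) (a + 1 : ℕ) : K) =
        chooseZ ((a + 1 : ℕ) + (b - 1)) (a + 1 : ℕ) + (chooseZ (a + b) a : K) := by
      intro b
      have := chooseZ_pascal (a + b) (a + 1 : ℕ)
      rw [show ((a + 1 : ℕ) : ℤ) + b = a + b + 1 by push_cast; ring, this,
        show ((a + 1 : ℕ) : ℤ) + (b - 1) = a + b by push_cast; ring,
        show ((a + 1 : ℕ) : ℤ) - 1 = a by push_cast; ring]
      push_cast; ring
    have hbase : G (-((a + 1 : ℕ) : ℤ)) =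
        (chooseZ ((a + 1 : ℕ) + -((a + 1 : ℕ) : ℤ)) (a + 1 : ℕ) : K) := by
      rw [add_neg_cancel, chooseZ_natCast, Ring.choose_zero_succ, hG]
      simp only
      rw [Finset.sum_eq_single_of_mem 0 (by simp; omega)]
      · rw [show ((a + 1 : ℕ) : ℤ) - q * ((0 : ℕ) : ℤ) = (a + 1 : ℕ) by simp, chooseZ_natCast,
          show ((q : ℤ) - 1) * (-((a + 1 : ℕ) : ℤ) - (0 : ℕ)) - 1
            = -(((q : ℤ) - 1) * (a + 1 : ℕ) + 1) by push_cast; ring, Ring.choose_neg,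
          show ((q : ℤ) - 1) * (a + 1 : ℕ) + 1 + (a + 1 : ℕ) - 1 = (q * (a + 1) : ℕ) by
            push_cast; ring, Ring.choose_natCast]
        have := hself (a + 1) (by omega)
        simp [Units.smul_def, this]
      · intro j _ hj
        rw [add_neg_cancel, chooseZ_natCast]
        obtain ⟨m, rfl⟩ := Nat.exists_eq_succ_of_ne_zero hj
        rw [Nat.succ_eq_add_one, Ring.choose_zero_succ]
        simp
    have hall : ∀ b : ℤ, G b - (chooseZ ((a + 1 : ℕ) + b) (a + 1 : ℕ) : K) = 0 := by
      intro b
      induction b using Int.inductionOn' (b := -((a + 1 : ℕ) : ℤ)) with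
      | zero => rw [hbase, sub_self]
      | succ k _ hk =>
        have s1 := hstep (k + 1); have s2 := hpas (k + 1)
        rw [add_sub_cancel_right] at s1 s2
        rw [s1, s2]; linear_combination hk
      | pred k _ hk =>
        have s1 := hstep k; have s2 := hpas k
        linear_combination hk - s1 + s2
    exact sub_eq_zero.1 (hall b)


theorem adem_choose (K : Type*) [Field K] (p e : ℕ) [Fact p.Prime] [NeZero e] [CharP K p]
    (a b : ℕ) (hab : a < p ^ e * b) :
    ∑ j ∈ Finset.range (a / p ^ e + 1), (-1 : K) ^ (a + j) *
      (((p ^ e - 1) * (b - j) - 1).choose (a - p ^ e * j) : K) * ((a + b).choose j : K) =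
    ((a + b).choose b : K) := by
  have hq : 0 < p ^ e := pow_pos (Fact.out : p.Prime).pos e
  have hq2 : 2 ≤ p ^ e :=
    le_trans (Fact.out : p.Prime).two_le (Nat.le_self_pow (NeZero.ne e) p)
  have h := adem_chooseZ K p e a b (a + 1) (by omega)
  generalize p ^ e = q at *
  have hle : a / q ≤ a := Nat.div_le_self _ _
  rw [← Nat.choose_symm_add]
  rw [← Nat.cast_add, chooseZ_natCast, Ring.choose_natCast, Int.cast_natCast] at h
  rw [← h]
  refine Finset.sum_subset_zero_on_sdiff (Finset.range_subset_range.2 (by omega)) ?_ ?_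
  · intro j hj
    simp only [Finset.mem_sdiff, Finset.mem_range, not_lt] at hj
    have : a < q * j := by
      have := (Nat.div_lt_iff_lt_mul hq).1 (show a / q < j by omega)
      rwa [mul_comm] at this
    have h' : (a : ℤ) < q * j := by exact_mod_cast this
    rw [chooseZ_of_neg (k := (a : ℤ) - q * j) (by linarith)]
    simp
  · intro j hj
    simp only [Finset.mem_range] at hj
    have h1 : q * j ≤ a := by
      have := (Nat.le_div_iff_mul_le hq).1 (show j ≤ a / q by omega)
      rwa [mul_comm] at this
    have h2 : j < b := by
      by_contra hc
      have := Nat.mul_le_mul_left q (not_lt.1 hc)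
      omega
    have h3 : 1 ≤ (q - 1) * (b - j) := Nat.mul_pos (by omega) (by omega)
    rw [show (a : ℤ) - q * j = (a - q * j : ℕ) by rw [Nat.cast_sub h1]; push_cast; rfl,
      show ((q : ℤ) - 1) * ((b : ℤ) - j) - 1 = ((q - 1) * (b - j) - 1 : ℕ) by
        rw [Nat.cast_sub h3, Nat.cast_mul, Nat.cast_sub h2.le, Nat.cast_sub (by omega)]
        push_cast; rfl]
    simp only [chooseZ_natCast, Ring.choose_natCast, Int.cast_natCast]

theorem powerOp_apply (K : Type*) [Field K] (q r : ℕ) (f : MvPolynomial ℕ K) :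
    powerOp K q r f = (totalPower K q f).coeff r := rfl

theorem powerOp_zero (K : Type*) [Field K] (q : ℕ) : powerOp K q 0 = 1 := by
  have h : ((Polynomial.aeval (0 : MvPolynomial ℕ K)).restrictScalars K).comp (totalPower K q) =
      AlgHom.id K (MvPolynomial ℕ K) := by
    apply MvPolynomial.algHom_ext
    intro i
    simp [totalPower]
  refine LinearMap.ext fun f => ?_
  rw [powerOp_apply, Polynomial.coeff_zero_eq_aeval_zero]
  exact DFunLike.congr_fun h f

section Composite
open Polynomial

/-- Auxiliary: the total operation `x ↦ x + x ^ q * u + x ^ (q ^ 2) * v`. -/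
noncomputable def twoTermTotal (K : Type*) [Field K] (q : ℕ) :
    MvPolynomial ℕ K →ₐ[K] (MvPolynomial ℕ K)[X][X] :=
  MvPolynomial.aeval fun i =>
    C (C (MvPolynomial.X i) + C (MvPolynomial.X i ^ q) * X) + C (C (MvPolynomial.X i ^ q ^ 2)) * X

/-- Auxiliary: the substitution `u ↦ s + t`, `v ↦ s ^ q * t`. -/
noncomputable def twoTermSubst (A : Type*) [CommRing A] (q : ℕ) : A[X][X] →+* A[X][X] :=
  eval₂RingHom (eval₂RingHom (C.comp C) (C X + X)) (C (X ^ q) * X)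

theorem twoTermSubst_coeff (A : Type*) [CommRing A] (q a b : ℕ) (g : A[X][X]) :
    ((twoTermSubst A q g).coeff b).coeff a =
      ∑ k ∈ Finset.range (b + 1), if q * k ≤ a then
        ((a + b - (q + 1) * k).choose (b - k) : A) * (g.coeff k).coeff (a + b - (q + 1) * k)
      else 0 := by
  induction g using Polynomial.induction_on' with
  | add g h hg hh =>
    rw [map_add, coeff_add, coeff_add, hg, hh, ← Finset.sum_add_distrib]
    refine Finset.sum_congr rfl fun k _ => ?_
    split_ifs <;> simp [mul_add]
  | monomial k g =>
    induction g using Polynomial.induction_on' with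
    | add g h hg hh =>
      rw [map_add, map_add, coeff_add, coeff_add, hg, hh, ← Finset.sum_add_distrib]
      refine Finset.sum_congr rfl fun k' _ => ?_
      split_ifs <;> simp [mul_add]
    | monomial r d =>
      have e1 : twoTermSubst A q (monomial k (monomial r d)) =
          C (C d * X ^ (q * k)) * ((X + C X) ^ r * X ^ k) := by
        simp only [twoTermSubst, coe_eval₂RingHom, eval₂_monomial, RingHom.comp_apply, map_mul,
          map_pow, mul_pow, pow_mul]
        ring
      rw [e1, coeff_C_mul, coeff_mul_X_pow']
      by_cases hk : k ≤ b
      · rw [if_pos hk, coeff_X_add_C_pow, Finset.sum_eq_single_of_mem k (by simpa using by omega)]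
        · rw [coeff_monomial, if_pos rfl, coeff_monomial]
          rw [show C d * X ^ (q * k) * (X ^ (r - (b - k)) * ((r.choose (b - k) : ℕ) : A[X])) =
            C (d * (r.choose (b - k) : ℕ)) * X ^ (q * k + (r - (b - k))) by
              rw [pow_add]; simp only [map_mul, map_natCast]; ring]
          rw [coeff_C_mul, coeff_X_pow, add_mul, one_mul]
          by_cases hr : b - k ≤ r
          · by_cases hs : q * k ≤ a
            · rw [if_pos hs]
              by_cases he : r = a + b - (q * k + k)
              · rw [if_pos he, if_pos (by omega), ← he]; ring
              · rw [if_neg he, if_neg (by omega)]; ring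
            · rw [if_neg hs, if_neg (by omega)]; simp
          · rw [Nat.choose_eq_zero_of_lt (show r < b - k by omega)]
            split_ifs <;> first | (exfalso; omega) | simp
        · intro j _ hj
          rw [coeff_monomial, if_neg (Ne.symm hj)]
          simp
      · rw [if_neg hk, mul_zero, coeff_zero]
        symm
        apply Finset.sum_eq_zero
        intro j hj
        rw [Finset.mem_range] at hj
        rw [coeff_monomial, if_neg (show ¬ k = j by omega)]
        simp

theorem powerOp_comp (K : Type*) [Field K] (p e : ℕ) [Fact p.Prime] [CharP K p]
    (a b : ℕ) (f : MvPolynomial ℕ K) :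
    powerOp K (p ^ e) a (powerOp K (p ^ e) b f) =
      ∑ k ∈ Finset.range (b + 1), if p ^ e * k ≤ a then
        ((a + b - (p ^ e + 1) * k).choose (b - k) : K) •
          ((twoTermTotal K (p ^ e) f).coeff k).coeff (a + b - (p ^ e + 1) * k)
      else 0 := by
  have h : ((mapRingHom (totalPower K (p ^ e)).toRingHom).comp (totalPower K (p ^ e)).toRingHom) =
      (twoTermSubst (MvPolynomial ℕ K) (p ^ e)).comp (twoTermTotal K (p ^ e)).toRingHom := by
    apply MvPolynomial.ringHom_ext
    · intro r
      simp [totalPower, twoTermTotal, twoTermSubst, MvPolynomial.algebraMap_eq,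
        Polynomial.algebraMap_apply]
    · intro i
      have hfr := add_pow_char_pow (R := (MvPolynomial ℕ K)[X][X]) (p := p) (n := e)
        (C (C (MvPolynomial.X i))) (C (C (MvPolynomial.X i)) ^ p ^ e * C X)
      simp only [totalPower, twoTermTotal, twoTermSubst, RingHom.comp_apply, AlgHom.toRingHom_eq_coe,
        RingHom.coe_coe, MvPolynomial.aeval_X, coe_mapRingHom, map_C, map_X, map_pow,
        coe_eval₂RingHom, eval₂_C, eval₂_X, map_add, map_mul, hfr]
      ring
  have h2 := RingHom.congr_fun h f
  have h3 := twoTermSubst_coeff (MvPolynomial ℕ K) (p ^ e) a b (twoTermTotal K (p ^ e) f)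
  have h4 : twoTermSubst (MvPolynomial ℕ K) (p ^ e) (twoTermTotal K (p ^ e) f) =
    (totalPower K (p ^ e) f).map (totalPower K (p ^ e)).toRingHom := h2.symm
  rw [h4, coeff_map] at h3
  rw [powerOp_apply, powerOp_apply]
  refine Eq.trans h3 (Finset.sum_congr rfl fun k _ => ?_)
  split_ifs
  · rw [Algebra.smul_def]; simp
  · rfl

end Composite

theorem powerOp_adem (K : Type*) [Field K] (p e : ℕ) [Fact p.Prime] [NeZero e] [CharP K p]
    (a b : ℕ) (hab : a < p ^ e * b) :
    powerOp K (p ^ e) a * powerOp K (p ^ e) b =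
      ∑ j ∈ Finset.range (a / p ^ e + 1),
        ((-1 : K) ^ (a + j) * (((p ^ e - 1) * (b - j) - 1).choose (a - p ^ e * j) : K)) •
          (powerOp K (p ^ e) (a + b - j) * powerOp K (p ^ e) j) := by
  have hq : 0 < p ^ e := pow_pos (Fact.out : p.Prime).pos e
  have hsign : (-1 : K) ^ p ^ e = -1 := neg_one_pow_char_pow K p e
  refine LinearMap.ext fun f => ?_
  rw [LinearMap.sum_apply]
  simp only [LinearMap.smul_apply, Module.End.mul_apply, powerOp_comp]
  have hadem := adem_choose K p e
  generalize twoTermTotal K (p ^ e) f = g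
  generalize p ^ e = q at *
  have hb : ∀ k, q * k ≤ a → k < b := by
    intro k hk
    by_contra hc
    have := Nat.mul_le_mul_left q (not_lt.1 hc)
    omega
  have hdiv : ∀ k, k < a / q + 1 ↔ q * k ≤ a := by
    intro k
    rw [Nat.lt_succ_iff, Nat.le_div_iff_mul_le hq, mul_comm]
  have hL : ∀ (D : ℕ → MvPolynomial ℕ K),
      (∑ k ∈ Finset.range (b + 1), if q * k ≤ a then D k else 0) =
      ∑ k ∈ Finset.range (a / q + 1), D k := by
    intro D
    rw [← Finset.sum_filter]
    apply Finset.sum_congr _ fun _ _ => rfl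
    ext k
    simp only [Finset.mem_filter, Finset.mem_range, hdiv]
    constructor
    · exact fun h => h.2
    · intro h; have := hb k h; exact ⟨by omega, h⟩
  rw [hL]
  have hR : ∀ j ∈ Finset.range (a / q + 1),
      ((-1 : K) ^ (a + j) * (((q - 1) * (b - j) - 1).choose (a - q * j) : K)) •
        (∑ k ∈ Finset.range (j + 1), if q * k ≤ a + b - j then
          ((a + b - j + j - (q + 1) * k).choose (j - k) : K) •
            (g.coeff k).coeff (a + b - j + j - (q + 1) * k) else 0) =
      ∑ k ∈ Finset.range (j + 1), ((-1 : K) ^ (a + j) *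
        (((q - 1) * (b - j) - 1).choose (a - q * j) : K) *
          ((a + b - (q + 1) * k).choose (j - k) : K)) •
            (g.coeff k).coeff (a + b - (q + 1) * k) := by
    intro j hj
    have hj' := (hdiv j).1 (Finset.mem_range.1 hj)
    have hjb := hb j hj'
    rw [Finset.smul_sum]
    refine Finset.sum_congr rfl fun k hk => ?_
    have hk' : q * k ≤ q * j := Nat.mul_le_mul_left q (by simpa [Nat.lt_succ_iff] using hk)
    rw [if_pos (by omega), smul_smul, show a + b - j + j = a + b by omega]
  rw [Finset.sum_congr rfl hR, Finset.sum_sigma', Finset.sum_congr rfl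
    (g := fun k => ∑ j ∈ Finset.range ((a - q * k) / q + 1), ((-1 : K) ^ (a + (k + j)) *
        (((q - 1) * (b - (k + j)) - 1).choose (a - q * (k + j)) : K) *
          ((a + b - (q + 1) * k).choose ((k + j) - k) : K)) •
            (g.coeff k).coeff (a + b - (q + 1) * k))]
  · rw [Finset.sum_sigma']
    refine Finset.sum_bij' (fun x _ => ⟨x.1 + x.2, x.1⟩) (fun x _ => ⟨x.2, x.1 - x.2⟩) ?_ ?_ ?_ ?_ ?_
    · rintro ⟨k, j⟩ h
      simp only [Finset.mem_sigma, Finset.mem_range, hdiv] at h ⊢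
      have h2 := (Nat.le_div_iff_mul_le hq).1 (Nat.lt_succ_iff.1 h.2)
      rw [mul_add]
      rw [mul_comm] at h2
      omega
    · rintro ⟨j, k⟩ h
      simp only [Finset.mem_sigma, Finset.mem_range, hdiv] at h ⊢
      have h3 : q * k ≤ q * j := Nat.mul_le_mul_left q (by omega)
      refine ⟨by omega, ?_⟩
      rw [Nat.lt_succ_iff, Nat.le_div_iff_mul_le hq, mul_comm, Nat.mul_sub]
      omega
    · rintro ⟨k, j⟩ h
      simp
    · rintro ⟨j, k⟩ h
      simp only [Finset.mem_sigma, Finset.mem_range] at h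
      simp only [Sigma.mk.injEq, heq_eq_eq, and_true]
      omega
    · rintro ⟨k, j⟩ h
      rfl
  · intro k hk
    have hk' := (hdiv k).1 (Finset.mem_range.1 hk)
    have hkb := hb k hk'
    rw [← Finset.sum_smul]
    congr 1
    have hlt : a - q * k < q * (b - k) := by rw [Nat.mul_sub]; omega
    have hn : a - q * k + (b - k) = a + b - (q + 1) * k := by rw [add_mul, one_mul]; omega
    rw [← hn, ← hadem (a - q * k) (b - k) hlt]
    refine Finset.sum_congr rfl fun j hj => ?_
    have hs : (-1 : K) ^ (a + (k + j)) = (-1 : K) ^ (a - q * k + j) := by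
      have : (-1 : K) ^ (q * k) = (-1) ^ k := by rw [pow_mul, hsign]
      rw [show a + (k + j) = (a - q * k + j) + (q * k + k) by omega, pow_add _ _ (q * k + k),
        pow_add _ (q * k) k, this, ← mul_pow]
      simp
    rw [hs, show b - (k + j) = b - k - j by omega, show k + j - k = j by omega,
      show a - q * (k + j) = a - q * k - q * j by rw [mul_add]; omega]


theorem powerOp_rel (p e : ℕ) [Fact p.Prime] [NeZero e] ⦃x y : FreeAlgebra (GaloisField p e) ℕ⦄
    (h : AdemRel (GaloisField p e) (p ^ e) x y) :
    FreeAlgebra.lift (GaloisField p e) (powerOp (GaloisField p e) (p ^ e)) x =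
      FreeAlgebra.lift (GaloisField p e) (powerOp (GaloisField p e) (p ^ e)) y := by
  cases h with
  | zero => rw [FreeAlgebra.lift_ι_apply, powerOp_zero, map_one]
  | adem a b hab =>
    simp only [map_mul, map_sum, map_smul, FreeAlgebra.lift_ι_apply]
    exact powerOp_adem (GaloisField p e) p e a b hab

/-- The standard action of the algebra of Steenrod `q`th powers on the polynomial algebra
`𝔽_q[x₀, x₁, …]`, in which `P^r` acts as `powerOp`. -/
noncomputable def action (p e : ℕ) [Fact p.Prime] [NeZero e] :
    SteenrodAlgebra p e →ₐ[GaloisField p e] Module.End (GaloisField p e)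
      (MvPolynomial ℕ (GaloisField p e)) :=
  RingQuot.liftAlgHom (GaloisField p e)
    ⟨FreeAlgebra.lift (GaloisField p e) (powerOp (GaloisField p e) (p ^ e)), powerOp_rel p e⟩

theorem action_power (p e : ℕ) [Fact p.Prime] [NeZero e] (r : ℕ) :
    action p e (power p e r) = powerOp (GaloisField p e) (p ^ e) r := by
  unfold action power
  exact (RingQuot.liftAlgHom_mkAlgHom_apply (GaloisField p e) _ _ _).trans
    (FreeAlgebra.lift_ι_apply _ _)

/-! ### Milnor basis elements -/

/-- The power series `xᵢ + ∑_{t ≥ 1} xᵢ ^ (q ^ t) ξ_t` in variables `ξ₁, ξ₂, …`. -/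
noncomputable def milnorSeries (K : Type*) [Field K] (q i : ℕ) :
    MvPowerSeries ℕ+ (MvPolynomial ℕ K) :=
  fun R => if R = 0 then MvPolynomial.X i else
    ∑ t ∈ R.support, if R = Finsupp.single t 1 then MvPolynomial.X i ^ q ^ (t : ℕ) else 0

/-- The total Milnor operation: the algebra homomorphism `xᵢ ↦ xᵢ + ∑_{t ≥ 1} xᵢ ^ (q ^ t) ξ_t`. -/
noncomputable def totalMilnor (K : Type*) [Field K] (q : ℕ) :
    MvPolynomial ℕ K →ₐ[K] MvPowerSeries ℕ+ (MvPolynomial ℕ K) :=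
  MvPolynomial.aeval (milnorSeries K q)

/-- The Milnor operation `P(R) = P(r₁, r₂, …)` on polynomials: the coefficient of
`ξ^R = ξ₁ ^ r₁ ξ₂ ^ r₂ ⋯` in the total Milnor operation. On `x₁ ⋯ xₙ` it is the sum of the monomials
obtained by replacing, for each `t`, exactly `r_t` of the variables `xᵢ` by `xᵢ ^ (q ^ t)`. -/
noncomputable def milnorOp (K : Type*) [Field K] (q : ℕ) (R : ℕ+ →₀ ℕ) :
    Module.End K (MvPolynomial ℕ K) :=
  (MvPowerSeries.coeff (R := MvPolynomial ℕ K) R).restrictScalars K ∘ₗ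
    (totalMilnor K q).toLinearMap

/-- `θ` is the Milnor basis element `P(R)`: it acts on polynomials as the Milnor operation. -/
def IsMilnorElement (p e : ℕ) [Fact p.Prime] [NeZero e] (R : ℕ+ →₀ ℕ)
    (θ : SteenrodAlgebra p e) : Prop :=
  action p e θ = milnorOp (GaloisField p e) (p ^ e) R

/-! ### The Y- and Z-orders and the `P^s_t` monomials

A pair `(s, t)` with `s ≥ 0`, `t ≥ 1` stands for the `q`-atomic number
`p ^ s * (q ^ t - 1) / (q - 1)`. With `s = s' * e + s''`, `0 ≤ s'' < e`, we have `s' = s / e` and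
`s'' = s % e`. -/

/-- The Y-order is the left lexicographic order on the triples `(s', t, s'')`. -/
def yKey (e : ℕ) : ℕ × ℕ+ ↪ ℕ ×ₗ ℕ+ ×ₗ ℕ where
  toFun a := toLex (a.1 / e, toLex (a.2, a.1 % e))
  inj' := by
    rintro ⟨s, t⟩ ⟨u, v⟩ h
    simp only [EmbeddingLike.apply_eq_iff_eq, Prod.mk.injEq] at h
    obtain ⟨h1, h2, h3⟩ := h
    rw [Prod.mk.injEq, ← Nat.div_add_mod s e, ← Nat.div_add_mod u e, h1, h3]
    exact ⟨rfl, h2⟩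

/-- The Z-order is the left lexicographic order on the triples `(s' + t, s', s'')`. -/
def zKey (e : ℕ) : ℕ × ℕ+ ↪ ℕ ×ₗ ℕ ×ₗ ℕ where
  toFun a := toLex (a.1 / e + a.2, toLex (a.1 / e, a.1 % e))
  inj' := by
    rintro ⟨s, t⟩ ⟨u, v⟩ h
    simp only [EmbeddingLike.apply_eq_iff_eq, Prod.mk.injEq] at h
    obtain ⟨h1, h2, h3⟩ := h
    rw [Prod.mk.injEq, ← Nat.div_add_mod s e, ← Nat.div_add_mod u e, h2, h3]
    exact ⟨rfl, PNat.coe_injective (by omega)⟩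

/-- The elements of a finite set, listed in increasing order of an injective key. -/
def sortByKey {α L : Type*} [LinearOrder L] (key : α ↪ L) (S : Finset α) : List α :=
  haveI : IsTrans α (fun a b => key a ≤ key b) := ⟨fun _ _ _ => le_trans⟩
  haveI : Std.Antisymm (fun a b : α => key a ≤ key b) :=
    ⟨fun _ _ h h' => key.injective (le_antisymm h h')⟩
  haveI : Std.Total (fun a b : α => key a ≤ key b) := ⟨fun _ _ => le_total _ _⟩
  S.sort (fun a b => key a ≤ key b)

/-- Multisets of `q`-atomic numbers with all multiplicities at most `p - 1`, given by their
multiplicity functions. -/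
abbrev PstExponent (p : ℕ) : Type := {k : ℕ × ℕ+ →₀ ℕ // ∀ a, k a < p}

/-- The product of the elements `P^s_t = P(0, …, 0, p ^ s)` (with `p ^ s` in position `t`), each
repeated `k (s, t)` times, in increasing order of the key. The argument `P` is the family of Milnor
basis elements. -/
noncomputable def pstMonomial (p : ℕ) {A L : Type*} [Ring A] [LinearOrder L] (key : ℕ × ℕ+ ↪ L)
    (P : (ℕ+ →₀ ℕ) → A) (k : PstExponent p) : A :=
  ((sortByKey key k.1.support).map fun a => P (Finsupp.single a.2 (p ^ a.1)) ^ k.1 a).prod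

/-- The sequence `R = (r₁, r₂, …)` with `r_t = ∑_s k (s, t) * p ^ s`: the coefficient of `p ^ s` in
the base `p` expansion of `r_t` is `k (s, t)`. -/
noncomputable def milnorIndex (p : ℕ) (k : PstExponent p) : ℕ+ →₀ ℕ :=
  k.1.sum fun a n => Finsupp.single a.2 (n * p ^ a.1)

/-- The product of the factorials of the multiplicities. -/
noncomputable def factorialCoeff (p : ℕ) (k : PstExponent p) : ℕ :=
  k.1.prod fun _ n => n.factorial

/-! ### The May filtration -/

theorem augmentation_rel (p e : ℕ) [Fact p.Prime] ⦃x y : FreeAlgebra (GaloisField p e) ℕ⦄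
    (h : AdemRel (GaloisField p e) (p ^ e) x y) :
    FreeAlgebra.lift (GaloisField p e) (fun r => if r = 0 then (1 : GaloisField p e) else 0) x =
      FreeAlgebra.lift (GaloisField p e) (fun r => if r = 0 then 1 else 0) y := by
  cases h with
  | zero => simp
  | adem a b hab =>
    have hb : b ≠ 0 := by rintro rfl; simp at hab
    simp only [map_mul, map_sum, map_smul, FreeAlgebra.lift_ι_apply, if_neg hb, mul_zero]
    symm
    apply Finset.sum_eq_zero
    intro j _
    by_cases hj : j = 0
    · rw [if_neg (show a + b - j ≠ 0 by omega)]; simp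
    · simp [hj]

/-- The augmentation, `P^r ↦ 0` for `r > 0`. -/
noncomputable def augmentation (p e : ℕ) [Fact p.Prime] :
    SteenrodAlgebra p e →ₐ[GaloisField p e] GaloisField p e :=
  RingQuot.liftAlgHom (GaloisField p e)
    ⟨FreeAlgebra.lift (GaloisField p e) (fun r => if r = 0 then 1 else 0), augmentation_rel p e⟩

/-- The augmentation ideal; it is two-sided, being the kernel of a ring homomorphism. -/
noncomputable def augIdeal (p e : ℕ) [Fact p.Prime] : Ideal (SteenrodAlgebra p e) :=
  RingHom.ker (augmentation p e)

/-- The May filtration of `θ`: the largest `m` with `θ` in the `m`-th power of the augmentation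
ideal (`⊤` if there is no largest one). -/
noncomputable def mayFiltration (p e : ℕ) [Fact p.Prime] (θ : SteenrodAlgebra p e) : ℕ∞ :=
  ⨆ m : {m : ℕ // θ ∈ augIdeal p e ^ m}, ((m : ℕ) : ℕ∞)

/-- The `m`-th power of the augmentation ideal, as a vector space. -/
noncomputable abbrev mayPower (p e : ℕ) [Fact p.Prime] (m : ℕ) :
    Submodule (GaloisField p e) (SteenrodAlgebra p e) :=
  (augIdeal p e ^ m).restrictScalars (GaloisField p e)

/-- The graded piece: the `m`-th power of the augmentation ideal modulo the `(m+1)`-st. -/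
abbrev GradedPiece (p e : ℕ) [Fact p.Prime] (m : ℕ) : Type :=
  mayPower p e m ⧸ (mayPower p e (m + 1)).submoduleOf (mayPower p e m)

/-- The graded vector space `E⁰` associated to the May filtration. -/
abbrev E0 (p e : ℕ) [Fact p.Prime] : Type := DirectSum ℕ (GradedPiece p e)

open Classical in
/-- The class of `θ` in the graded piece whose degree is the May filtration of `θ`
(zero if the filtration is infinite: then `toNat` is `0`, and `θ` lies in the augmentation ideal). -/
noncomputable def initialForm (p e : ℕ) [Fact p.Prime] (θ : SteenrodAlgebra p e) : E0 p e :=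
  if h : θ ∈ mayPower p e (mayFiltration p e θ).toNat then
    DirectSum.lof (GaloisField p e) ℕ (GradedPiece p e) (mayFiltration p e θ).toNat
      (Submodule.Quotient.mk ⟨θ, h⟩)
  else 0

end Steenrod

/-! Everything is governed by the weight `w(R) = ∑ t * α(r_t)`, with `α` the base `p` digit sum. The
central fact is that the `m`-th power of the augmentation ideal is exactly the span of the `P(R)`
with `w(R) ≥ m`. Hence the May filtration of `P(R)` is `w(R)`, and the Milnor basis is adapted to
the filtration.

The engine is Milnor's product formula for `P(R) * P(0, …, 0, n)`, obtained by composing total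
operations (`milnorOp_mul_single`). The coefficient of `P(T)` is a product of binomial coefficients,
so it survives mod `p` only if certain base `p` additions have no carry; then `w(T) ≥ w(R) + t *
α(n)` (`IsMilnorSplitting.weight_add_le`). The case `t = 1` shows that right multiplication by
`P^r`, `r > 0`, raises the weight, so the `m`-th power has weight at least `m`
(`action_mem_weightSpan`).

For `n = p^s` the terms of minimal weight can be listed (`IsMilnorSplitting.eq_or`). Two
consequences follow. If no entry of `R` has a digit in the place `s + e * t`, then `P(R) * P^s_t`
has one leading term, the digit of `R` at `(s, t)` plus one, times `P(R + p^s e_t)`. Also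
`[P^{s+et}_i, P^s_t]` is `P^s_{i+t}` up to higher weight. The commutator puts `P^s_t` in the `t`-th
power, and the leading terms extend this to all `P(R)` (`milnorOp_mem_filtration`). Both orders
place `(s, t)` before every `(s + e * t, i)`, so an ordered product has leading term `c_k *
P(R(k))`, the factorials arising from repeated factors (`list_prod_milnorOp`).

It remains to pass from operations to the algebra given by relations, that is, to show that the
action is faithful (`action_injective`). The Adem relations make admissible monomials span. In each
degree they inject into the sequences `R`, while their operations span the linearly independent
Milnor operations; a dimension count makes them independent. The same count turns the triangularity
of the Y- and Z-products into the basis property. -/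

namespace Steenrod

/-! ### Base `p` digits -/

/-- The sum of the base `p` digits of `n`. -/
def digitSum (p n : ℕ) : ℕ := (p.digits n).sum

@[simp] theorem digitSum_zero (p : ℕ) : digitSum p 0 = 0 := by simp [digitSum]

theorem digitSum_le (p n : ℕ) : digitSum p n ≤ n := Nat.digit_sum_le p n

/-- Kummer's theorem: the valuation of the binomial coefficient counts carries, each of which costs
`p - 1` in the digit sum. It follows from Legendre's formula for the valuations of the three
factorials. -/
theorem digitSum_add_eq (p : ℕ) [hp : Fact p.Prime] (a b : ℕ) :
    digitSum p a + digitSum p b =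
      digitSum p (a + b) + (p - 1) * padicValNat p ((a + b).choose a) := by
  have h := Nat.add_choose_mul_factorial_mul_factorial a b
  rw [← Nat.choose_symm_add] at h
  have hv := congrArg (padicValNat p) h
  rw [padicValNat.mul (mul_ne_zero (Nat.choose_ne_zero (Nat.le_add_right a b))
    (Nat.factorial_ne_zero _)) (Nat.factorial_ne_zero _),
    padicValNat.mul (Nat.choose_ne_zero (Nat.le_add_right a b)) (Nat.factorial_ne_zero _)] at hv
  have hv' := congrArg ((p - 1) * ·) hv
  simp only [mul_add, sub_one_mul_padicValNat_factorial] at hv'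
  have h1 := digitSum_le p a
  have h2 := digitSum_le p b
  have h3 := digitSum_le p (a + b)
  unfold digitSum at *
  omega

theorem digitSum_add_le (p : ℕ) [Fact p.Prime] (a b : ℕ) :
    digitSum p (a + b) ≤ digitSum p a + digitSum p b :=
  (digitSum_add_eq p a b).symm ▸ Nat.le_add_right _ _

theorem digitSum_add_iff (p : ℕ) [hp : Fact p.Prime] (a b : ℕ) :
    digitSum p a + digitSum p b = digitSum p (a + b) ↔ ¬ p ∣ (a + b).choose a := by
  have h2 : 2 ≤ p := hp.out.two_le
  have h0 : (a + b).choose a ≠ 0 := Nat.choose_ne_zero (Nat.le_add_right a b)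
  rw [digitSum_add_eq, dvd_iff_padicValNat_ne_zero h0, not_not, Nat.add_eq_left, mul_eq_zero]
  exact ⟨fun h => h.resolve_left (by omega), Or.inr⟩

/-- Lucas' congruence, removing one final digit at a time; those of `p ^ (s + 1)` are `0` and
contribute a factor `1`. -/
theorem choose_prime_pow_modEq (p : ℕ) [hp : Fact p.Prime] (s n : ℕ) :
    n.choose (p ^ s) ≡ n / p ^ s [MOD p] := by
  induction s generalizing n with
  | zero => simp [Nat.ModEq]
  | succ s ih =>
    have h := Choose.choose_modEq_choose_mod_mul_choose_div_nat (n := n) (k := p ^ (s + 1)) (p := p)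
    rw [pow_succ, Nat.mul_mod_left, Nat.choose_zero_right, one_mul,
      Nat.mul_div_cancel _ hp.out.pos] at h
    rw [pow_succ, mul_comm (p ^ s) p, ← Nat.div_div_eq_div_mul, mul_comm p]
    exact h.trans (ih _)

theorem digitSum_mul_prime_pow (p : ℕ) [hp : Fact p.Prime] (s n : ℕ) :
    digitSum p (p ^ s * n) = digitSum p n := by
  rcases Nat.eq_zero_or_pos n with rfl | hn
  · simp
  · rw [digitSum, Nat.digits_base_pow_mul hp.out.one_lt hn]
    simp [digitSum]

@[simp] theorem digitSum_prime_pow (p : ℕ) [hp : Fact p.Prime] (s : ℕ) :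
    digitSum p (p ^ s) = 1 := by
  have := digitSum_mul_prime_pow p s 1
  rw [mul_one] at this
  rw [this, digitSum, Nat.digits_of_lt p 1 one_ne_zero hp.out.one_lt]
  rfl

theorem digitSum_pos (p : ℕ) [Fact p.Prime] {n : ℕ} (hn : n ≠ 0) : 0 < digitSum p n := by
  have h := Nat.getLast_digit_ne_zero p hn
  have h2 := List.single_le_sum (l := p.digits n) (by simp) _
    (List.getLast_mem (Nat.digits_ne_nil_iff_ne_zero.2 hn))
  unfold digitSum
  omega

theorem digitSum_eq_zero_iff (p : ℕ) [Fact p.Prime] {n : ℕ} : digitSum p n = 0 ↔ n = 0 :=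
  ⟨fun h => by_contra fun hn => (digitSum_pos p hn).ne' h, by rintro rfl; simp⟩

/-! ### Degree and weight of a sequence -/

/-- The degree of a Milnor basis element, in units of `q - 1`. -/
noncomputable def milnorDeg (q : ℕ) : (ℕ+ →₀ ℕ) →+ ℕ :=
  Finsupp.liftAddHom fun t => AddMonoidHom.mulRight (∑ j ∈ Finset.range (t : ℕ), q ^ j)

theorem milnorDeg_single (q : ℕ) (t : ℕ+) (n : ℕ) :
    milnorDeg q (Finsupp.single t n) = n * ∑ j ∈ Finset.range (t : ℕ), q ^ j := by
  simp [milnorDeg]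

theorem milnorDeg_single_one (q n : ℕ) : milnorDeg q (Finsupp.single 1 n) = n := by
  simp [milnorDeg_single]

theorem le_sum_range_pow {q : ℕ} (hq : 2 ≤ q) (t : ℕ) : t ≤ ∑ j ∈ Finset.range t, q ^ j := by
  calc t = ∑ j ∈ Finset.range t, 1 := by simp
    _ ≤ _ := Finset.sum_le_sum fun j _ => Nat.one_le_pow _ _ (by omega)

theorem mul_le_milnorDeg {q : ℕ} (hq : 2 ≤ q) (R : ℕ+ →₀ ℕ) (t : ℕ+) :
    R t * t ≤ milnorDeg q R := by
  have h : R = Finsupp.single t (R t) + R.erase t := (Finsupp.single_add_erase t R).symm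
  calc R t * t ≤ R t * ∑ j ∈ Finset.range (t : ℕ), q ^ j :=
        Nat.mul_le_mul_left _ (le_sum_range_pow hq t)
    _ ≤ _ := by
        conv_rhs => rw [h, map_add, milnorDeg_single]
        exact Nat.le_add_right _ _

theorem finite_milnorDeg_le {q : ℕ} (hq : 2 ≤ q) (N : ℕ) :
    {R : ℕ+ →₀ ℕ | milnorDeg q R ≤ N}.Finite := by
  classical
  -- The bound `r_t * t ≤ deg R` confines `R` to a box with sides `N` and positions up to `N`. The
  -- box is taken up to `N + 1` because `N` may be `0`, which is not a position.
  refine Set.Finite.subset (Set.finite_Iic (Finsupp.onFinset (Finset.Icc 1 N.succPNat)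
    (fun t => if t ≤ N.succPNat then N else 0) ?_)) ?_
  · intro t ht
    rw [Finset.mem_Icc]
    refine ⟨one_le, ?_⟩
    by_contra h
    simp [h] at ht
  · intro R hR t
    have h1 := mul_le_milnorDeg hq R t
    have h2 : milnorDeg q R ≤ N := hR
    have h3 := t.pos
    rw [Finsupp.onFinset_apply]
    split_ifs with h
    · nlinarith
    · have h4 : N < t := by
        have : N.succPNat < t := not_le.1 h
        have := PNat.coe_lt_coe _ _ |>.2 this
        simp at this
        omega
      by_contra h5
      nlinarith [Nat.pos_of_ne_zero (show R t ≠ 0 by omega)]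

/-- The weight `∑ t * α(r_t)`, where `α` is the sum of the base `p` digits. -/
noncomputable def mayWeight (p : ℕ) (R : ℕ+ →₀ ℕ) : ℕ := R.sum fun t r => t * digitSum p r

theorem mayWeight_single (p : ℕ) (t : ℕ+) (n : ℕ) :
    mayWeight p (Finsupp.single t n) = t * digitSum p n := by
  simp [mayWeight]

@[simp] theorem mayWeight_zero (p : ℕ) : mayWeight p 0 = 0 := by simp [mayWeight]

theorem mayWeight_eq_sum (p : ℕ) (R : ℕ+ →₀ ℕ) {J : Finset ℕ+} (h : R.support ⊆ J) :
    mayWeight p R = ∑ t ∈ J, t * digitSum p (R t) :=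
  Finsupp.sum_of_support_subset _ h _ (by simp)

theorem mayWeight_add_le (p : ℕ) [Fact p.Prime] (R S : ℕ+ →₀ ℕ) :
    mayWeight p (R + S) ≤ mayWeight p R + mayWeight p S := by
  classical
  rw [mayWeight_eq_sum p (R + S) Finsupp.support_add,
    mayWeight_eq_sum p R Finset.subset_union_left, mayWeight_eq_sum p S Finset.subset_union_right,
    ← Finset.sum_add_distrib]
  refine Finset.sum_le_sum fun t _ => ?_
  rw [← mul_add]
  exact Nat.mul_le_mul_left _ (digitSum_add_le p _ _)

theorem mayWeight_add_of_disjoint (p : ℕ) (R S : ℕ+ →₀ ℕ) (h : Disjoint R.support S.support) :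
    mayWeight p (R + S) = mayWeight p R + mayWeight p S :=
  Finsupp.sum_add_index_of_disjoint h _

/-- Equality means that adding `p ^ s` to `r_t` causes no carry. By Kummer and Lucas this is the
nonvanishing mod `p` of the quotient on the right. -/
theorem mayWeight_add_single_eq_iff (p : ℕ) [Fact p.Prime] (R : ℕ+ →₀ ℕ) (t : ℕ+) (s : ℕ) :
    mayWeight p (R + Finsupp.single t (p ^ s)) = mayWeight p R + t ↔
      ¬ p ∣ (R t + p ^ s) / p ^ s := by
  classical
  have h1 : mayWeight p R = t * digitSum p (R t) + mayWeight p (R.erase t) := by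
    conv_lhs => rw [← Finsupp.single_add_erase t R]
    rw [mayWeight_add_of_disjoint, mayWeight_single]
    exact Finset.disjoint_of_subset_left Finsupp.support_single_subset (by simp)
  have h2 : mayWeight p (R + Finsupp.single t (p ^ s)) =
      t * digitSum p (R t + p ^ s) + mayWeight p (R.erase t) := by
    rw [show R + Finsupp.single t (p ^ s) = Finsupp.single t (R t + p ^ s) + R.erase t by
      conv_lhs => rw [← Finsupp.single_add_erase t R]
      rw [Finsupp.single_add]; abel, mayWeight_add_of_disjoint, mayWeight_single]
    exact Finset.disjoint_of_subset_left Finsupp.support_single_subset (by simp)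
  have h3 := digitSum_add_iff p (p ^ s) (R t)
  rw [digitSum_prime_pow, add_comm (p ^ s)] at h3
  rw [← ((choose_prime_pow_modEq p s (R t + p ^ s)).dvd_iff dvd_rfl), ← h3, h1, h2]
  constructor
  · intro h
    exact Nat.eq_of_mul_eq_mul_left t.pos (by linarith)
  · intro h
    rw [← h]; ring

/-- In a fixed degree the weight is bounded, so inductions that replace an operation by operations
of higher weight terminate. -/
theorem mayWeight_le_milnorDeg {q : ℕ} (hq : 2 ≤ q) (p : ℕ) (R : ℕ+ →₀ ℕ) :
    mayWeight p R ≤ milnorDeg q R := by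
  simp only [mayWeight, milnorDeg, Finsupp.liftAddHom_apply]
  refine Finset.sum_le_sum fun t _ => ?_
  simp only [AddMonoidHom.coe_mulRight]
  rw [mul_comm]
  exact Nat.mul_le_mul (digitSum_le p _) (le_sum_range_pow hq t)

/-! ### The product of a Milnor operation with a Milnor operation of length one -/

section Product

variable {K : Type*} [Field K]

theorem milnorOp_apply (q : ℕ) (R : ℕ+ →₀ ℕ) (f : MvPolynomial ℕ K) :
    milnorOp K q R f = MvPowerSeries.coeff R (totalMilnor K q f) := rfl

open Classical in
theorem milnorOp_mul (q : ℕ) (R : ℕ+ →₀ ℕ) (f g : MvPolynomial ℕ K) :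
    milnorOp K q R (f * g) = ∑ x ∈ Finset.HasAntidiagonal.antidiagonal R,
      milnorOp K q x.1 f * milnorOp K q x.2 g := by
  simp only [milnorOp_apply, map_mul]
  exact MvPowerSeries.coeff_mul _ _ _

theorem milnorOp_C (q : ℕ) (R : ℕ+ →₀ ℕ) (a : K) :
    milnorOp K q R (MvPolynomial.C a) = if R = 0 then MvPolynomial.C a else 0 := by
  classical
  rw [milnorOp_apply, ← MvPolynomial.algebraMap_eq, AlgHom.commutes,
    MvPowerSeries.algebraMap_apply, MvPowerSeries.coeff_C]

theorem milnorOp_X (q : ℕ) (R : ℕ+ →₀ ℕ) (i : ℕ) :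
    milnorOp K q R (MvPolynomial.X i) = if R = 0 then MvPolynomial.X i else
      ∑ t ∈ R.support, if R = Finsupp.single t 1 then MvPolynomial.X i ^ q ^ (t : ℕ) else 0 := by
  rw [milnorOp_apply, totalMilnor, MvPolynomial.aeval_X]
  rfl

theorem milnorOp_X_eq_sum (q : ℕ) {R : ℕ+ →₀ ℕ} {J : Finset ℕ+} (h : R.support ⊆ J) (i : ℕ) :
    milnorOp K q R (MvPolynomial.X i) = (if R = 0 then MvPolynomial.X i else 0) +
      ∑ t ∈ J, if R = Finsupp.single t 1 then MvPolynomial.X i ^ q ^ (t : ℕ) else 0 := by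
  rw [milnorOp_X]
  split_ifs with h0
  · subst h0
    rw [Finset.sum_eq_zero, add_zero]
    intro t _
    rw [if_neg]
    intro h
    simpa using (DFunLike.congr_fun h t).symm
  · rw [zero_add]
    refine Finset.sum_subset h fun t _ ht => if_neg ?_
    rintro rfl
    simp at ht

/-- The total Milnor operation with all variables `ξ_j`, `j ∉ J`, set to zero. -/
noncomputable def truncTotal (K : Type*) [Field K] (q : ℕ) (J : Finset ℕ+) :
    MvPolynomial ℕ K →ₐ[K] MvPolynomial ℕ+ (MvPolynomial ℕ K) :=
  MvPolynomial.aeval fun i => MvPolynomial.C (MvPolynomial.X i) +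
    ∑ j ∈ J, MvPolynomial.C (MvPolynomial.X i ^ q ^ (j : ℕ)) * MvPolynomial.X j

open Classical in
-- Keeping finitely many `ξ_j` replaces power series by polynomials, into which one can substitute
-- freely, and loses no coefficient of a monomial supported in `J`.
theorem coeff_truncTotal (q : ℕ) (J : Finset ℕ+) (f : MvPolynomial ℕ K) (R : ℕ+ →₀ ℕ) :
    (truncTotal K q J f).coeff R = if R.support ⊆ J then milnorOp K q R f else 0 := by
  induction f using MvPolynomial.induction_on generalizing R with
  | C a =>
    rw [milnorOp_C, ← MvPolynomial.algebraMap_eq, AlgHom.commutes,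
      show algebraMap K (MvPolynomial ℕ+ (MvPolynomial ℕ K)) a =
        MvPolynomial.C (algebraMap K (MvPolynomial ℕ K) a) from rfl, MvPolynomial.coeff_C]
    by_cases h : R = 0
    · subst h; simp
    · simp [h, Ne.symm h]
  | add f g hf hg =>
    rw [map_add, MvPolynomial.coeff_add, hf, hg, map_add]
    split_ifs <;> simp
  | mul_X f i hf =>
    have hX : ∀ R : ℕ+ →₀ ℕ, (truncTotal K q J (MvPolynomial.X i)).coeff R =
        if R.support ⊆ J then milnorOp K q R (MvPolynomial.X i) else 0 := by
      intro R
      rw [truncTotal, MvPolynomial.aeval_X, MvPolynomial.coeff_add, MvPolynomial.coeff_C,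
        MvPolynomial.coeff_sum]
      simp only [MvPolynomial.coeff_C_mul, MvPolynomial.coeff_X, mul_ite, mul_one, mul_zero]
      split_ifs with h0 hR hR
      · rw [milnorOp_X_eq_sum q hR, if_pos h0.symm]
        simp only [eq_comm]
      · subst h0; simp at hR
      · rw [milnorOp_X_eq_sum q hR, if_neg (Ne.symm h0), zero_add, zero_add]
        simp only [eq_comm]
      · rw [zero_add, Finset.sum_eq_zero]
        intro t ht
        rw [if_neg]
        rintro rfl
        exact hR (Finsupp.support_single_subset.trans (by simpa using ht))
    rw [map_mul, MvPolynomial.coeff_mul]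
    simp only [hf, hX]
    split_ifs with hR
    · rw [milnorOp_mul]
      refine Finset.sum_congr rfl fun x hx => ?_
      rw [Finset.HasAntidiagonal.mem_antidiagonal] at hx
      have h1 : x.1 ≤ R := hx ▸ le_self_add
      have h2 : x.2 ≤ R := hx ▸ le_add_self
      rw [if_pos ((Finsupp.support_mono h1).trans hR), if_pos ((Finsupp.support_mono h2).trans hR)]
    · refine Finset.sum_eq_zero fun x hx => ?_
      rw [Finset.HasAntidiagonal.mem_antidiagonal] at hx
      by_cases h1 : x.1.support ⊆ J
      · rw [if_neg (c := x.2.support ⊆ J), mul_zero]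
        intro h2
        exact hR (hx ▸ Finsupp.support_add.trans (Finset.union_subset h1 h2))
      · rw [if_neg h1, zero_mul]

/-- The total operation `xᵢ ↦ xᵢ + xᵢ ^ (q ^ t) * X`. -/
noncomputable def singleTotal (K : Type*) [Field K] (q : ℕ) (t : ℕ+) :
    MvPolynomial ℕ K →ₐ[K] Polynomial (MvPolynomial ℕ K) :=
  MvPolynomial.aeval fun i => Polynomial.C (MvPolynomial.X i) +
    Polynomial.C (MvPolynomial.X i ^ q ^ (t : ℕ)) * Polynomial.X

theorem coeff_singleTotal (q : ℕ) (t : ℕ+) (f : MvPolynomial ℕ K) (n : ℕ) :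
    (singleTotal K q t f).coeff n = milnorOp K q (Finsupp.single t n) f := by
  classical
  induction f using MvPolynomial.induction_on generalizing n with
  | C a =>
    rw [milnorOp_C, ← MvPolynomial.algebraMap_eq, AlgHom.commutes, Polynomial.algebraMap_apply,
      Polynomial.coeff_C]
    simp
  | add f g hf hg => rw [map_add, Polynomial.coeff_add, hf, hg, map_add]
  | mul_X f i hf =>
    have hX : ∀ n, (singleTotal K q t (MvPolynomial.X i)).coeff n =
        milnorOp K q (Finsupp.single t n) (MvPolynomial.X i) := by
      intro n
      rw [milnorOp_X_eq_sum q Finsupp.support_single_subset, singleTotal, MvPolynomial.aeval_X,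
        Polynomial.coeff_add, Polynomial.coeff_C, Polynomial.coeff_C_mul, Polynomial.coeff_X,
        Finset.sum_singleton]
      simp only [Finsupp.single_eq_zero, mul_ite, mul_one, mul_zero,
        (Finsupp.single_injective t).eq_iff, eq_comm]
    rw [map_mul, Polynomial.coeff_mul, milnorOp_mul, Finsupp.antidiagonal_single, Finset.sum_map]
    refine Finset.sum_congr rfl fun x _ => ?_
    rw [hf, hX]
    rfl

theorem powerOp_eq_milnorOp (q n : ℕ) : powerOp K q n = milnorOp K q (Finsupp.single 1 n) := by
  refine LinearMap.ext fun f => ?_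
  rw [← coeff_singleTotal, powerOp_apply]
  simp [singleTotal, totalPower]

theorem milnorOp_zero (q : ℕ) : milnorOp K q 0 = 1 := by
  rw [← powerOp_zero K q, powerOp_eq_milnorOp, Finsupp.single_zero]

/-- The coefficient of `Y` in the image of `ξ_m` under `ξ_m ↦ ξ_m + ξ_{m - t} ^ (q ^ t) * Y`, with
`ξ_0 = 1` and with all variables `ξ_j`, `j ∉ J`, set to zero. -/
noncomputable def coprodTail (K : Type*) [Field K] (q : ℕ) (t : ℕ+) (J : Finset ℕ+) (m : ℕ+) :
    MvPolynomial ℕ+ K :=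
  (if m = t then 1 else 0) + ∑ i ∈ J, if m = i + t then MvPolynomial.X i ^ q ^ (t : ℕ) else 0

/-- The image of `ξ_m` under the coproduct `ξ_m ↦ ξ_m + ξ_{m - t} ^ (q ^ t) * Y`, with
`ξ_0 = 1` and with all variables `ξ_j`, `j ∉ J`, set to zero. -/
noncomputable def coprodGen (K : Type*) [Field K] (q : ℕ) (t : ℕ+) (J : Finset ℕ+) (m : ℕ+) :
    Polynomial (MvPolynomial ℕ+ K) :=
  Polynomial.C (if m ∈ J then MvPolynomial.X m else 0) +
    Polynomial.C (coprodTail K q t J m) * Polynomial.X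

/-- The image of the monomial `ξ^T` under the coproduct. -/
noncomputable def coprod (K : Type*) [Field K] (q : ℕ) (t : ℕ+) (J : Finset ℕ+) (T : ℕ+ →₀ ℕ) :
    Polynomial (MvPolynomial ℕ+ K) :=
  T.prod fun m k => coprodGen K q t J m ^ k

/-- Two total operations in succession are again a total operation, with the `ξ_m` replaced by their
coproducts. On `x_i` this is additivity of the `q ^ t`-th power: it sends `x_i ^ (q ^ j) * ξ_j` to
`x_i ^ (q ^ (j + t)) * ξ_j ^ (q ^ t)`. The positions that occur are `t`, those of `J`, and those of
`J` shifted by `t`. -/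
theorem map_truncTotal_singleTotal (p e : ℕ) [Fact p.Prime] [CharP K p] (t : ℕ+) (J : Finset ℕ+) :
    (Polynomial.mapRingHom (truncTotal K (p ^ e) J).toRingHom).comp
        (singleTotal K (p ^ e) t).toRingHom =
      (MvPolynomial.eval₂Hom (Polynomial.C.comp MvPolynomial.C) fun m =>
        Polynomial.mapRingHom (MvPolynomial.map MvPolynomial.C)
          (coprodGen K (p ^ e) t J m)).comp
        (truncTotal K (p ^ e) (insert t (J ∪ J.image (· + t)))).toRingHom := by
  classical
  apply MvPolynomial.ringHom_ext
  · intro r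
    simp only [RingHom.comp_apply, AlgHom.toRingHom_eq_coe, RingHom.coe_coe,
      ← MvPolynomial.algebraMap_eq, AlgHom.commutes, Polynomial.algebraMap_apply]
    rw [show algebraMap K (MvPolynomial ℕ+ (MvPolynomial ℕ K)) r =
        MvPolynomial.C (algebraMap K (MvPolynomial ℕ K) r) from rfl]
    simp
  · intro i
    have hfr : ∀ x : Polynomial (MvPolynomial ℕ+ (MvPolynomial ℕ K)), ∀ g : ℕ+ → _,
        (x + ∑ j ∈ J, g j) ^ (p ^ e) ^ (t : ℕ) =
          x ^ (p ^ e) ^ (t : ℕ) + ∑ j ∈ J, g j ^ (p ^ e) ^ (t : ℕ) := by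
      intro x g
      rw [← pow_mul, add_pow_char_pow, sum_pow_char_pow]
    have hJ : ∀ g : ℕ+ → Polynomial (MvPolynomial ℕ+ (MvPolynomial ℕ K)),
        ∑ m ∈ insert t (J ∪ J.image (· + t)), (if m ∈ J then g m else 0) = ∑ m ∈ J, g m := by
      intro g
      rw [← Finset.sum_filter]
      refine Finset.sum_congr ?_ fun _ _ => rfl
      ext m
      simp only [Finset.mem_filter, Finset.mem_insert, Finset.mem_union]
      tauto
    have ht : ∀ g : ℕ+ → Polynomial (MvPolynomial ℕ+ (MvPolynomial ℕ K)),
        ∑ m ∈ insert t (J ∪ J.image (· + t)), (if m = t then g m else 0) = g t := by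
      intro g
      rw [Finset.sum_ite_eq', if_pos (by simp)]
    have hi : ∀ j ∈ J, ∀ g : ℕ+ → Polynomial (MvPolynomial ℕ+ (MvPolynomial ℕ K)),
        ∑ m ∈ insert t (J ∪ J.image (· + t)), (if m = j + t then g m else 0) = g (j + t) := by
      intro j hj g
      rw [Finset.sum_ite_eq', if_pos]
      simp only [Finset.mem_insert, Finset.mem_union, Finset.mem_image]
      exact Or.inr (Or.inr ⟨j, hj, rfl⟩)
    have hterm : ∀ m : ℕ+, Polynomial.C (MvPolynomial.C (MvPolynomial.X i ^ (p ^ e) ^ (m : ℕ))) *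
        Polynomial.mapRingHom (MvPolynomial.map MvPolynomial.C) (coprodGen K (p ^ e) t J m) =
        (if m ∈ J then Polynomial.C (MvPolynomial.C (MvPolynomial.X i ^ (p ^ e) ^ (m : ℕ)) *
          MvPolynomial.X m) else 0) +
        (if m = t then Polynomial.C (MvPolynomial.C (MvPolynomial.X i ^ (p ^ e) ^ (m : ℕ))) *
          Polynomial.X else 0) +
        ∑ j ∈ J, (if m = j + t then
          Polynomial.C (MvPolynomial.C (MvPolynomial.X i ^ (p ^ e) ^ (m : ℕ)) *
            MvPolynomial.X j ^ (p ^ e) ^ (t : ℕ)) * Polynomial.X else 0) := by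
      intro m
      simp only [coprodGen, coprodTail, map_add, map_mul, map_sum, Polynomial.coe_mapRingHom,
        Polynomial.map_C, Polynomial.map_X, mul_add, add_mul, Finset.mul_sum, Finset.sum_mul,
        ← add_assoc]
      congr 1
      · congr 1
        · split_ifs <;> simp
        · split_ifs <;> simp
      · refine Finset.sum_congr rfl fun j _ => ?_
        split_ifs <;> simp [mul_assoc]
    simp only [RingHom.comp_apply, AlgHom.toRingHom_eq_coe, RingHom.coe_coe]
    rw [singleTotal, truncTotal, MvPolynomial.aeval_X, truncTotal, MvPolynomial.aeval_X]
    simp only [map_add, map_mul, map_sum, MvPolynomial.coe_eval₂Hom, MvPolynomial.eval₂_C,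
      MvPolynomial.eval₂_X, RingHom.comp_apply, Polynomial.coe_mapRingHom, Polynomial.map_C,
      Polynomial.map_X, RingHom.coe_coe, map_pow, MvPolynomial.aeval_X, hfr] at hterm ⊢
    simp only [hterm, Finset.sum_add_distrib, hJ, ht]
    rw [Finset.sum_comm]
    rw [Finset.sum_congr rfl fun j hj => hi j hj _]
    simp only [mul_pow, ← pow_mul, ← pow_add, PNat.add_coe, add_mul, Finset.sum_mul, mul_add]
    simp only [add_assoc, mul_assoc]

theorem coprod_eq_zero (q : ℕ) (t : ℕ+) (J : Finset ℕ+) {T : ℕ+ →₀ ℕ} {m : ℕ+} (hm : T m ≠ 0)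
    (h1 : m ∉ J) (h2 : m ≠ t) (h3 : ∀ j ∈ J, m ≠ j + t) : coprod K q t J T = 0 := by
  refine Finset.prod_eq_zero (Finsupp.mem_support_iff.2 hm) ?_
  have : coprodGen K q t J m = 0 := by
    rw [coprodGen, coprodTail, if_neg h1, if_neg h2,
      Finset.sum_eq_zero fun j hj => if_neg (h3 j hj)]
    simp
  simp only [this]
  exact zero_pow hm

/-- Milnor's product formula in dual form: the coefficient of `P(T)` in the product is that of `ξ^R
* Y^n` in the coproduct of `ξ^T`. It is read off by comparing coefficients in
`map_truncTotal_singleTotal`. -/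
theorem milnorOp_mul_single (p e : ℕ) [Fact p.Prime] [CharP K p] (t : ℕ+) (n : ℕ)
    (R : ℕ+ →₀ ℕ) (J : Finset ℕ+) (hJ : R.support ⊆ J) (D : Finset (ℕ+ →₀ ℕ))
    (hD : ∀ T, ((coprod K (p ^ e) t J T).coeff n).coeff R ≠ 0 → T ∈ D) :
    milnorOp K (p ^ e) R * milnorOp K (p ^ e) (Finsupp.single t n) =
      ∑ T ∈ D, ((coprod K (p ^ e) t J T).coeff n).coeff R • milnorOp K (p ^ e) T := by
  classical
  refine LinearMap.ext fun f => ?_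
  set J' := insert t (J ∪ J.image (· + t)) with hJ'
  have h := RingHom.congr_fun (map_truncTotal_singleTotal (K := K) p e t J) f
  simp only [RingHom.comp_apply, AlgHom.toRingHom_eq_coe, RingHom.coe_coe] at h
  rw [← hJ'] at h
  have h1 := congrArg (fun g => (Polynomial.coeff g n).coeff R) h
  simp only [Polynomial.coe_mapRingHom, Polynomial.coeff_map, RingHom.coe_coe, coeff_singleTotal,
    MvPolynomial.coe_eval₂Hom, MvPolynomial.eval₂_eq] at h1
  rw [coeff_truncTotal, if_pos hJ] at h1
  rw [Module.End.mul_apply, h1, LinearMap.sum_apply, Polynomial.finsetSum_coeff,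
    MvPolynomial.coeff_sum]
  have hterm : ∀ T, ((((Polynomial.C.comp MvPolynomial.C)
      ((truncTotal K (p ^ e) J' f).coeff T) * ∏ i ∈ T.support,
        Polynomial.map (MvPolynomial.map MvPolynomial.C) (coprodGen K (p ^ e) t J i) ^ T i).coeff
          n).coeff R : MvPolynomial ℕ K) =
      ((coprod K (p ^ e) t J T).coeff n).coeff R • (truncTotal K (p ^ e) J' f).coeff T := by
    intro T
    have : ∏ i ∈ T.support,
        Polynomial.map (MvPolynomial.map MvPolynomial.C) (coprodGen K (p ^ e) t J i) ^ T i =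
        Polynomial.map (MvPolynomial.map (MvPolynomial.C : K →+* MvPolynomial ℕ K))
          (coprod K (p ^ e) t J T) := by
      rw [coprod, Finsupp.prod, Polynomial.map_prod]
      simp only [Polynomial.map_pow]
    rw [this, RingHom.comp_apply, Polynomial.coeff_C_mul, MvPolynomial.coeff_C_mul,
      Polynomial.coeff_map, MvPolynomial.coeff_map, mul_comm, MvPolynomial.smul_eq_C_mul]
  rw [Finset.sum_congr rfl fun T _ => hterm T]
  -- One sum runs over the support of the total operation on `f`, the other over `D`; both are
  -- extended by zero terms to the union.
  rw [Finset.sum_subset (Finset.subset_union_left (s₂ := D)), eq_comm,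
    Finset.sum_subset (Finset.subset_union_right (s₁ := (truncTotal K (p ^ e) J' f).support))]
  · refine Finset.sum_congr rfl fun T _ => ?_
    rw [LinearMap.smul_apply, coeff_truncTotal]
    split_ifs with hT
    · rfl
    · obtain ⟨m, hm, hmJ⟩ := Finset.not_subset.1 hT
      simp only [hJ', Finset.mem_insert, Finset.mem_union, Finset.mem_image, not_or, not_exists,
        not_and] at hmJ
      rw [coprod_eq_zero _ _ _ (Finsupp.mem_support_iff.1 hm) hmJ.2.1 hmJ.1
        fun j hj h => hmJ.2.2 j hj h.symm]
      simp
  · intro T _ hT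
    rw [not_not.1 (mt (hD T) hT), zero_smul, LinearMap.zero_apply]
  · intro T _ hT
    rw [MvPolynomial.notMem_support_iff.1 hT, smul_zero]

end Product

/-! ### Nonzero coefficients of the coproduct and their effect on the weight -/

section Coefficients

variable {K : Type*} [Field K]

theorem coeff_linear_pow {A : Type*} [CommRing A] (a b : A) (k n : ℕ) :
    ((Polynomial.C a + Polynomial.C b * Polynomial.X) ^ k).coeff n =
      a ^ (k - n) * b ^ n * (k.choose n : A) := by
  rw [add_comm, add_pow, Polynomial.finsetSum_coeff]
  have h : ∀ j, ((Polynomial.C b * Polynomial.X) ^ j * Polynomial.C a ^ (k - j) *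
      (k.choose j : Polynomial A)).coeff n =
      if j = n then a ^ (k - j) * b ^ j * (k.choose j : A) else 0 := by
    intro j
    rw [show (Polynomial.C b * Polynomial.X) ^ j * Polynomial.C a ^ (k - j) *
      (k.choose j : Polynomial A) =
      Polynomial.C (a ^ (k - j) * b ^ j * (k.choose j : A)) * Polynomial.X ^ j by
        simp only [map_mul, map_pow, map_natCast]; ring, Polynomial.coeff_C_mul,
      Polynomial.coeff_X_pow]
    by_cases hj : j = n
    · simp [hj]
    · simp [hj, Ne.symm hj]
  rw [Finset.sum_congr rfl fun j _ => h j, Finset.sum_ite_eq']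
  split_ifs with hn
  · rfl
  · rw [Nat.choose_eq_zero_of_lt (by simpa using hn)]
    simp

theorem coprodTail_self (q : ℕ) (t : ℕ+) (J : Finset ℕ+) : coprodTail K q t J t = 1 := by
  rw [coprodTail, if_pos rfl, Finset.sum_eq_zero, add_zero]
  intro i _
  rw [if_neg]
  exact (PNat.lt_add_left t i).ne

theorem coprodTail_add (q : ℕ) (i t : ℕ+) (J : Finset ℕ+) :
    coprodTail K q t J (i + t) = if i ∈ J then MvPolynomial.X i ^ q ^ (t : ℕ) else 0 := by
  rw [coprodTail, if_neg (PNat.lt_add_left t i).ne', zero_add]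
  simp only [add_left_inj, Finset.sum_ite_eq]

theorem coprodTail_cases (q : ℕ) (t : ℕ+) (J : Finset ℕ+) (m : ℕ+) :
    (m = t ∧ coprodTail K q t J m = 1) ∨
      (∃ i, m = i + t ∧ coprodTail K q t J m = MvPolynomial.X i ^ q ^ (t : ℕ)) ∨
      coprodTail K q t J m = 0 := by
  rcases lt_trichotomy m t with h | rfl | h
  · refine Or.inr (Or.inr ?_)
    rw [coprodTail, if_neg h.ne, zero_add, Finset.sum_eq_zero]
    intro i _
    rw [if_neg]
    rintro rfl
    exact (h.trans (PNat.lt_add_left t i)).false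
  · exact Or.inl ⟨rfl, coprodTail_self _ _ _⟩
  · obtain ⟨i, rfl⟩ : ∃ i, m = i + t := ⟨m - t, by rw [add_comm, PNat.add_sub_of_lt h]⟩
    by_cases hi : i ∈ J
    · exact Or.inr (Or.inl ⟨i, rfl, by rw [coprodTail_add, if_pos hi]⟩)
    · exact Or.inr (Or.inr (by rw [coprodTail_add, if_neg hi]))

/-- The exponents `(R, n)` of a monomial occurring in the coproduct of `ξ^T` without any carry in
the base `p` addition of the pieces. -/
def IsMilnorSplitting (p q : ℕ) (t : ℕ+) (T R : ℕ+ →₀ ℕ) (n : ℕ) (z : ℕ+ →₀ ℕ) (x₀ : ℕ)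
    (x : ℕ+ →₀ ℕ) : Prop :=
  T = z + Finsupp.single t x₀ + x.mapDomain (· + t) ∧ R = z + q ^ (t : ℕ) • x ∧
    n = x₀ + x.degree ∧
    mayWeight p z + t * digitSum p x₀ + mayWeight p (x.mapDomain (· + t)) ≤ mayWeight p T

/-- The coefficient contains `k.choose n`, so its nonvanishing means that `n + (k - n)` is added
without carry and the weight of `ξ_m ^ k` splits. The `n` factors with `Y` contribute to `x₀` if `m
= t` and to the entry `i` of `x` if `m = i + t`; otherwise `n = 0`. -/
theorem coeff_coprodGen_ne_zero (p q : ℕ) [Fact p.Prime] [CharP K p] (t : ℕ+) (J : Finset ℕ+)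
    (m : ℕ+) (k n : ℕ) (R : ℕ+ →₀ ℕ)
    (h : ((coprodGen K q t J m ^ k).coeff n).coeff R ≠ 0) :
    ∃ z x₀ x, IsMilnorSplitting p q t (Finsupp.single m k) R n z x₀ x := by
  rw [coprodGen, coeff_linear_pow, mul_comm, ← map_natCast (MvPolynomial.C (σ := ℕ+) (R := K)),
    MvPolynomial.coeff_C_mul] at h
  have hc : ¬ p ∣ k.choose n := fun hd => left_ne_zero_of_mul h ((CharP.cast_eq_zero_iff K p _).2 hd)
  have hn : n ≤ k := by
    by_contra hlt
    exact hc (by rw [Nat.choose_eq_zero_of_lt (not_le.1 hlt)]; exact dvd_zero p)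
  have hd : digitSum p n + digitSum p (k - n) = digitSum p k := by
    conv_rhs => rw [← Nat.add_sub_cancel' hn]
    rw [digitSum_add_iff, Nat.add_sub_cancel' hn]
    exact hc
  have h2 := right_ne_zero_of_mul h
  have ha : (if m ∈ J then (MvPolynomial.X m : MvPolynomial ℕ+ K) else 0) ^ (k - n) =
      MvPolynomial.monomial (Finsupp.single m (k - n)) 1 ∨
      (if m ∈ J then (MvPolynomial.X m : MvPolynomial ℕ+ K) else 0) ^ (k - n) = 0 := by
    split_ifs
    · exact Or.inl (MvPolynomial.X_pow_eq_monomial)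
    · by_cases h0 : k - n = 0
      · left; simp [h0]
      · right; exact zero_pow h0
  rcases ha with ha | ha
  swap
  · simp [ha] at h2
  rw [ha] at h2
  have hw : mayWeight p (Finsupp.single m (k - n)) + m * digitSum p n =
      mayWeight p (Finsupp.single m k) := by
    rw [mayWeight_single, mayWeight_single, ← mul_add, add_comm (digitSum p _), hd]
  rcases coprodTail_cases (K := K) q t J m with ⟨rfl, hb⟩ | ⟨i, rfl, hb⟩ | hb
  · rw [hb, one_pow, mul_one, MvPolynomial.coeff_monomial] at h2
    refine ⟨Finsupp.single m (k - n), n, 0, ?_, ?_, by simp, by simpa using hw.le⟩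
    · rw [Finsupp.mapDomain_zero, add_zero, ← Finsupp.single_add, Nat.sub_add_cancel hn]
    · by_contra h'
      refine h2 (if_neg fun h'' => h' ?_)
      rw [← h'']
      simp
  · rw [hb, ← pow_mul, MvPolynomial.X_pow_eq_monomial, MvPolynomial.monomial_mul,
      MvPolynomial.coeff_monomial] at h2
    refine ⟨Finsupp.single (i + t) (k - n), 0, Finsupp.single i n, ?_, ?_, by simp, ?_⟩
    · rw [Finsupp.mapDomain_single, Finsupp.single_zero, add_zero, ← Finsupp.single_add,
        Nat.sub_add_cancel hn]
    · by_contra h'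
      refine h2 (if_neg fun h'' => h' ?_)
      rw [← h'']
      simp
    · rw [Finsupp.mapDomain_single, mayWeight_single p (i + t) n]
      simpa using hw.le
  · rw [hb] at h2
    have h0 : n = 0 := by
      by_contra h0
      simp [zero_pow h0] at h2
    subst h0
    rw [pow_zero, mul_one, MvPolynomial.coeff_monomial] at h2
    refine ⟨Finsupp.single m k, 0, 0, by simp, ?_, by simp, by simp⟩
    by_contra h'
    refine h2 (if_neg fun h'' => h' ?_)
    rw [← h'']
    simp

/-- The entries of `T` split independently. The weight is additive over the entries of `T` but only
subadditive over the pieces, which is why `IsMilnorSplitting` carries an inequality. -/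
theorem coeff_coprod_ne_zero (p q : ℕ) [Fact p.Prime] [CharP K p] (t : ℕ+) (J : Finset ℕ+)
    (T : ℕ+ →₀ ℕ) (n : ℕ) (R : ℕ+ →₀ ℕ) (h : ((coprod K q t J T).coeff n).coeff R ≠ 0) :
    ∃ z x₀ x, IsMilnorSplitting p q t T R n z x₀ x := by
  classical
  induction T using Finsupp.induction generalizing n R with
  | zero =>
    rw [coprod, Finsupp.prod_zero_index, Polynomial.coeff_one] at h
    split_ifs at h with hn
    · rw [MvPolynomial.coeff_one] at h
      refine ⟨0, 0, 0, by simp, ?_, by simp [hn], by simp⟩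
      by_contra h'
      refine h (if_neg fun h'' => h' ?_)
      rw [← h'']
      simp
    · simp at h
  | single_add m k T hm hk ih =>
    rw [coprod, Finsupp.prod_add_index_of_disjoint, Finsupp.prod_single_index (by simp),
      Polynomial.coeff_mul, MvPolynomial.coeff_sum] at h
    · obtain ⟨⟨n1, n2⟩, hn, h⟩ := Finset.exists_ne_zero_of_sum_ne_zero h
      rw [MvPolynomial.coeff_mul] at h
      obtain ⟨⟨R1, R2⟩, hR, h⟩ := Finset.exists_ne_zero_of_sum_ne_zero h
      rw [Finset.HasAntidiagonal.mem_antidiagonal] at hn hR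
      simp only at hn hR
      obtain ⟨z, x₀, x, a1, a2, a3, a4⟩ :=
        coeff_coprodGen_ne_zero p q t J m k n1 R1 (left_ne_zero_of_mul h)
      obtain ⟨z', x₀', x', b1, b2, b3, b4⟩ := ih n2 R2 (right_ne_zero_of_mul h)
      refine ⟨z + z', x₀ + x₀', x + x', ?_, ?_, ?_, ?_⟩
      · rw [a1, b1, Finsupp.mapDomain_add, Finsupp.single_add]; abel
      · rw [← hR, a2, b2, smul_add]; abel
      · rw [← hn, a3, b3, map_add]; ring
      · have c1 := mayWeight_add_le p z z'
        have c2 := Nat.mul_le_mul_left (t : ℕ) (digitSum_add_le p x₀ x₀')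
        have c3 := mayWeight_add_le p (x.mapDomain (· + t)) (x'.mapDomain (· + t))
        have c4 := mayWeight_add_of_disjoint p (Finsupp.single m k) T
          (Finset.disjoint_of_subset_left Finsupp.support_single_subset (by simpa using hm))
        rw [← Finsupp.mapDomain_add] at c3
        linarith
    · exact Finset.disjoint_of_subset_left Finsupp.support_single_subset (by simpa using hm)

variable {p q : ℕ} {t : ℕ+} {T R z x : ℕ+ →₀ ℕ} {n x₀ : ℕ}

theorem IsMilnorSplitting.deg_eq (h : IsMilnorSplitting p q t T R n z x₀ x) :
    milnorDeg q T = milnorDeg q R + n * ∑ j ∈ Finset.range (t : ℕ), q ^ j := by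
  obtain ⟨rfl, rfl, rfl, -⟩ := h
  have hx : milnorDeg q (x.mapDomain (· + t)) =
      q ^ (t : ℕ) * milnorDeg q x + x.degree * ∑ j ∈ Finset.range (t : ℕ), q ^ j := by
    induction x using Finsupp.induction_linear with
    | zero => simp
    | add x y hx hy => rw [Finsupp.mapDomain_add, map_add, map_add, hx, hy, map_add]; ring
    | single i k =>
      rw [Finsupp.mapDomain_single, milnorDeg_single, milnorDeg_single, PNat.add_coe,
        add_comm (i : ℕ), Finset.sum_range_add]
      simp only [pow_add, ← Finset.mul_sum, Finsupp.degree_single]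
      ring
  simp only [map_add, map_nsmul, milnorDeg_single, hx, smul_eq_mul]
  ring

/-- The sum of the digit sums of the entries. -/
noncomputable def digitDegree (p : ℕ) (x : ℕ+ →₀ ℕ) : ℕ := x.sum fun _ k => digitSum p k

theorem mayWeight_mapDomain (p : ℕ) (t : ℕ+) (x : ℕ+ →₀ ℕ) :
    mayWeight p (x.mapDomain (· + t)) = mayWeight p x + t * digitDegree p x := by
  rw [mayWeight, Finsupp.sum_mapDomain_index_inj (add_left_injective t), mayWeight, digitDegree,
    Finsupp.mul_sum, ← Finsupp.sum_add]
  exact Finset.sum_congr rfl fun i _ => by simp only [PNat.add_coe]; ring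

theorem mayWeight_smul (p : ℕ) [Fact p.Prime] (s : ℕ) (x : ℕ+ →₀ ℕ) :
    mayWeight p (p ^ s • x) = mayWeight p x := by
  rw [mayWeight, mayWeight, Finsupp.sum_smul_index (by simp)]
  exact Finset.sum_congr rfl fun i _ => by simp only [digitSum_mul_prime_pow]

theorem digitSum_degree_le (p : ℕ) [Fact p.Prime] (x : ℕ+ →₀ ℕ) :
    digitSum p x.degree ≤ digitDegree p x := by
  classical
  rw [Finsupp.degree_apply, digitDegree, Finsupp.sum]
  exact Finset.le_sum_of_subadditive (digitSum p) (digitSum_zero p).le (digitSum_add_le p) _ _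

theorem exists_eq_single_of_digitDegree_eq_one (p : ℕ) [Fact p.Prime] {x : ℕ+ →₀ ℕ}
    (h : digitDegree p x = 1) : ∃ i k, x = Finsupp.single i k := by
  classical
  by_cases hx : x = 0
  · simp [hx, digitDegree] at h
  obtain ⟨i, hi⟩ := Finsupp.ne_iff.1 hx
  rw [Finsupp.zero_apply] at hi
  refine ⟨i, x i, ?_⟩
  by_contra hne
  obtain ⟨j, hj⟩ := Finsupp.ne_iff.1 hne
  have hji : j ≠ i := by rintro rfl; simp at hj
  rw [Finsupp.single_eq_of_ne hji] at hj
  have h1 := Finset.sum_le_sum_of_subset (f := fun a => digitSum p (x a)) (s := {i, j})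
    (t := x.support) (by
      intro a ha
      rw [Finset.mem_insert, Finset.mem_singleton] at ha
      rcases ha with rfl | rfl
      · exact Finsupp.mem_support_iff.2 hi
      · exact Finsupp.mem_support_iff.2 hj)
  rw [Finset.sum_pair hji.symm] at h1
  have h2 := digitSum_pos p hi
  have h3 := digitSum_pos p hj
  have h4 : ∑ a ∈ x.support, digitSum p (x a) = digitDegree p x := rfl
  omega

/-- Shifting `x` by `t` positions adds `t` to the weight for each unit of digit sum, whereas
multiplying `x` by `q ^ t`, a power of `p`, leaves its weight unchanged. -/
theorem IsMilnorSplitting.weight_le {e : ℕ} [Fact p.Prime]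
    (h : IsMilnorSplitting p (p ^ e) t T R n z x₀ x) :
    mayWeight p R + t * (digitSum p x₀ + digitDegree p x) ≤ mayWeight p T := by
  obtain ⟨-, rfl, -, hw⟩ := h
  rw [mayWeight_mapDomain] at hw
  have h1 := mayWeight_add_le p z ((p ^ e) ^ (t : ℕ) • x)
  rw [← pow_mul, mayWeight_smul] at h1
  rw [← pow_mul]
  linarith

theorem IsMilnorSplitting.weight_add_le {e : ℕ} [Fact p.Prime]
    (h : IsMilnorSplitting p (p ^ e) t T R n z x₀ x) :
    mayWeight p R + t * digitSum p n ≤ mayWeight p T := by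
  refine le_trans (Nat.add_le_add_left (Nat.mul_le_mul_left _ ?_) _) h.weight_le
  rw [h.2.2.1]
  exact (digitSum_add_le p _ _).trans (Nat.add_le_add_left (digitSum_degree_le p x) _)

/-- A gain of at most `t` leaves `x₀` and `x` with total digit sum one. Either it lies in `x₀`, and
`x = 0`, or `x₀ = 0` and `x` is the single entry `p ^ s` at some `i`. -/
theorem IsMilnorSplitting.eq_or {e s : ℕ} [Fact p.Prime]
    (h : IsMilnorSplitting p (p ^ e) t T R (p ^ s) z x₀ x)
    (hw : mayWeight p T ≤ mayWeight p R + t) :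
    T = R + Finsupp.single t (p ^ s) ∨
      ∃ i, R = z + Finsupp.single i (p ^ (s + e * t)) ∧ T = z + Finsupp.single (i + t) (p ^ s) ∧
        ¬ p ∣ R i / p ^ (s + e * t) := by
  have h1 := h.weight_le
  obtain ⟨hT, hR, hn, hw'⟩ := h
  have h2 : digitSum p x₀ + digitDegree p x ≤ 1 := by
    refine le_of_mul_le_mul_left (a := (t : ℕ)) ?_ t.pos
    linarith
  have h3 : digitSum p (p ^ s) ≤ digitSum p x₀ + digitDegree p x := by
    rw [hn]
    exact (digitSum_add_le p _ _).trans (Nat.add_le_add_left (digitSum_degree_le p x) _)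
  rw [digitSum_prime_pow] at h3
  have h4 : digitSum p x.degree ≤ digitDegree p x := digitSum_degree_le p x
  by_cases hx : digitDegree p x = 0
  · left
    have hx0 : x = 0 := by
      by_contra hne
      obtain ⟨i, hi⟩ := Finsupp.ne_iff.1 hne
      rw [Finsupp.zero_apply] at hi
      have := Finset.single_le_sum (f := fun a => digitSum p (x a)) (fun _ _ => Nat.zero_le _)
        (Finsupp.mem_support_iff.2 hi)
      have h5 := digitSum_pos p hi
      have h6 : ∑ a ∈ x.support, digitSum p (x a) = digitDegree p x := rfl
      omega
    subst hx0
    simp only [map_zero, add_zero, smul_zero, Finsupp.mapDomain_zero] at hn hT hR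
    rw [hT, hR, hn]
  · right
    obtain ⟨i, k, rfl⟩ := exists_eq_single_of_digitDegree_eq_one p (x := x) (by omega)
    have hx₀ : x₀ = 0 := (digitSum_eq_zero_iff p).1 (by omega)
    subst hx₀
    rw [Finsupp.degree_single, zero_add] at hn
    subst hn
    have hR' : R = z + Finsupp.single i (p ^ (s + e * t)) := by
      rw [hR, Finsupp.smul_single, smul_eq_mul, ← pow_mul, ← pow_add, add_comm s]
    refine ⟨i, hR', ?_, ?_⟩
    · rw [hT, Finsupp.mapDomain_single]; simp
    -- Subadditivity bounds the weight of `R` above by that of `z` plus `i`, and the bounds on the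
    -- weight of `T` give the opposite inequality. So `p ^ (s + e * t)` is added to `z i` without
    -- carry.
    · rw [hR', Finsupp.add_apply, Finsupp.single_eq_same, ← mayWeight_add_single_eq_iff, ← hR']
      rw [Finsupp.mapDomain_single, mayWeight_single, digitSum_prime_pow, PNat.add_coe] at hw'
      have h5 := mayWeight_add_le p z (Finsupp.single i (p ^ (s + e * t)))
      rw [← hR', mayWeight_single, digitSum_prime_pow] at h5
      rw [digitSum_zero] at hw'
      omega

end Coefficients

/-! ### Leading terms of products and commutators -/

section Span

variable (K : Type*) [Field K]

theorem coeff_zero_coprod (q : ℕ) (t : ℕ+) (J : Finset ℕ+) {T : ℕ+ →₀ ℕ} (hT : T.support ⊆ J) :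
    (coprod K q t J T).coeff 0 = MvPolynomial.monomial T 1 := by
  rw [← Polynomial.constantCoeff_apply, coprod, Finsupp.prod, map_prod, MvPolynomial.monomial_eq,
    map_one, one_mul, Finsupp.prod]
  refine Finset.prod_congr rfl fun m hm => ?_
  rw [map_pow, coprodGen, if_pos (hT hm)]
  simp

theorem coeff_coprod_add_single (q : ℕ) (t : ℕ+) (J : Finset ℕ+) {R : ℕ+ →₀ ℕ}
    (hR : R.support ⊆ J) (ht : t ∈ J) (n : ℕ) :
    ((coprod K q t J (R + Finsupp.single t n)).coeff n).coeff R = ((R t + n).choose n : K) := by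
  classical
  rw [show R + Finsupp.single t n = Finsupp.single t (R t + n) + R.erase t by
      conv_lhs => rw [← Finsupp.single_add_erase t R]
      rw [Finsupp.single_add]; abel]
  rw [coprod, Finsupp.prod_add_index_of_disjoint, Finsupp.prod_single_index (by simp), ← coprod,
    coprodGen, coprodTail_self, if_pos ht, Polynomial.coeff_mul, MvPolynomial.coeff_sum,
    Finset.sum_eq_single_of_mem (n, 0) (by simp)]
  · rw [coeff_linear_pow, coeff_zero_coprod K q t J ((Finsupp.support_erase (f := R) ▸
      Finset.erase_subset _ _ : (R.erase t).support ⊆ R.support).trans hR), Nat.add_sub_cancel,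
      one_pow, mul_one, MvPolynomial.X_pow_eq_monomial,
      ← map_natCast (MvPolynomial.C (σ := ℕ+) (R := K)), mul_comm (MvPolynomial.monomial _ _),
      mul_assoc, MvPolynomial.coeff_C_mul, MvPolynomial.monomial_mul, Finsupp.single_add_erase,
      MvPolynomial.coeff_monomial, if_pos rfl]
    ring
  -- Taking fewer than `n` factors `Y` from the entry at `t` leaves a power of `ξ_t` larger than
  -- `r_t`, so `ξ^R` cannot occur.
  · rintro ⟨a, b⟩ hab hne
    rw [Finset.HasAntidiagonal.mem_antidiagonal] at hab
    simp only at hab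
    have hlt : a < n := by
      rcases Nat.eq_zero_or_pos b with rfl | hb
      · exact absurd (by simpa using hab) (fun h : a = n => hne (by rw [h]))
      · omega
    rw [coeff_linear_pow, one_pow, mul_one, MvPolynomial.X_pow_eq_monomial, mul_assoc,
      MvPolynomial.coeff_monomial_mul', if_neg]
    intro hle
    have := hle t
    rw [Finsupp.single_eq_same] at this
    omega
  · exact Finset.disjoint_of_subset_left Finsupp.support_single_subset (by simp)

theorem coeff_coprod_single (q : ℕ) (i t : ℕ+) (J : Finset ℕ+) (hi : i ∈ J) (n : ℕ) :
    ((coprod K q t J (Finsupp.single (i + t) n)).coeff n).coeff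
      (Finsupp.single i (n * q ^ (t : ℕ))) = 1 := by
  rw [coprod, Finsupp.prod_single_index (by simp), coprodGen, coeff_linear_pow, coprodTail_add,
    if_pos hi, Nat.sub_self, pow_zero, one_mul, Nat.choose_self, Nat.cast_one, mul_one, ← pow_mul,
    MvPolynomial.X_pow_eq_monomial, MvPolynomial.coeff_monomial, if_pos (by rw [mul_comm])]

/-- The span of the Milnor operations of degree `d` and weight at least `m`. -/
noncomputable def milnorSpan (p e m d : ℕ) : Submodule K (Module.End K (MvPolynomial ℕ K)) :=
  Submodule.span K (milnorOp K (p ^ e) '' {T | m ≤ mayWeight p T ∧ milnorDeg (p ^ e) T = d})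

variable {K}
variable {p e : ℕ}

theorem milnorOp_mem_milnorSpan {m d : ℕ} {T : ℕ+ →₀ ℕ} (hm : m ≤ mayWeight p T)
    (hd : milnorDeg (p ^ e) T = d) : milnorOp K (p ^ e) T ∈ milnorSpan K p e m d :=
  Submodule.subset_span ⟨T, ⟨hm, hd⟩, rfl⟩

theorem milnorSpan_anti {m m' d : ℕ} (h : m' ≤ m) : milnorSpan K p e m d ≤ milnorSpan K p e m' d :=
  Submodule.span_mono (Set.image_mono fun _ hT => ⟨h.trans hT.1, hT.2⟩)

variable [Fact p.Prime] [NeZero e] [CharP K p]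

theorem two_le_prime_pow (p e : ℕ) [Fact p.Prime] [NeZero e] : 2 ≤ p ^ e :=
  le_trans (Fact.out : p.Prime).two_le (Nat.le_self_pow (NeZero.ne e) p)

/-- The product formula with a canonical index set, all sequences of the right degree. The
truncation set is enlarged by `t` and `i` so that the two explicit coefficients can be read off. -/
theorem exists_milnorOp_mul_single (R : ℕ+ →₀ ℕ) (t : ℕ+) (n : ℕ) (i : ℕ+) :
    ∃ (D : Finset (ℕ+ →₀ ℕ)) (c : (ℕ+ →₀ ℕ) → K),
      (∀ T, T ∈ D ↔ milnorDeg (p ^ e) T =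
        milnorDeg (p ^ e) R + milnorDeg (p ^ e) (Finsupp.single t n)) ∧
      milnorOp K (p ^ e) R * milnorOp K (p ^ e) (Finsupp.single t n) =
        ∑ T ∈ D, c T • milnorOp K (p ^ e) T ∧
      (∀ T, c T ≠ 0 → ∃ z x₀ x, IsMilnorSplitting p (p ^ e) t T R n z x₀ x) ∧
      c (R + Finsupp.single t n) = ((R t + n).choose n : K) ∧
      (R = Finsupp.single i (n * (p ^ e) ^ (t : ℕ)) → c (Finsupp.single (i + t) n) = 1) := by
  classical
  have hfin : {T | milnorDeg (p ^ e) T =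
      milnorDeg (p ^ e) R + milnorDeg (p ^ e) (Finsupp.single t n)}.Finite :=
    (finite_milnorDeg_le (two_le_prime_pow p e) _).subset fun T hT => le_of_eq hT
  have hmem : ∀ T, T ∈ hfin.toFinset ↔ milnorDeg (p ^ e) T =
        milnorDeg (p ^ e) R + milnorDeg (p ^ e) (Finsupp.single t n) := fun T => by simp
  refine ⟨hfin.toFinset,
    fun T => ((coprod K (p ^ e) t (insert i (insert t R.support)) T).coeff n).coeff R, hmem, ?_,
    fun T hT => coeff_coprod_ne_zero p (p ^ e) t _ T n R hT, ?_, ?_⟩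
  · refine milnorOp_mul_single p e t n R _ ?_ _ ?_
    · exact (Finset.subset_insert _ _).trans (Finset.subset_insert _ _)
    · intro T hT
      obtain ⟨z, x₀, x, h⟩ := coeff_coprod_ne_zero p (p ^ e) t _ T n R hT
      rw [hmem, milnorDeg_single]
      exact h.deg_eq
  · exact coeff_coprod_add_single K _ _ _
      ((Finset.subset_insert _ _).trans (Finset.subset_insert _ _)) (by simp) _
  · intro h
    subst h
    exact coeff_coprod_single K _ _ _ _ (by simp) _

theorem milnorOp_mul_single_mem (R : ℕ+ →₀ ℕ) (t : ℕ+) (n : ℕ) :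
    milnorOp K (p ^ e) R * milnorOp K (p ^ e) (Finsupp.single t n) ∈
      milnorSpan K p e (mayWeight p R + t * digitSum p n)
        (milnorDeg (p ^ e) R + milnorDeg (p ^ e) (Finsupp.single t n)) := by
  obtain ⟨D, c, hD, hsum, hc, -⟩ := exists_milnorOp_mul_single (K := K) (p := p) (e := e) R t n 1
  rw [hsum]
  refine Submodule.sum_mem _ fun T hT => ?_
  by_cases h0 : c T = 0
  · rw [h0, zero_smul]; exact Submodule.zero_mem _
  · obtain ⟨z, x₀, x, h⟩ := hc T h0
    exact Submodule.smul_mem _ _ (milnorOp_mem_milnorSpan h.weight_add_le ((hD T).1 hT))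

/-- If no entry of `R` has a digit in the place `s + e * t`, then the leading term of the product
of `P(R)` with `P^s_t` is a multiple of the Milnor operation of the sum of the sequences. -/
theorem milnorOp_mul_prime_pow (R : ℕ+ →₀ ℕ) (t : ℕ+) (s : ℕ)
    (hR : ∀ i, p ∣ R i / p ^ (s + e * t)) :
    milnorOp K (p ^ e) R * milnorOp K (p ^ e) (Finsupp.single t (p ^ s)) -
        ((R t + p ^ s).choose (p ^ s) : K) •
          milnorOp K (p ^ e) (R + Finsupp.single t (p ^ s)) ∈
      milnorSpan K p e (mayWeight p R + t + 1)
        (milnorDeg (p ^ e) R + milnorDeg (p ^ e) (Finsupp.single t (p ^ s))) := by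
  classical
  obtain ⟨D, c, hD, hsum, hc, hval, -⟩ :=
    exists_milnorOp_mul_single (K := K) (p := p) (e := e) R t (p ^ s) 1
  rw [hsum, ← hval, ← Finset.sum_erase_eq_sub ((hD _).2 (map_add _ _ _))]
  refine Submodule.sum_mem _ fun T hT => ?_
  rw [Finset.mem_erase] at hT
  by_cases h0 : c T = 0
  · rw [h0, zero_smul]; exact Submodule.zero_mem _
  · obtain ⟨z, x₀, x, h⟩ := hc T h0
    refine Submodule.smul_mem _ _ (milnorOp_mem_milnorSpan ?_ ((hD T).1 hT.2))
    by_contra hlt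
    rcases h.eq_or (by omega) with h | ⟨i, -, -, h⟩
    · exact hT.1 h
    · exact h (hR i)

/-- By `IsMilnorSplitting.eq_or` only these two sequences can have weight at most `i + t`: the
second alternative needs an entry with a nonzero digit in the place `s + e * t`, and only the one at
`i` has it. -/
theorem single_mul_single_prime_pow (i t : ℕ+) (s : ℕ) :
    milnorOp K (p ^ e) (Finsupp.single i (p ^ (s + e * t))) *
          milnorOp K (p ^ e) (Finsupp.single t (p ^ s)) -
        ((Finsupp.single i (p ^ (s + e * t)) t + p ^ s).choose (p ^ s) : K) •
          milnorOp K (p ^ e) (Finsupp.single i (p ^ (s + e * t)) + Finsupp.single t (p ^ s)) -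
        milnorOp K (p ^ e) (Finsupp.single (i + t) (p ^ s)) ∈
      milnorSpan K p e (i + t + 1) (milnorDeg (p ^ e) (Finsupp.single (i + t) (p ^ s))) := by
  classical
  obtain ⟨D, c, hD, hsum, hc, hval, hval2⟩ := exists_milnorOp_mul_single (K := K) (p := p) (e := e)
    (Finsupp.single i (p ^ (s + e * t))) t (p ^ s) i
  have hval2 := hval2 (by rw [← pow_mul, ← pow_add])
  have hdeg : milnorDeg (p ^ e) (Finsupp.single (i + t) (p ^ s)) =
      milnorDeg (p ^ e) (Finsupp.single i (p ^ (s + e * t))) +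
        milnorDeg (p ^ e) (Finsupp.single t (p ^ s)) := by
    simp only [milnorDeg_single, PNat.add_coe]
    rw [add_comm (i : ℕ), Finset.sum_range_add]
    simp only [pow_add, pow_mul, ← Finset.mul_sum]
    ring
  have hne : Finsupp.single (i + t) (p ^ s) ≠
      Finsupp.single i (p ^ (s + e * t)) + Finsupp.single t (p ^ s) := by
    intro h
    have h1 := DFunLike.congr_fun h t
    rw [Finsupp.single_eq_of_ne (PNat.lt_add_left t i).ne, Finsupp.add_apply,
      Finsupp.single_eq_same (a := t)] at h1
    have := pow_pos (Fact.out : p.Prime).pos s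
    omega
  rw [hsum, ← hval, ← Finset.sum_erase_eq_sub ((hD _).2 (map_add _ _ _)),
    ← one_smul K (milnorOp K (p ^ e) (Finsupp.single (i + t) (p ^ s))), ← hval2,
    ← Finset.sum_erase_eq_sub (Finset.mem_erase.2 ⟨hne, (hD _).2 hdeg⟩)]
  refine Submodule.sum_mem _ fun T hT => ?_
  rw [Finset.mem_erase, Finset.mem_erase] at hT
  by_cases h0 : c T = 0
  · rw [h0, zero_smul]; exact Submodule.zero_mem _
  · obtain ⟨z, x₀, x, h⟩ := hc T h0
    refine Submodule.smul_mem _ _ (milnorOp_mem_milnorSpan ?_ (((hD T).1 hT.2.2).trans hdeg.symm))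
    by_contra hlt
    rcases h.eq_or (by rw [mayWeight_single, digitSum_prime_pow]; omega) with h | ⟨j, h1, h2, h3⟩
    · exact hT.2.1 h
    · have hji : j = i := by
        by_contra hji
        rw [Finsupp.single_eq_of_ne hji] at h3
        simp at h3
      subst hji
      have hz : z = 0 := by
        rwa [eq_comm, add_eq_right] at h1
      subst hz
      exact hT.1 (by simpa using h2)

/-- The commutator of two elements `P^s_t`, up to terms of higher weight. -/
theorem commutator_prime_pow (i t : ℕ+) (s : ℕ) :
    milnorOp K (p ^ e) (Finsupp.single i (p ^ (s + e * t))) *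
          milnorOp K (p ^ e) (Finsupp.single t (p ^ s)) -
        milnorOp K (p ^ e) (Finsupp.single t (p ^ s)) *
          milnorOp K (p ^ e) (Finsupp.single i (p ^ (s + e * t))) -
        milnorOp K (p ^ e) (Finsupp.single (i + t) (p ^ s)) ∈
      milnorSpan K p e (i + t + 1) (milnorDeg (p ^ e) (Finsupp.single (i + t) (p ^ s))) := by
  have h1 := single_mul_single_prime_pow (K := K) (p := p) (e := e) i t s
  -- In the opposite order only the sum of the sequences appears, since the entry `p ^ s` is too
  -- small to have a digit in the place `s + e * t + e * i`.
  have h2 := milnorOp_mul_prime_pow (K := K) (p := p) (e := e) (Finsupp.single t (p ^ s)) i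
    (s + e * t) (by
      intro j
      rw [Nat.div_eq_of_lt]
      · exact dvd_zero p
      · refine lt_of_le_of_lt (b := p ^ s) ?_ ?_
        · rw [Finsupp.single_apply]; split_ifs <;> simp
        · refine Nat.pow_lt_pow_right (Fact.out : p.Prime).one_lt ?_
          have h3 := Nat.mul_pos (Nat.pos_of_ne_zero (NeZero.ne e)) i.pos
          omega)
  have hdeg : milnorDeg (p ^ e) (Finsupp.single (i + t) (p ^ s)) =
      milnorDeg (p ^ e) (Finsupp.single t (p ^ s)) +
        milnorDeg (p ^ e) (Finsupp.single i (p ^ (s + e * t))) := by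
    simp only [milnorDeg_single, PNat.add_coe]
    rw [add_comm (i : ℕ), Finset.sum_range_add]
    simp only [pow_add, pow_mul, ← Finset.mul_sum]
    ring
  rw [← hdeg, mayWeight_single, digitSum_prime_pow, mul_one, add_comm (t : ℕ)] at h2
  -- The sum of the sequences has the same coefficient in both products, so it cancels in the
  -- commutator.
  have hc : (Finsupp.single t (p ^ s) i + p ^ (s + e * t)).choose (p ^ (s + e * t)) =
      (Finsupp.single i (p ^ (s + e * t)) t + p ^ s).choose (p ^ s) := by
    by_cases h : i = t
    · subst h
      rw [Finsupp.single_eq_same, Finsupp.single_eq_same, ← Nat.choose_symm_add, add_comm]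
    · rw [Finsupp.single_eq_of_ne h, Finsupp.single_eq_of_ne (Ne.symm h)]
      simp
  rw [hc, add_comm (Finsupp.single t (p ^ s)) _] at h2
  have := Submodule.sub_mem _ h1 h2
  convert this using 1
  abel

end Span

/-! ### Digit expansions of sequences -/

theorem sum_range_mul_pow_div_mod {p : ℕ} (f : ℕ → ℕ) (hf : ∀ s, f s < p) (N u : ℕ) :
    (∑ s ∈ Finset.range N, f s * p ^ s) / p ^ u % p = if u < N then f u else 0 := by
  have hp : 0 < p := (Nat.zero_le _).trans_lt (hf 0)
  induction N generalizing f u with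
  | zero => simp
  | succ N ih =>
    have h : ∑ s ∈ Finset.range (N + 1), f s * p ^ s =
        f 0 + p * ∑ s ∈ Finset.range N, f (s + 1) * p ^ s := by
      rw [Finset.sum_range_succ', pow_zero, mul_one, add_comm, Finset.mul_sum]
      congr 1
      exact Finset.sum_congr rfl fun s _ => by ring
    rw [h]
    cases u with
    | zero => simp [Nat.mod_eq_of_lt (hf 0)]
    | succ u =>
      rw [pow_succ', ← Nat.div_div_eq_div_mul, Nat.add_mul_div_left _ _ hp,
        Nat.div_eq_of_lt (hf 0), zero_add, ih _ fun s => hf _]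
      simp

theorem sum_range_digit_mul_pow (p n N : ℕ) :
    ∑ s ∈ Finset.range N, n / p ^ s % p * p ^ s = n % p ^ N := by
  induction N with
  | zero => simp [Nat.mod_one]
  | succ N ih => rw [Finset.sum_range_succ, ih, Nat.mod_pow_succ]; ring

/-- The sequence `R` with `r_t = ∑_s g (s, t) * p ^ s`. -/
noncomputable def pstIndex (p : ℕ) : (ℕ × ℕ+ →₀ ℕ) →+ (ℕ+ →₀ ℕ) :=
  Finsupp.liftAddHom fun a => (Finsupp.singleAddHom a.2).comp (AddMonoidHom.mulRight (p ^ a.1))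

theorem pstIndex_single (p : ℕ) (a : ℕ × ℕ+) (n : ℕ) :
    pstIndex p (Finsupp.single a n) = Finsupp.single a.2 (n * p ^ a.1) := by
  simp [pstIndex]

theorem milnorIndex_eq_pstIndex (p : ℕ) (k : PstExponent p) : milnorIndex p k = pstIndex p k.1 :=
  rfl

theorem pstIndex_apply (p : ℕ) (g : ℕ × ℕ+ →₀ ℕ) (t : ℕ+) (N : ℕ)
    (hN : ∀ a : ℕ × ℕ+, N ≤ a.1 → g a = 0) :
    pstIndex p g t = ∑ s ∈ Finset.range N, g (s, t) * p ^ s := by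
  induction g using Finsupp.induction_linear with
  | zero => simp
  | add g h hg hh =>
    have h1 : ∀ a : ℕ × ℕ+, N ≤ a.1 → g a = 0 ∧ h a = 0 := fun a ha => by
      have := hN a ha
      rw [Finsupp.add_apply] at this
      omega
    rw [map_add, Finsupp.add_apply, hg fun a ha => (h1 a ha).1, hh fun a ha => (h1 a ha).2,
      ← Finset.sum_add_distrib]
    exact Finset.sum_congr rfl fun s _ => by rw [Finsupp.add_apply]; ring
  | single a n =>
    obtain ⟨u, i⟩ := a
    rw [pstIndex_single]
    by_cases hi : i = t
    · subst hi
      rw [Finsupp.single_eq_same]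
      have h1 : ∀ s ∈ Finset.range N, Finsupp.single (u, i) n (s, i) * p ^ s =
          if u = s then n * p ^ s else 0 := by
        intro s _
        rw [Finsupp.single_apply]
        by_cases h : u = s <;> simp [h]
      rw [Finset.sum_congr rfl h1, Finset.sum_ite_eq]
      split_ifs with hu
      · rfl
      · have := hN (u, i) (by simpa using hu)
        rw [Finsupp.single_eq_same] at this
        rw [this, zero_mul]
    · rw [Finsupp.single_eq_of_ne (Ne.symm hi), Finset.sum_eq_zero]
      intro s _
      rw [Finsupp.single_eq_of_ne (by simp [Ne.symm hi]), zero_mul]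

theorem exists_bound (g : ℕ × ℕ+ →₀ ℕ) : ∃ N, ∀ a : ℕ × ℕ+, N ≤ a.1 → g a = 0 := by
  refine ⟨g.support.sup Prod.fst + 1, fun a ha => ?_⟩
  by_contra h
  have := Finset.le_sup (f := Prod.fst) (Finsupp.mem_support_iff.2 h)
  omega

theorem pstIndex_digit {p : ℕ} {g : ℕ × ℕ+ →₀ ℕ} (hg : ∀ a, g a < p) (s : ℕ) (t : ℕ+) :
    pstIndex p g t / p ^ s % p = g (s, t) := by
  obtain ⟨N, hN⟩ := exists_bound g
  rw [pstIndex_apply p g t N hN, sum_range_mul_pow_div_mod (fun s => g (s, t)) fun s => hg _]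
  split_ifs with h
  · rfl
  · exact (hN (s, t) (not_lt.1 h)).symm

theorem milnorIndex_bijective (p : ℕ) [hp : Fact p.Prime] :
    Function.Bijective (milnorIndex p) := by
  classical
  constructor
  · intro k l h
    refine Subtype.ext (Finsupp.ext fun a => ?_)
    rw [milnorIndex_eq_pstIndex, milnorIndex_eq_pstIndex] at h
    have h1 := pstIndex_digit k.2 a.1 a.2
    rw [h, pstIndex_digit l.2] at h1
    exact h1.symm
  · intro R
    -- A bound for the entries also bounds the number of their digits, because `n < p ^ n`.
    set N := R.support.sup R with hN
    have hlt : ∀ s t, N ≤ s → R t / p ^ s = 0 := by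
      intro s t hs
      refine Nat.div_eq_of_lt (lt_of_le_of_lt ?_ (Nat.lt_pow_self hp.out.one_lt))
      by_cases ht : R t = 0
      · omega
      · exact (Finset.le_sup (f := R) (Finsupp.mem_support_iff.2 ht)).trans hs
    set g : ℕ × ℕ+ →₀ ℕ := Finsupp.onFinset (Finset.range N ×ˢ R.support)
      (fun a => R a.2 / p ^ a.1 % p) (by
        intro a ha
        rw [Finset.mem_product, Finset.mem_range, Finsupp.mem_support_iff]
        constructor
        · by_contra h
          rw [hlt _ _ (not_lt.1 h)] at ha
          simp at ha
        · intro h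
          rw [h] at ha
          simp at ha) with hg
    refine ⟨⟨g, fun a => Nat.mod_lt _ hp.out.pos⟩, Finsupp.ext fun t => ?_⟩
    rw [milnorIndex_eq_pstIndex, pstIndex_apply p g t N (by
      intro a ha
      rw [hg, Finsupp.onFinset_apply, hlt _ _ ha, Nat.zero_mod])]
    simp only [hg, Finsupp.onFinset_apply]
    rw [sum_range_digit_mul_pow, Nat.mod_eq_of_lt]
    by_contra h
    have := hlt N t le_rfl
    rw [Nat.div_eq_zero_iff] at this
    have h2 := pow_pos hp.out.pos N
    omega

theorem milnorDeg_pos {q : ℕ} (hq : 2 ≤ q) {R : ℕ+ →₀ ℕ} (hR : R ≠ 0) : 0 < milnorDeg q R := by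
  obtain ⟨t, ht⟩ := Finsupp.ne_iff.1 hR
  rw [Finsupp.zero_apply] at ht
  exact (Nat.mul_pos (Nat.pos_of_ne_zero ht) t.pos).trans_le (mul_le_milnorDeg hq R t)

/-! ### Leading terms of ordered products, and the filtration of a Milnor operation -/

section Triangular

variable {K : Type*} [Field K] {p e : ℕ} [Fact p.Prime] [NeZero e] [CharP K p]

theorem mul_single_mem_milnorSpan {m d : ℕ} {v : Module.End K (MvPolynomial ℕ K)}
    (hv : v ∈ milnorSpan K p e m d) (t : ℕ+) (n : ℕ) :
    v * milnorOp K (p ^ e) (Finsupp.single t n) ∈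
      milnorSpan K p e (m + t * digitSum p n) (d + milnorDeg (p ^ e) (Finsupp.single t n)) := by
  induction hv using Submodule.span_induction with
  | mem v hv =>
    obtain ⟨T, ⟨h1, rfl⟩, rfl⟩ := hv
    exact milnorSpan_anti (Nat.add_le_add_right h1 _) (milnorOp_mul_single_mem T t n)
  | zero => rw [zero_mul]; exact Submodule.zero_mem _
  | add v w _ _ hv hw => rw [add_mul]; exact Submodule.add_mem _ hv hw
  | smul c v _ hv => rw [smul_mul_assoc]; exact Submodule.smul_mem _ _ hv

theorem mayWeight_pstIndex_add_single {g : ℕ × ℕ+ →₀ ℕ} (hg : ∀ b, g b < p) {a : ℕ × ℕ+}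
    (ha : g a + 1 < p) :
    mayWeight p (pstIndex p (g + Finsupp.single a 1)) = mayWeight p (pstIndex p g) + a.2 := by
  rw [map_add, pstIndex_single, one_mul, mayWeight_add_single_eq_iff,
    Nat.add_div_right _ (pow_pos (Fact.out : p.Prime).pos _), Nat.dvd_iff_mod_eq_zero,
    Nat.add_mod, pstIndex_digit hg, Nat.add_mod_mod, Nat.mod_eq_of_lt ha]
  omega

/-- By Lucas, the leading binomial coefficient of `milnorOp_mul_prime_pow` is one more than the
digit `g a`, and `g a + 1 < p` excludes a carry. -/
theorem milnorOp_pstIndex_mul {g : ℕ × ℕ+ →₀ ℕ} (hg : ∀ b, g b < p) {a : ℕ × ℕ+}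
    (ha : g a + 1 < p) (h0 : ∀ i, g (a.1 + e * a.2, i) = 0) :
    milnorOp K (p ^ e) (pstIndex p g) * milnorOp K (p ^ e) (Finsupp.single a.2 (p ^ a.1)) -
        ((g a + 1 : ℕ) : K) • milnorOp K (p ^ e) (pstIndex p (g + Finsupp.single a 1)) ∈
      milnorSpan K p e (mayWeight p (pstIndex p (g + Finsupp.single a 1)) + 1)
        (milnorDeg (p ^ e) (pstIndex p (g + Finsupp.single a 1))) := by
  have h := milnorOp_mul_prime_pow (K := K) (p := p) (e := e) (pstIndex p g) a.2 a.1 (by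
    intro i
    rw [Nat.dvd_iff_mod_eq_zero, pstIndex_digit hg, h0])
  have hc : (((pstIndex p g) a.2 + p ^ a.1).choose (p ^ a.1) : K) = ((g a + 1 : ℕ) : K) := by
    rw [CharP.natCast_eq_natCast K p]
    refine (choose_prime_pow_modEq p _ _).trans ?_
    rw [Nat.add_div_right _ (pow_pos (Fact.out : p.Prime).pos _)]
    refine Nat.ModEq.add_right 1 ?_
    rw [Nat.ModEq, pstIndex_digit hg, Nat.mod_eq_of_lt (hg a)]
  rw [mayWeight_pstIndex_add_single hg ha]
  rw [hc] at h
  rw [map_add, pstIndex_single, one_mul, map_add]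
  exact h

/-- As the digit at `a` grows from `0` to `j`, the successive leading coefficients are `1, 2, …, j`,
whence the factorial. -/
theorem milnorOp_pstIndex_mul_pow {g : ℕ × ℕ+ →₀ ℕ} (hg : ∀ b, g b < p) {a : ℕ × ℕ+}
    (ha : g a = 0) (h0 : ∀ i, g (a.1 + e * a.2, i) = 0) {v : Module.End K (MvPolynomial ℕ K)}
    {c : ℕ} (hv : v - (c : K) • milnorOp K (p ^ e) (pstIndex p g) ∈
      milnorSpan K p e (mayWeight p (pstIndex p g) + 1) (milnorDeg (p ^ e) (pstIndex p g)))
    (j : ℕ) (hj : j < p) :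
    v * milnorOp K (p ^ e) (Finsupp.single a.2 (p ^ a.1)) ^ j -
        ((c * j.factorial : ℕ) : K) •
          milnorOp K (p ^ e) (pstIndex p (g + Finsupp.single a j)) ∈
      milnorSpan K p e (mayWeight p (pstIndex p (g + Finsupp.single a j)) + 1)
        (milnorDeg (p ^ e) (pstIndex p (g + Finsupp.single a j))) := by
  classical
  induction j with
  | zero => simpa using hv
  | succ j ih =>
    have ih := ih (by omega)
    set g' := g + Finsupp.single a j with hg'
    have ha' : g' a = j := by simp [hg', ha]
    have hb : ∀ b, g' b < p := by
      intro b
      by_cases hb : b = a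
      · rw [hb, ha']; omega
      · rw [hg', Finsupp.add_apply, Finsupp.single_eq_of_ne hb]; exact hg b
    have hpos : 0 < e * a.2 := Nat.mul_pos (Nat.pos_of_ne_zero (NeZero.ne e)) a.2.pos
    have h0' : ∀ i, g' (a.1 + e * a.2, i) = 0 := by
      intro i
      have hne : (a.1 + e * a.2, i) ≠ a := by
        intro h
        have := congrArg Prod.fst h
        simp only at this
        omega
      rw [hg', Finsupp.add_apply, h0, Finsupp.single_eq_of_ne hne, add_zero]
    have h1 := milnorOp_pstIndex_mul (K := K) (e := e) hb (by omega) h0'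
    have h2 := mul_single_mem_milnorSpan ih a.2 (p ^ a.1)
    have hw := mayWeight_pstIndex_add_single hb (a := a) (by omega)
    have hd : milnorDeg (p ^ e) (pstIndex p (g' + Finsupp.single a 1)) =
        milnorDeg (p ^ e) (pstIndex p g') +
          milnorDeg (p ^ e) (Finsupp.single a.2 (p ^ a.1)) := by
      rw [map_add, map_add, pstIndex_single, one_mul]
    rw [← hd, digitSum_prime_pow, mul_one, add_right_comm, ← hw] at h2
    have hg2 : g + Finsupp.single a (j + 1) = g' + Finsupp.single a 1 := by
      rw [hg', add_assoc, ← Finsupp.single_add]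
    rw [hg2]
    have := Submodule.add_mem _ h2 (Submodule.smul_mem _ ((c * j.factorial : ℕ) : K) h1)
    convert this using 1
    rw [ha', pow_succ, Nat.factorial_succ]
    push_cast
    rw [sub_mul, smul_sub, smul_smul, smul_mul_assoc, mul_assoc]
    rw [show (c : K) * (((j : K) + 1) * (j.factorial : K)) =
      (c : K) * (j.factorial : K) * ((j : K) + 1) by ring]
    abel

/-- The leading term of an ordered product of powers of elements `P^s_t`. -/
theorem list_prod_milnorOp {L : Type*} [LinearOrder L] (key : ℕ × ℕ+ ↪ L)
    (hkey : ∀ s t i, key (s, t) < key (s + e * t, i)) (l : List (ℕ × ℕ+))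
    (hl : l.Pairwise fun a b => key a < key b) (f : ℕ × ℕ+ → ℕ) (hf : ∀ a, f a < p) :
    (l.map fun a => milnorOp K (p ^ e) (Finsupp.single a.2 (p ^ a.1)) ^ f a).prod -
        ((l.map fun a => (f a).factorial).prod : K) •
          milnorOp K (p ^ e) (pstIndex p (l.map fun a => Finsupp.single a (f a)).sum) ∈
      milnorSpan K p e (mayWeight p (pstIndex p (l.map fun a => Finsupp.single a (f a)).sum) + 1)
        (milnorDeg (p ^ e) (pstIndex p (l.map fun a => Finsupp.single a (f a)).sum)) := by
  classical
  have hsum : ∀ l : List (ℕ × ℕ+), l.Nodup → ∀ b,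
      (l.map fun a => Finsupp.single a (f a)).sum b = if b ∈ l then f b else 0 := by
    intro l hl b
    induction l with
    | nil => simp
    | cons a l ih =>
      rw [List.nodup_cons] at hl
      rw [List.map_cons, List.sum_cons, Finsupp.add_apply, ih hl.2]
      by_cases hb : b = a
      · subst hb; simp [hl.1]
      · rw [Finsupp.single_eq_of_ne hb]; simp [hb]
  -- The last factor has the largest key, so by `hkey` no earlier factor occupies a place `(s + e *
  -- t, i)`. This is the condition under which multiplying by it has one leading term.
  induction l using List.reverseRecOn with
  | nil =>
    simp [milnorOp_zero]
  | append_singleton l a ih =>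
    rw [List.pairwise_append] at hl
    obtain ⟨hl1, -, hl2⟩ := hl
    have hnd : l.Nodup := hl1.imp fun {x y} h => by rintro rfl; exact h.false
    have hlt : ∀ b ∈ l, key b < key a := fun b hb => hl2 b hb a (by simp)
    have := milnorOp_pstIndex_mul_pow (K := K) (e := e)
      (g := (l.map fun a => Finsupp.single a (f a)).sum) (a := a) (by
        intro b; rw [hsum l hnd]
        split_ifs
        · exact hf b
        · exact (Fact.out : p.Prime).pos) (by
        rw [hsum l hnd, if_neg]
        intro h; exact (hlt a h).false) (by
        intro i
        rw [hsum l hnd, if_neg]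
        intro h
        exact ((hlt _ h).trans (hkey a.1 a.2 i)).false)
      (c := (l.map fun a => (f a).factorial).prod) (ih hl1) (f a) (hf a)
    simpa only [List.map_append, List.map_cons, List.map_nil, List.prod_append, List.sum_append,
      List.prod_singleton, List.sum_singleton, List.prod_cons, List.prod_nil, mul_one] using this

/-- Replacing `s` by `s + e * t` raises `s'` by `t`. This inequality and its Z-analogue are all that
the leading term argument needs from the two orders. -/
theorem yKey_lt (e : ℕ) [NeZero e] (s : ℕ) (t i : ℕ+) :
    yKey e (s, t) < yKey e (s + e * t, i) := by
  have h : s / e < (s + e * t) / e := by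
    rw [Nat.add_mul_div_left _ _ (Nat.pos_of_ne_zero (NeZero.ne e))]
    exact Nat.lt_add_of_pos_right t.pos
  exact Prod.Lex.toLex_lt_toLex.2 (Or.inl h)

theorem zKey_lt (e : ℕ) [NeZero e] (s : ℕ) (t i : ℕ+) :
    zKey e (s, t) < zKey e (s + e * t, i) := by
  have h : s / e + (t : ℕ) < (s + e * t) / e + i := by
    rw [Nat.add_mul_div_left _ _ (Nat.pos_of_ne_zero (NeZero.ne e))]
    exact Nat.lt_add_of_pos_right i.pos
  exact Prod.Lex.toLex_lt_toLex.2 (Or.inl h)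

/-- A Milnor operation lies in the piece given by its weight of every multiplicative filtration for
which the operations `P^r`, `r > 0`, have filtration at least one. -/
theorem milnorOp_mem_filtration (J : ℕ → Submodule K (Module.End K (MvPolynomial ℕ K)))
    (hanti : Antitone J) (hone : 1 ∈ J 0) (hmul : ∀ m n, ∀ x ∈ J m, ∀ y ∈ J n, x * y ∈ J (m + n))
    (hpow : ∀ n, n ≠ 0 → milnorOp K (p ^ e) (Finsupp.single 1 n) ∈ J 1) (R : ℕ+ →₀ ℕ) :
    milnorOp K (p ^ e) R ∈ J (mayWeight p R) := by
  classical
  have hp : p.Prime := Fact.out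
  have hq := two_le_prime_pow p e
  obtain ⟨d, hd⟩ : ∃ d, milnorDeg (p ^ e) R = d := ⟨_, rfl⟩
  -- The outer induction is on the degree, the inner one on degree minus weight; higher weight terms
  -- of the same degree are thus already known.
  induction d using Nat.strong_induction_on generalizing R with
  | _ d ihd =>
  obtain ⟨k, hk⟩ : ∃ k, d - mayWeight p R = k := ⟨_, rfl⟩
  induction k using Nat.strong_induction_on generalizing R with
  | _ k ihk =>
  have hspan : milnorSpan K p e (mayWeight p R + 1) d ≤ J (mayWeight p R) := by
    refine Submodule.span_le.2 ?_
    rintro _ ⟨T, ⟨hT1, hT2⟩, rfl⟩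
    have hle := mayWeight_le_milnorDeg hq p T
    exact hanti (by omega) (ihk (d - mayWeight p T) (by omega) T hT2 rfl)
  obtain ⟨k, rfl⟩ := (milnorIndex_bijective p).2 R
  obtain ⟨g, hg⟩ := k
  rw [milnorIndex_eq_pstIndex] at *
  simp only at *
  by_cases h0 : g = 0
  · subst h0
    simpa [milnorOp_zero] using hone
  -- One unit of the largest digit position is split off on the right. By maximality, the remaining
  -- sequence has no digit that would spoil the leading term.
  obtain ⟨a, ha, hmax⟩ := Finset.exists_max_image g.support (yKey e)
    (Finsupp.support_nonempty_iff.2 h0)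
  rw [Finsupp.mem_support_iff] at ha
  obtain ⟨g', rfl⟩ : ∃ g', g = g' + Finsupp.single a 1 :=
    ⟨g - Finsupp.single a 1, (tsub_add_cancel_of_le
      (Finsupp.single_le_iff.2 (Nat.one_le_iff_ne_zero.2 ha))).symm⟩
  by_cases h1 : g' = 0
  · subst h1
    rw [zero_add, pstIndex_single, one_mul] at *
    obtain ⟨s, t⟩ := a
    simp only at *
    -- A single `P^s_t` is a generator when `t = 1`. When `t = τ + 1` it is, up to higher weight,
    -- the commutator of `P^{s + eτ}_1` and `P^s_τ`, of filtrations `1` and `τ`.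
    rcases PNat.exists_eq_succ_of_ne_one (n := t) |> fun h => or_iff_not_imp_left.2 h with
      rfl | ⟨τ, rfl⟩
    · rw [mayWeight_single, digitSum_prime_pow]
      exact hpow _ (pow_pos hp.pos s).ne'
    · have hdeg : milnorDeg (p ^ e) (Finsupp.single τ (p ^ s)) < d := by
        rw [← hd, milnorDeg_single, milnorDeg_single, PNat.add_coe, PNat.one_coe,
          Finset.sum_range_succ, mul_add]
        exact Nat.lt_add_of_pos_right (Nat.mul_pos (pow_pos hp.pos s) (pow_pos (by omega) _))
      have hτ := ihd _ hdeg _ rfl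
      have hi := hpow (p ^ (s + e * τ)) (pow_pos hp.pos _).ne'
      have hc := commutator_prime_pow (K := K) (p := p) (e := e) 1 τ s
      rw [mayWeight_single, digitSum_prime_pow, mul_one] at hτ hspan ⊢
      rw [add_comm 1 τ, hd, show ((1 : ℕ+) : ℕ) + (τ : ℕ) + 1 = ((τ + 1 : ℕ+) : ℕ) + 1 by
        rw [PNat.add_coe, PNat.one_coe]; ring] at hc
      have h3 := hmul _ _ _ hi _ hτ
      have h4 := hmul _ _ _ hτ _ hi
      rw [add_comm] at h3
      have h5 := Submodule.sub_mem _ (Submodule.sub_mem _ h3 h4) (hspan hc)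
      rwa [sub_sub_cancel] at h5
  · have hlt : ∀ b, g' b < p := fun b => lt_of_le_of_lt (by simp) (hg b)
    have haa : g' a + 1 < p := by simpa using hg a
    have hmul' := milnorOp_pstIndex_mul (K := K) (e := e) hlt haa (by
      intro i
      by_contra hne
      exact (hmax (a.1 + e * a.2, i) (by
        rw [Finsupp.mem_support_iff, Finsupp.add_apply]; omega)).not_gt (yKey_lt e a.1 a.2 i))
    have hd' := hd
    rw [map_add, map_add] at hd'
    have hne1 : pstIndex p g' ≠ 0 := by
      intro h
      exact h1 (Finsupp.ext fun b => by
        rw [← pstIndex_digit hlt b.1 b.2, h]; simp)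
    have hne2 : pstIndex p (Finsupp.single a 1) ≠ 0 := by
      rw [pstIndex_single, one_mul, Ne, Finsupp.single_eq_zero]
      exact (pow_pos hp.pos _).ne'
    have hp1 := milnorDeg_pos hq hne1
    have hp2 := milnorDeg_pos hq hne2
    have m1 := ihd _ (by omega) _ (rfl : milnorDeg (p ^ e) (pstIndex p g') = _)
    have m2 := ihd _ (by omega) _ (rfl : milnorDeg (p ^ e) (pstIndex p (Finsupp.single a 1)) = _)
    rw [pstIndex_single, one_mul, mayWeight_single, digitSum_prime_pow, mul_one] at m2
    have m3 := hmul _ _ _ m1 _ m2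
    rw [← mayWeight_pstIndex_add_single hlt haa] at m3
    rw [hd] at hmul'
    have m4 := Submodule.sub_mem _ m3 (hspan hmul')
    rw [sub_sub_cancel] at m4
    -- The leading coefficient `g' a + 1` lies strictly between `0` and `p`, so it is invertible.
    refine (Submodule.smul_mem_iff _ ?_).1 m4
    rw [Ne, CharP.cast_eq_zero_iff K p]
    exact Nat.not_dvd_of_pos_of_lt (Nat.succ_pos _) haa

end Triangular

/-! ### Linear independence of the Milnor operations -/

section Independence

variable {K : Type*} [Field K]

/-- The sequence with a single entry `1` in position `t`, or the zero sequence for `t = 0`. -/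
noncomputable def unitSeq (t : ℕ) : ℕ+ →₀ ℕ := if h : 0 < t then Finsupp.single ⟨t, h⟩ 1 else 0

theorem unitSeq_coe (t : ℕ+) : unitSeq t = Finsupp.single t 1 := by
  rw [unitSeq, dif_pos t.pos]
  rfl

theorem unitSeq_injective : Function.Injective unitSeq := by
  have h0 : ∀ t : ℕ+, Finsupp.single t 1 ≠ (0 : ℕ+ →₀ ℕ) := fun t => by simp
  intro s t h
  unfold unitSeq at h
  split_ifs at h with h1 h2 h2
  · have := Finsupp.single_left_injective one_ne_zero h
    exact congrArg PNat.val this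
  · exact absurd h (h0 _)
  · exact absurd h.symm (h0 _)
  · omega

theorem milnorOp_X_cases (q : ℕ) (R : ℕ+ →₀ ℕ) (i : ℕ) :
    (∃ t, R = unitSeq t ∧ milnorOp K q R (MvPolynomial.X i) = MvPolynomial.X i ^ q ^ t) ∨
      ((∀ t, R ≠ unitSeq t) ∧ milnorOp K q R (MvPolynomial.X i) = 0) := by
  rw [milnorOp_X]
  by_cases h0 : R = 0
  · exact Or.inl ⟨0, by simp [h0, unitSeq], by simp [h0]⟩
  rw [if_neg h0]
  by_cases h1 : ∃ t, R = Finsupp.single t 1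
  · obtain ⟨t, rfl⟩ := h1
    refine Or.inl ⟨t, (unitSeq_coe t).symm, ?_⟩
    rw [Finsupp.support_single _ one_ne_zero, Finset.sum_singleton, if_pos rfl]
  · refine Or.inr ⟨fun t ht => ?_, Finset.sum_eq_zero fun t _ => if_neg fun h => h1 ⟨t, h⟩⟩
    unfold unitSeq at ht
    split_ifs at ht with h
    · exact h1 ⟨_, ht⟩
    · exact h0 ht

/-- The monomial `x₀ ⋯ x_{n - 1}`, where `n` is the length of the list. -/
noncomputable def testMonomial (K : Type*) [Field K] : List ℕ → MvPolynomial ℕ K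
  | [] => 1
  | _ :: l => testMonomial K l * MvPolynomial.X l.length

/-- The exponent of the monomial in which the variables of `testMonomial` are raised to the powers
with exponents `q ^ t`, `t` in the list. -/
noncomputable def testExponent (q : ℕ) : List ℕ → (ℕ →₀ ℕ)
  | [] => 0
  | t :: l => testExponent q l + Finsupp.single l.length (q ^ t)

theorem testExponent_apply (q : ℕ) (l : List ℕ) (j : ℕ) (hj : l.length ≤ j) :
    testExponent q l j = 0 := by
  induction l with
  | nil => rfl
  | cons t l ih =>
    rw [List.length_cons] at hj
    rw [testExponent, Finsupp.add_apply, ih (by omega), Finsupp.single_eq_of_ne (by omega), add_zero]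

theorem coeff_milnorOp_testMonomial_eq_zero (q : ℕ) (l : List ℕ) (R : ℕ+ →₀ ℕ) (m : ℕ →₀ ℕ)
    (j : ℕ) (hj : l.length ≤ j) (hm : m j ≠ 0) :
    (milnorOp K q R (testMonomial K l)).coeff m = 0 := by
  classical
  induction l generalizing R m with
  | nil =>
    rw [testMonomial, ← map_one MvPolynomial.C, milnorOp_C]
    split_ifs
    · rw [MvPolynomial.coeff_C, if_neg]
      rintro rfl
      exact hm rfl
    · simp
  | cons t l ih =>
    rw [List.length_cons] at hj
    rw [testMonomial, milnorOp_mul, MvPolynomial.coeff_sum]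
    refine Finset.sum_eq_zero fun x _ => ?_
    rcases milnorOp_X_cases (K := K) q x.2 l.length with ⟨u, -, h⟩ | ⟨-, h⟩
    · rw [h, MvPolynomial.X_pow_eq_monomial, MvPolynomial.coeff_mul_monomial']
      split_ifs
      · rw [ih _ _ (by omega), zero_mul]
        rw [Finsupp.tsub_apply, Finsupp.single_eq_of_ne (by omega), Nat.sub_zero]
        exact hm
      · rfl
    · rw [h, mul_zero, MvPolynomial.coeff_zero]

/-- Each variable occurs once in the test monomial, and its exponent `q ^ t` in the image reveals
which `ξ_t` was used, as the powers of `q ≥ 2` are distinct. Hence the list determines `R`, and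
these coefficients separate the operations. -/
theorem coeff_milnorOp_testMonomial {q : ℕ} (hq : 2 ≤ q) (l : List ℕ) (R : ℕ+ →₀ ℕ) :
    (milnorOp K q R (testMonomial K l)).coeff (testExponent q l) =
      if R = (l.map unitSeq).sum then 1 else 0 := by
  classical
  induction l generalizing R with
  | nil =>
    rw [testMonomial, ← map_one MvPolynomial.C, milnorOp_C, testExponent]
    split_ifs with h1 h2 h2
    · simp
    · exact absurd h1 h2
    · exact absurd h2 h1
    · simp
  | cons t l ih =>
    have hterm : ∀ x : (ℕ+ →₀ ℕ) × (ℕ+ →₀ ℕ),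
        (milnorOp K q x.1 (testMonomial K l) *
          milnorOp K q x.2 (MvPolynomial.X l.length)).coeff (testExponent q (t :: l)) =
        if x = ((l.map unitSeq).sum, unitSeq t) then 1 else 0 := by
      rintro ⟨x, y⟩
      simp only
      rcases milnorOp_X_cases (K := K) q y l.length with ⟨u, hu, h⟩ | ⟨hu, h⟩
      · rw [h, MvPolynomial.X_pow_eq_monomial, MvPolynomial.coeff_mul_monomial', hu, testExponent]
        by_cases hut : u = t
        · subst hut
          rw [if_pos le_add_self, add_tsub_cancel_right, ih, mul_one]
          simp
        -- A wrong exponent for the last variable would leave a positive power of it to the shorter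
        -- test monomial, whose image does not involve that variable.
        · rw [if_neg (c := (x, unitSeq u) = _)
            fun h => hut (unitSeq_injective (Prod.ext_iff.1 h).2)]
          split_ifs with hle
          · have h1 := hle l.length
            rw [Finsupp.add_apply, testExponent_apply q l _ le_rfl, Finsupp.single_eq_same,
              Finsupp.single_eq_same, zero_add] at h1
            rw [coeff_milnorOp_testMonomial_eq_zero q l _ _ l.length le_rfl, zero_mul]
            rw [Finsupp.tsub_apply, Finsupp.add_apply, testExponent_apply q l _ le_rfl,
              Finsupp.single_eq_same, Finsupp.single_eq_same, zero_add]
            have h2 : q ^ u ≠ q ^ t := fun h => hut (Nat.pow_right_injective hq h)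
            omega
          · rfl
      · rw [h, mul_zero, MvPolynomial.coeff_zero, if_neg]
        intro h
        exact hu t (Prod.ext_iff.1 h).2
    rw [testMonomial, milnorOp_mul, MvPolynomial.coeff_sum, Finset.sum_congr rfl fun x _ => hterm x,
      Finset.sum_ite_eq']
    simp only [Finset.HasAntidiagonal.mem_antidiagonal, List.map_cons, List.sum_cons]
    congr 1
    rw [add_comm, eq_iff_iff]
    exact eq_comm

theorem exists_list_unitSeq (R : ℕ+ →₀ ℕ) : ∃ l : List ℕ, (l.map unitSeq).sum = R := by
  induction R using Finsupp.induction_linear with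
  | zero => exact ⟨[], rfl⟩
  | add R S hR hS =>
    obtain ⟨l, rfl⟩ := hR
    obtain ⟨l', rfl⟩ := hS
    exact ⟨l ++ l', by simp⟩
  | single t n =>
    exact ⟨List.replicate n t, by simp [unitSeq_coe]⟩

theorem linearIndependent_milnorOp {q : ℕ} (hq : 2 ≤ q) : LinearIndependent K (milnorOp K q) := by
  classical
  rw [linearIndependent_iff']
  intro s c h R hR
  obtain ⟨l, hl⟩ := exists_list_unitSeq R
  have h1 := congrArg (fun f => (f (testMonomial K l)).coeff (testExponent q l)) h
  simpa [LinearMap.sum_apply, MvPolynomial.coeff_sum, coeff_milnorOp_testMonomial hq, hl, hR]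
    using h1

end Independence

/-! ### A criterion for linear independence by dimension count -/

/-- Truncating to degrees at most `N` fixes or kills each `y k`, so the `y k` of degree at most `N`
span the finitely many `b i` of degree at most `N`. Since `σ` is injective they are no more numerous
than these, so they are independent. -/
theorem linearIndependent_of_graded_span {K E ι κ : Type*} [Field K] [AddCommGroup E] [Module K E]
    {b : ι → E} (hb : LinearIndependent K b) (deg : ι → ℕ) (hdeg : ∀ N, {i | deg i ≤ N}.Finite)
    {y : κ → E} {σ : κ → ι} (hσ : Function.Injective σ)
    (hy : ∀ k, y k ∈ Submodule.span K (b '' {i | deg i = deg (σ k)}))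
    (hspan : ∀ i, b i ∈ Submodule.span K (Set.range y)) : LinearIndependent K y := by
  classical
  have key : ∀ N, LinearIndependent K fun k : {k // deg (σ k) ≤ N} => y k := by
    intro N
    have : Finite {i // deg i ≤ N} := (hdeg N).to_subtype
    have : Finite {k // deg (σ k) ≤ N} :=
      Finite.of_injective (fun k => (⟨σ k.1, k.2⟩ : {i // deg i ≤ N}))
        fun k l h => Subtype.ext (hσ (congrArg Subtype.val h))
    have := Fintype.ofFinite {i // deg i ≤ N}
    have := Fintype.ofFinite {k // deg (σ k) ≤ N}
    -- The truncation is only determined on the span of `b`; any linear extension to `E` will do.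
    obtain ⟨π, hπ⟩ := LinearMap.exists_extend ((Module.Basis.span hb).constr K
      fun i => if deg i ≤ N then b i else 0)
    have hπb : ∀ i, π (b i) = if deg i ≤ N then b i else 0 := by
      intro i
      have h1 := LinearMap.congr_fun hπ (Module.Basis.span hb i)
      rw [Module.Basis.constr_basis, LinearMap.comp_apply, Submodule.subtype_apply,
        Module.Basis.span_apply] at h1
      exact h1
    have hπy : ∀ k, π (y k) ∈ Submodule.span K (Set.range fun k : {k // deg (σ k) ≤ N} => y k) := by
      intro k
      by_cases hk : deg (σ k) ≤ N
      · have h1 : ∀ x ∈ Submodule.span K (b '' {i | deg i = deg (σ k)}), π x = x := by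
          intro x hx
          induction hx using Submodule.span_induction with
          | mem x hx =>
            obtain ⟨i, hi, rfl⟩ := hx
            rw [Set.mem_ofPred_eq] at hi
            rw [hπb, if_pos (hi ▸ hk)]
          | zero => simp
          | add x y _ _ hx hy => rw [map_add, hx, hy]
          | smul c x _ hx => rw [map_smul, hx]
        rw [h1 _ (hy k)]
        exact Submodule.subset_span ⟨⟨k, hk⟩, rfl⟩
      · have h1 : ∀ x ∈ Submodule.span K (b '' {i | deg i = deg (σ k)}), π x = 0 := by
          intro x hx
          induction hx using Submodule.span_induction with
          | mem x hx =>
            obtain ⟨i, hi, rfl⟩ := hx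
            rw [Set.mem_ofPred_eq] at hi
            rw [hπb, if_neg (hi ▸ hk)]
          | zero => simp
          | add x y _ _ hx hy => rw [map_add, hx, hy, add_zero]
          | smul c x _ hx => rw [map_smul, hx, smul_zero]
        rw [h1 _ (hy k)]
        exact Submodule.zero_mem _
    have hle : Submodule.span K (Set.range fun i : {i // deg i ≤ N} => b i) ≤
        Submodule.span K (Set.range fun k : {k // deg (σ k) ≤ N} => y k) := by
      rw [Submodule.span_le]
      rintro _ ⟨i, rfl⟩
      have h1 : Submodule.span K (Set.range y) ≤ (Submodule.span K
          (Set.range fun k : {k // deg (σ k) ≤ N} => y k)).comap π := by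
        rw [Submodule.span_le]
        rintro _ ⟨k, rfl⟩
        exact hπy k
      have h2 := h1 (hspan i)
      rw [Submodule.mem_comap, hπb, if_pos i.2] at h2
      exact h2
    rw [linearIndependent_iff_card_le_finrank_span]
    have : FiniteDimensional K
        (Submodule.span K (Set.range fun k : {k // deg (σ k) ≤ N} => y k)) :=
      FiniteDimensional.span_of_finite K (Set.finite_range _)
    have h1 := Submodule.finrank_mono hle
    rw [show (fun i : {i // deg i ≤ N} => b i) = b ∘ Subtype.val from rfl,
      finrank_span_eq_card (hb.comp _ Subtype.val_injective)] at h1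
    exact (Fintype.card_le_of_injective (fun k => (⟨σ k.1, k.2⟩ : {i // deg i ≤ N}))
        fun k l h => Subtype.ext (hσ (congrArg Subtype.val h))).trans h1
  rw [linearIndependent_iff']
  intro s c h k hk
  set N := s.sup fun k => deg (σ k)
  have hN : ∀ k ∈ s, deg (σ k) ≤ N := fun k hk => Finset.le_sup (f := fun k => deg (σ k)) hk
  have h1 := linearIndependent_iff'.1 (key N) (s.subtype _) (fun k => c k) (by
    rw [Finset.sum_subtype_of_mem (fun k => c k • y k) hN]
    exact h)
  exact h1 ⟨k, hN k hk⟩ (by simpa using hk)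

/-! ### Admissible monomials -/

section Admissible

/-- The condition `i_1 ≥ q * i_2`, `i_2 ≥ q * i_3`, … on a sequence of positive integers. -/
def IsAdmissible (q : ℕ) (l : List ℕ) : Prop :=
  (∀ a ∈ l, a ≠ 0) ∧ l.IsChain fun a b => q * b ≤ a

/-- The sequence `r_j = i_j - q * i_{j + 1}` attached to the exponents of an admissible monomial. -/
noncomputable def admissibleIndex (q : ℕ) : List ℕ → (ℕ+ →₀ ℕ)
  | [] => 0
  | a :: l => Finsupp.single 1 (a - q * l.headD 0) + (admissibleIndex q l).mapDomain (· + 1)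

theorem IsAdmissible.tail {q a : ℕ} {l : List ℕ} (h : IsAdmissible q (a :: l)) :
    IsAdmissible q l :=
  ⟨fun b hb => h.1 b (List.mem_cons_of_mem _ hb), h.2.tail⟩

theorem IsAdmissible.mul_headD_le {q a : ℕ} {l : List ℕ} (h : IsAdmissible q (a :: l)) :
    q * l.headD 0 ≤ a := by
  cases l with
  | nil => simp
  | cons b l => exact (List.isChain_cons_cons.1 h.2).1

theorem mapDomain_add_one_apply_one (x : ℕ+ →₀ ℕ) : x.mapDomain (· + 1) 1 = 0 := by
  rw [Finsupp.mapDomain_of_notMem_range]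
  rintro ⟨i, hi⟩
  exact (PNat.lt_add_left 1 i).ne' hi

theorem admissibleIndex_cons_apply_one (q a : ℕ) (l : List ℕ) :
    admissibleIndex q (a :: l) 1 = a - q * l.headD 0 := by
  rw [admissibleIndex, Finsupp.add_apply, mapDomain_add_one_apply_one, Finsupp.single_eq_same,
    add_zero]

theorem admissibleIndex_eq_zero {q : ℕ} {l : List ℕ} (h : IsAdmissible q l)
    (h0 : admissibleIndex q l = 0) : l = [] := by
  induction l with
  | nil => rfl
  | cons a l ih =>
    exfalso
    have h2 : admissibleIndex q l = 0 := by
      rw [admissibleIndex, add_eq_zero] at h0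
      exact Finsupp.mapDomain_injective (add_left_injective 1) (h0.2.trans Finsupp.mapDomain_zero.symm)
    have hl := ih h.tail h2
    subst hl
    have h3 := admissibleIndex_cons_apply_one q a []
    rw [h0] at h3
    exact h.1 a (by simp) (by simpa using h3.symm)

/-- Admissibility makes the subtraction exact, so `i_j = r_j + q * i_{j + 1}` recovers the exponents
from the end; their positivity fixes the length. -/
theorem admissibleIndex_injOn {q : ℕ} {l l' : List ℕ} (h : IsAdmissible q l)
    (h' : IsAdmissible q l') (heq : admissibleIndex q l = admissibleIndex q l') : l = l' := by
  induction l generalizing l' with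
  | nil => exact (admissibleIndex_eq_zero h' heq.symm).symm
  | cons a l ih =>
    cases l' with
    | nil => exact admissibleIndex_eq_zero h heq
    | cons b l' =>
      have h1 := DFunLike.congr_fun heq 1
      rw [admissibleIndex_cons_apply_one, admissibleIndex_cons_apply_one] at h1
      have h2 : admissibleIndex q l = admissibleIndex q l' := by
        rw [admissibleIndex, admissibleIndex] at heq
        rw [admissibleIndex_cons_apply_one q a l |>.symm.trans
          (DFunLike.congr_fun heq 1 |>.trans (admissibleIndex_cons_apply_one q b l'))] at heq
        exact Finsupp.mapDomain_injective (add_left_injective 1) (add_left_cancel heq)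
      have h3 := ih h.tail h'.tail h2
      subst h3
      have h4 := h.mul_headD_le
      have h5 := h'.mul_headD_le
      rw [show a = b by omega]

theorem milnorDeg_mapDomain_add_one (q : ℕ) (x : ℕ+ →₀ ℕ) :
    milnorDeg q (x.mapDomain (· + 1)) = milnorDeg q x + x.sum fun t r => r * q ^ (t : ℕ) := by
  induction x using Finsupp.induction_linear with
  | zero => simp
  | add x y hx hy =>
    rw [Finsupp.mapDomain_add, map_add, map_add, hx, hy,
      Finsupp.sum_add_index' (by simp) (fun _ _ _ => add_mul _ _ _)]
    ring
  | single t n =>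
    rw [Finsupp.mapDomain_single, milnorDeg_single, milnorDeg_single, Finsupp.sum_single_index
      (by simp), PNat.add_coe, PNat.one_coe, Finset.sum_range_succ, mul_add]

/-- The sum of `(i_t - q * i_{t+1}) * q ^ t` telescopes. It is the change of degree under a shift,
and so yields the degree of `admissibleIndex`. -/
theorem sum_admissibleIndex {q : ℕ} {l : List ℕ} (h : IsAdmissible q l) :
    ((admissibleIndex q l).sum fun t r => r * q ^ (t : ℕ)) = q * l.headD 0 := by
  induction l with
  | nil => simp [admissibleIndex]
  | cons a l ih =>
    rw [admissibleIndex, Finsupp.sum_add_index' (by simp) (fun _ _ _ => add_mul _ _ _),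
      Finsupp.sum_single_index (by simp),
      Finsupp.sum_mapDomain_index_inj (add_left_injective 1)]
    have h1 : ((admissibleIndex q l).sum fun t r => r * q ^ ((t + 1 : ℕ+) : ℕ)) =
        q * (admissibleIndex q l).sum fun t r => r * q ^ (t : ℕ) := by
      rw [Finsupp.mul_sum]
      refine Finset.sum_congr rfl fun t _ => ?_
      simp only [PNat.add_coe, PNat.one_coe]
      ring
    rw [h1, ih h.tail, PNat.one_coe, pow_one, mul_comm, ← mul_add,
      Nat.sub_add_cancel h.mul_headD_le]
    rfl

theorem milnorDeg_admissibleIndex {q : ℕ} {l : List ℕ} (h : IsAdmissible q l) :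
    milnorDeg q (admissibleIndex q l) = l.sum := by
  induction l with
  | nil => simp [admissibleIndex]
  | cons a l ih =>
    have h1 := h.mul_headD_le
    rw [admissibleIndex, map_add, milnorDeg_single_one, milnorDeg_mapDomain_add_one, ih h.tail,
      sum_admissibleIndex h.tail, List.sum_cons]
    omega

variable (p e : ℕ) [Fact p.Prime]

/-- The product of generators with the given exponents. -/
noncomputable def powerProd (l : List ℕ) : SteenrodAlgebra p e := (l.map (power p e)).prod

theorem power_zero : power p e 0 = 1 := by
  unfold power
  exact (RingQuot.mkAlgHom_rel (GaloisField p e) AdemRel.zero).trans (map_one _)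

theorem power_mul_power (a b : ℕ) (h : a < p ^ e * b) :
    power p e a * power p e b = ∑ j ∈ Finset.range (a / p ^ e + 1),
      ((-1 : GaloisField p e) ^ (a + j) *
        (((p ^ e - 1) * (b - j) - 1).choose (a - p ^ e * j) : GaloisField p e)) •
          (power p e (a + b - j) * power p e j) := by
  have h1 := RingQuot.mkAlgHom_rel (GaloisField p e)
    (AdemRel.adem (K := GaloisField p e) (q := p ^ e) a b h)
  rw [map_mul, map_sum] at h1
  refine h1.trans (Finset.sum_congr rfl fun j _ => ?_)
  rw [map_smul, map_mul]
  rfl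

/-- The sum of the entries of a list weighted by their positions. -/
def moment : List ℕ → ℕ
  | [] => 0
  | a :: l => moment l + (a + l.sum)

theorem moment_append_lt (l : List ℕ) {l₁ l₂ : List ℕ} (hs : l₁.sum = l₂.sum)
    (hm : moment l₁ < moment l₂) : moment (l ++ l₁) < moment (l ++ l₂) := by
  induction l with
  | nil => exact hm
  | cons a l ih =>
    simp only [List.cons_append, moment, List.sum_append, hs]
    omega

/-- Rewriting by the Adem relations terminates: deleting a factor `P^0` shortens the word, and
replacing `a, b` by `a + b - j, j` with `j < b` preserves the length and moves exponents to the
left, lowering the moment. -/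
theorem powerProd_mem_span_admissible (l : List ℕ) :
    powerProd p e l ∈ Submodule.span (GaloisField p e)
      (powerProd p e '' {l | IsAdmissible (p ^ e) l}) := by
  obtain ⟨n, hn⟩ : ∃ n, l.length = n := ⟨_, rfl⟩
  induction n using Nat.strong_induction_on generalizing l with
  | _ n ihn =>
  obtain ⟨m, hm⟩ : ∃ m, moment l = m := ⟨_, rfl⟩
  induction m using Nat.strong_induction_on generalizing l with
  | _ m ihm =>
  by_cases h0 : 0 ∈ l
  · obtain ⟨l₁, l₂, rfl⟩ := List.append_of_mem h0
    have h1 : powerProd p e (l₁ ++ 0 :: l₂) = powerProd p e (l₁ ++ l₂) := by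
      simp [powerProd, power_zero]
    rw [h1]
    refine ihn _ ?_ _ rfl
    rw [← hn]
    simp
  by_cases hc : l.IsChain fun a b => p ^ e * b ≤ a
  · exact Submodule.subset_span ⟨l, ⟨fun a ha h => h0 (h ▸ ha), hc⟩, rfl⟩
  rw [List.isChain_iff_forall_rel_of_append_cons_cons] at hc
  push Not at hc
  obtain ⟨a, b, l₁, l₂, rfl, hab⟩ := hc
  have hq : 0 < p ^ e := pow_pos (Fact.out : p.Prime).pos e
  have h1 : powerProd p e (l₁ ++ a :: b :: l₂) =
      ∑ j ∈ Finset.range (a / p ^ e + 1), ((-1 : GaloisField p e) ^ (a + j) *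
        (((p ^ e - 1) * (b - j) - 1).choose (a - p ^ e * j) : GaloisField p e)) •
          powerProd p e (l₁ ++ (a + b - j) :: j :: l₂) := by
    simp only [powerProd, List.map_append, List.map_cons, List.prod_append, List.prod_cons]
    rw [← mul_assoc (power p e a), power_mul_power p e a b hab, Finset.sum_mul, Finset.mul_sum]
    refine Finset.sum_congr rfl fun j _ => ?_
    rw [smul_mul_assoc, mul_smul_comm, mul_assoc]
  rw [h1]
  refine Submodule.sum_mem _ fun j hj => Submodule.smul_mem _ _ ?_
  rw [Finset.mem_range, Nat.lt_succ_iff, Nat.le_div_iff_mul_le hq] at hj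
  have hjb : j < b := by
    by_contra hle
    have := Nat.mul_le_mul_right (p ^ e) (not_lt.1 hle)
    rw [mul_comm b] at this
    omega
  refine ihm _ ?_ _ ?_ rfl
  · rw [← hm]
    refine moment_append_lt _ ?_ ?_
    · simp only [List.sum_cons]; omega
    · simp only [moment, List.sum_cons]; omega
  · rw [← hn]; simp

theorem span_powerProd : Submodule.span (GaloisField p e) (Set.range (powerProd p e)) = ⊤ := by
  rw [eq_top_iff]
  rintro x -
  obtain ⟨y, rfl⟩ := RingQuot.mkAlgHom_surjective (GaloisField p e)
    (AdemRel (GaloisField p e) (p ^ e)) x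
  set U := Submodule.span (GaloisField p e) (Set.range (powerProd p e)) with hU
  have hmul : U * U ≤ U := by
    rw [hU, Submodule.span_mul_span]
    refine Submodule.span_mono ?_
    rintro _ ⟨_, ⟨l, rfl⟩, _, ⟨l', rfl⟩, rfl⟩
    exact ⟨l ++ l', by simp [powerProd]⟩
  induction y using FreeAlgebra.induction with
  | grade0 r =>
    have h1 : (1 : SteenrodAlgebra p e) ∈ U := Submodule.subset_span ⟨[], rfl⟩
    rw [AlgHom.commutes]
    have := Submodule.smul_mem _ r h1
    rwa [← Algebra.algebraMap_eq_smul_one] at this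
  | grade1 r =>
    exact Submodule.subset_span ⟨[r], List.prod_singleton⟩
  | mul a b ha hb =>
    rw [map_mul]
    exact hmul (Submodule.mul_mem_mul ha hb)
  | add a b ha hb =>
    rw [map_add]
    exact Submodule.add_mem _ ha hb

theorem span_admissible : Submodule.span (GaloisField p e)
    (Set.range fun l : {l // IsAdmissible (p ^ e) l} => powerProd p e l) = ⊤ := by
  rw [eq_top_iff, ← span_powerProd, Submodule.span_le]
  rintro _ ⟨l, rfl⟩
  have h := powerProd_mem_span_admissible p e l
  rwa [← Subtype.range_val (s := {l | IsAdmissible (p ^ e) l}), ← Set.range_comp] at h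

theorem augmentation_power (r : ℕ) : augmentation p e (power p e r) = if r = 0 then 1 else 0 := by
  unfold augmentation power
  exact (RingQuot.liftAlgHom_mkAlgHom_apply (GaloisField p e) _ _ _).trans
    (FreeAlgebra.lift_ι_apply _ _)

instance : (augIdeal p e).IsTwoSided := by
  unfold augIdeal; infer_instance

variable [NeZero e]

theorem action_powerProd_mem (l : List ℕ) :
    action p e (powerProd p e l) ∈ milnorSpan (GaloisField p e) p e 0 l.sum := by
  induction l using List.reverseRecOn with
  | nil =>
    rw [powerProd, List.map_nil, List.prod_nil, map_one, ← milnorOp_zero (p ^ e)]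
    exact milnorOp_mem_milnorSpan (Nat.zero_le _) (map_zero _)
  | append_singleton l a ih =>
    have h := mul_single_mem_milnorSpan ih 1 a
    rw [milnorDeg_single_one, ← powerOp_eq_milnorOp, ← action_power, ← map_mul] at h
    rw [List.sum_append, List.sum_singleton, powerProd, List.map_append, List.prod_append,
      List.map_singleton, List.prod_singleton]
    exact milnorSpan_anti (Nat.zero_le _) h

/-! ### The image of the action and the powers of the augmentation ideal -/

/-- Gives the existence of `P(R)` together with a lower bound for its filtration. Faithfulness is
not yet available, so the filtration used consists of the images of the powers of the augmentation
ideal among the operations. -/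
theorem milnorOp_mem_action_pow (R : ℕ+ →₀ ℕ) :
    milnorOp (GaloisField p e) (p ^ e) R ∈
      (mayPower p e (mayWeight p R)).map (action p e).toLinearMap := by
  refine milnorOp_mem_filtration
    (fun m => (mayPower p e m).map (action p e).toLinearMap) ?_ ?_ ?_ ?_ R
  · intro m n h
    exact Submodule.map_mono fun x hx => Ideal.pow_le_pow_right h hx
  · exact ⟨1, by simp [mayPower, Submodule.pow_zero], map_one (action p e)⟩
  · rintro m n _ ⟨x, hx, rfl⟩ _ ⟨y, hy, rfl⟩
    refine ⟨x * y, ?_, map_mul (action p e) _ _⟩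
    change x * y ∈ augIdeal p e ^ (m + n)
    rw [Ideal.IsTwoSided.pow_add]
    exact Ideal.mul_mem_mul hx hy
  · intro n hn
    refine ⟨power p e n, ?_, ?_⟩
    · change power p e n ∈ augIdeal p e ^ 1
      rw [Submodule.pow_one]
      change augmentation p e (power p e n) = 0
      rw [augmentation_power, if_neg hn]
    · rw [← powerOp_eq_milnorOp]
      exact action_power p e n

/-- The admissible monomials span the algebra, so their operations span all Milnor operations. Their
degrees agree with those of their indices, and `linearIndependent_of_graded_span` makes these
operations independent; a spanning family with independent images has no kernel. -/
theorem action_injective : Function.Injective (action p e) := by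
  have hLI : LinearIndependent (GaloisField p e)
      fun l : {l // IsAdmissible (p ^ e) l} => action p e (powerProd p e l) := by
    refine linearIndependent_of_graded_span
      (linearIndependent_milnorOp (two_le_prime_pow p e)) (milnorDeg (p ^ e))
      (finite_milnorDeg_le (two_le_prime_pow p e))
      (σ := fun l : {l // IsAdmissible (p ^ e) l} => admissibleIndex (p ^ e) l)
      (fun l l' h => Subtype.ext (admissibleIndex_injOn l.2 l'.2 h)) ?_ ?_
    · intro l
      refine Submodule.span_mono ?_ (action_powerProd_mem p e l)
      refine Set.image_mono fun T hT => ?_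
      rw [Set.mem_ofPred_eq, milnorDeg_admissibleIndex l.2]
      exact hT.2
    · intro R
      obtain ⟨x, -, hx⟩ := milnorOp_mem_action_pow p e R
      have h1 : x ∈ Submodule.span (GaloisField p e)
        (Set.range fun l : {l // IsAdmissible (p ^ e) l} => powerProd p e l) := by
        rw [span_admissible]; trivial
      have h2 := Submodule.mem_map_of_mem (f := (action p e).toLinearMap) h1
      rw [Submodule.map_span, ← Set.range_comp, hx] at h2
      exact h2
  have hspan := span_admissible p e
  rw [← AlgHom.coe_toLinearMap, ← LinearMap.ker_eq_bot, eq_bot_iff]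
  intro x hx
  have hx' : x ∈ Submodule.span (GaloisField p e)
      (Set.range fun l : {l // IsAdmissible (p ^ e) l} => powerProd p e l) := by
    rw [hspan]; trivial
  obtain ⟨c, rfl⟩ := (Finsupp.mem_span_range_iff_exists_finsupp).1 hx'
  rw [LinearMap.mem_ker, map_finsuppSum] at hx
  simp only [map_smul, AlgHom.toLinearMap_apply] at hx
  have := (linearIndependent_iff.1 hLI) c (by rw [Finsupp.linearCombination_apply]; exact hx)
  simp [this]

end Admissible

/-! ### Weight spans and the Milnor basis -/

section Bases

variable (p e : ℕ) [Fact p.Prime]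

/-- The span of the Milnor operations of weight at least `m`. -/
noncomputable def weightSpan (m : ℕ) :
    Submodule (GaloisField p e) (Module.End (GaloisField p e) (MvPolynomial ℕ (GaloisField p e))) :=
  Submodule.span (GaloisField p e)
    (milnorOp (GaloisField p e) (p ^ e) '' {T | m ≤ mayWeight p T})

variable {p e}

theorem milnorSpan_le_weightSpan (m d : ℕ) :
    milnorSpan (GaloisField p e) p e m d ≤ weightSpan p e m :=
  Submodule.span_mono (Set.image_mono fun _ hT => hT.1)

theorem weightSpan_anti {m n : ℕ} (h : m ≤ n) : weightSpan p e n ≤ weightSpan p e m :=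
  Submodule.span_mono (Set.image_mono fun _ hT => h.trans hT)

theorem le_mayFiltration {m : ℕ} {θ : SteenrodAlgebra p e} (h : θ ∈ mayPower p e m) :
    (m : ℕ∞) ≤ mayFiltration p e θ :=
  le_iSup (fun m : {m : ℕ // θ ∈ augIdeal p e ^ m} => ((m : ℕ) : ℕ∞)) ⟨m, h⟩

theorem mayFiltration_eq {m : ℕ} {θ : SteenrodAlgebra p e} (h : θ ∈ mayPower p e m)
    (h' : θ ∉ mayPower p e (m + 1)) : mayFiltration p e θ = m := by
  refine le_antisymm (iSup_le fun n => ?_) (le_mayFiltration h)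
  rw [Nat.cast_le]
  by_contra hlt
  exact h' (Ideal.pow_le_pow_right (by omega) n.2)

theorem initialForm_eq {m : ℕ} {θ : SteenrodAlgebra p e} (h : θ ∈ mayPower p e m)
    (h' : θ ∉ mayPower p e (m + 1)) :
    initialForm p e θ = DirectSum.lof (GaloisField p e) ℕ (GradedPiece p e) m
      (Submodule.Quotient.mk ⟨θ, h⟩) := by
  have h1 : (mayFiltration p e θ).toNat = m := by rw [mayFiltration_eq h h', ENat.toNat_natCast]
  unfold initialForm
  subst h1
  rw [dif_pos h]

variable (p e) [NeZero e]

/-- A family in the algebra which acts by linearly independent operations spanning all Milnor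
operations is a basis. -/
theorem basis_of_action {κ : Type*} (y : κ → SteenrodAlgebra p e)
    (hLI : LinearIndependent (GaloisField p e) fun k => action p e (y k))
    (hspan : ∀ R, milnorOp (GaloisField p e) (p ^ e) R ∈
      Submodule.span (GaloisField p e) (Set.range fun k => action p e (y k))) :
    ∃ b : Module.Basis κ (GaloisField p e) (SteenrodAlgebra p e), ∀ k, b k = y k := by
  have h1 : LinearIndependent (GaloisField p e) y :=
    LinearIndependent.of_comp (action p e).toLinearMap hLI
  have h2 : ⊤ ≤ Submodule.span (GaloisField p e) (Set.range y) := by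
    have h3 : Submodule.span (GaloisField p e) (Set.range (powerProd p e)) ≤
        Submodule.span (GaloisField p e) (Set.range y) := by
      rw [Submodule.span_le]
      rintro _ ⟨l, rfl⟩
      have h4 : milnorSpan (GaloisField p e) p e 0 l.sum ≤
          (Submodule.span (GaloisField p e) (Set.range y)).map (action p e).toLinearMap := by
        rw [milnorSpan, Submodule.span_le, Submodule.map_span, ← Set.range_comp]
        rintro _ ⟨R, -, rfl⟩
        exact hspan R
      obtain ⟨x, hx, hxl⟩ := h4 (action_powerProd_mem p e l)
      rwa [action_injective p e hxl] at hx
    rwa [span_powerProd] at h3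
  exact ⟨Module.Basis.mk h1 h2, fun k => by rw [Module.Basis.mk_apply]⟩

theorem exists_milnorBasis :
    ∃ b : Module.Basis (ℕ+ →₀ ℕ) (GaloisField p e) (SteenrodAlgebra p e),
      ∀ R, action p e (b R) = milnorOp (GaloisField p e) (p ^ e) R := by
  choose u _ hu using milnorOp_mem_action_pow p e
  have hu' : (fun R => action p e (u R)) = milnorOp (GaloisField p e) (p ^ e) := funext hu
  obtain ⟨b, hb⟩ := basis_of_action p e u
    (hu' ▸ linearIndependent_milnorOp (two_le_prime_pow p e))
    (fun R => Submodule.subset_span ⟨R, hu R⟩)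
  exact ⟨b, fun R => by rw [hb]; exact hu R⟩

theorem isMilnorElement_iff {b : Module.Basis (ℕ+ →₀ ℕ) (GaloisField p e) (SteenrodAlgebra p e)}
    (hb : ∀ R, action p e (b R) = milnorOp (GaloisField p e) (p ^ e) R) (R : ℕ+ →₀ ℕ)
    (θ : SteenrodAlgebra p e) : IsMilnorElement p e R θ ↔ θ = b R := by
  rw [IsMilnorElement, ← hb]
  exact (action_injective p e).eq_iff

/-! ### The May filtration in terms of the Milnor basis -/

variable {p e}

theorem mul_power_mem_weightSpan {m r : ℕ} (hr : r ≠ 0)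
    {v : Module.End (GaloisField p e) (MvPolynomial ℕ (GaloisField p e))}
    (hv : v ∈ weightSpan p e m) : v * action p e (power p e r) ∈ weightSpan p e (m + 1) := by
  induction hv using Submodule.span_induction with
  | mem v hv =>
    obtain ⟨T, hT, rfl⟩ := hv
    rw [Set.mem_ofPred_eq] at hT
    rw [action_power, powerOp_eq_milnorOp]
    refine weightSpan_anti ?_ (milnorSpan_le_weightSpan _ _ (milnorOp_mul_single_mem T 1 r))
    have := digitSum_pos p hr
    rw [PNat.one_coe, one_mul]
    omega
  | zero => rw [zero_mul]; exact Submodule.zero_mem _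
  | add v w _ _ hv hw => rw [add_mul]; exact Submodule.add_mem _ hv hw
  | smul c v _ hv => rw [smul_mul_assoc]; exact Submodule.smul_mem _ _ hv

/-- Subtracting the augmentation makes the claim linear in `θ`, so words in the generators suffice.
For `θ` in the augmentation ideal, right multiplication raises the weight by at least one. -/
theorem mul_action_sub_mem_weightSpan {m : ℕ}
    {v : Module.End (GaloisField p e) (MvPolynomial ℕ (GaloisField p e))}
    (hv : v ∈ weightSpan p e m) (θ : SteenrodAlgebra p e) :
    v * action p e θ - augmentation p e θ • v ∈ weightSpan p e (m + 1) := by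
  have hθ : θ ∈ Submodule.span (GaloisField p e) (Set.range (powerProd p e)) := by
    rw [span_powerProd]; trivial
  induction hθ using Submodule.span_induction with
  | mem θ hθ =>
    obtain ⟨l, rfl⟩ := hθ
    induction l using List.reverseRecOn with
    | nil => simp [powerProd]
    | append_singleton l a ih =>
      have h1 : powerProd p e (l ++ [a]) = powerProd p e l * power p e a := by
        simp [powerProd]
      by_cases ha : a = 0
      · subst ha
        rwa [h1, power_zero, mul_one]
      · rw [h1, map_mul (augmentation p e), augmentation_power, if_neg ha, mul_zero, zero_smul,
          sub_zero, map_mul, ← mul_assoc]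
        refine mul_power_mem_weightSpan ha ?_
        have h2 := Submodule.add_mem _ (weightSpan_anti (Nat.le_succ m) ih)
          (Submodule.smul_mem _ (augmentation p e (powerProd p e l)) hv)
        rwa [sub_add_cancel] at h2
  | zero => simp
  | add x y _ _ hx hy =>
    rw [map_add, map_add, mul_add, add_smul, add_sub_add_comm]
    exact Submodule.add_mem _ hx hy
  | smul c x _ hx =>
    have h1 := Submodule.smul_mem _ c hx
    rwa [smul_sub c (v * action p e x), smul_smul, ← mul_smul_comm, ← smul_eq_mul c,
      ← map_smul (action p e), ← map_smul (augmentation p e)] at h1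

theorem action_mem_weightSpan {m : ℕ} {θ : SteenrodAlgebra p e} (h : θ ∈ mayPower p e m) :
    action p e θ ∈ weightSpan p e m := by
  change θ ∈ augIdeal p e ^ m at h
  induction m generalizing θ with
  | zero =>
    have h0 : (1 : Module.End (GaloisField p e) (MvPolynomial ℕ (GaloisField p e))) ∈
        weightSpan p e 0 :=
      Submodule.subset_span ⟨0, Nat.zero_le _, milnorOp_zero _⟩
    have h1 := Submodule.add_mem _
      (weightSpan_anti (Nat.zero_le 1) (mul_action_sub_mem_weightSpan h0 θ))
      (Submodule.smul_mem _ (augmentation p e θ) h0)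
    rwa [sub_add_cancel, one_mul] at h1
  | succ m ih =>
    rw [Submodule.pow_succ] at h
    induction h using Submodule.mul_induction_on' with
    | mem_mul_mem x hx y hy =>
      have h1 := mul_action_sub_mem_weightSpan (ih hx) y
      rwa [show augmentation p e y = 0 from hy, zero_smul, sub_zero, ← map_mul] at h1
    | add x _ y _ hx hy => rw [map_add]; exact Submodule.add_mem _ hx hy

/-- The two filtrations coincide: one inclusion comes from right multiplication raising the weight,
the other from `milnorOp_mem_action_pow` and faithfulness. -/
theorem mem_mayPower_iff {m : ℕ} {θ : SteenrodAlgebra p e} :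
    θ ∈ mayPower p e m ↔ action p e θ ∈ weightSpan p e m := by
  refine ⟨action_mem_weightSpan, fun h => ?_⟩
  have h1 : weightSpan p e m ≤ (mayPower p e m).map (action p e).toLinearMap := by
    rw [weightSpan, Submodule.span_le]
    rintro _ ⟨T, hT, rfl⟩
    exact Submodule.map_mono (show mayPower p e _ ≤ mayPower p e m from
      fun x hx => Ideal.pow_le_pow_right hT hx)
      (milnorOp_mem_action_pow p e T)
  obtain ⟨x, hx, hxθ⟩ := h1 h
  rwa [action_injective p e hxθ] at hx

theorem mem_mayPower_iff_repr
    {b : Module.Basis (ℕ+ →₀ ℕ) (GaloisField p e) (SteenrodAlgebra p e)}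
    (hb : ∀ R, action p e (b R) = milnorOp (GaloisField p e) (p ^ e) R) {m : ℕ}
    {θ : SteenrodAlgebra p e} :
    θ ∈ mayPower p e m ↔ ∀ R, b.repr θ R ≠ 0 → m ≤ mayWeight p R := by
  have h1 : weightSpan p e m = (Submodule.span (GaloisField p e)
      (b '' {T | m ≤ mayWeight p T})).map (action p e).toLinearMap := by
    rw [Submodule.map_span, ← Set.image_comp, weightSpan]
    congr 1
    exact Set.image_congr fun R _ => (hb R).symm
  have h2 : action p e θ ∈ weightSpan p e m ↔
      θ ∈ Submodule.span (GaloisField p e) (b '' {T | m ≤ mayWeight p T}) := by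
    rw [h1]
    exact Function.Injective.mem_set_image (action_injective p e)
  rw [mem_mayPower_iff, h2, Module.Basis.mem_span_image]
  constructor
  · exact fun h R hR => h (Finsupp.mem_support_iff.2 hR)
  · exact fun h R hR => h R (Finsupp.mem_support_iff.1 hR)

theorem milnor_mem_mayPower_iff
    {b : Module.Basis (ℕ+ →₀ ℕ) (GaloisField p e) (SteenrodAlgebra p e)}
    (hb : ∀ R, action p e (b R) = milnorOp (GaloisField p e) (p ^ e) R) {m : ℕ} (R : ℕ+ →₀ ℕ) :
    b R ∈ mayPower p e m ↔ m ≤ mayWeight p R := by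
  classical
  rw [mem_mayPower_iff_repr hb, Module.Basis.repr_self]
  constructor
  · intro h
    exact h R (by simp)
  · intro h S hS
    rw [Finsupp.single_apply] at hS
    split_ifs at hS with hRS
    · exact hRS ▸ h
    · exact absurd rfl hS

/-- The Milnor basis is adapted to the filtration: the `P(R)` of weight at least `m` span the `m`-th
power, so those of weight exactly `m` give a basis of the `m`-th graded piece. -/
theorem exists_basis_initialForm
    {b : Module.Basis (ℕ+ →₀ ℕ) (GaloisField p e) (SteenrodAlgebra p e)}
    (hb : ∀ R, action p e (b R) = milnorOp (GaloisField p e) (p ^ e) R) :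
    ∃ E : Module.Basis (ℕ+ →₀ ℕ) (GaloisField p e) (E0 p e),
      ∀ R, E R = initialForm p e (b R) := by
  classical
  let g : ∀ m, {R // mayWeight p R = m} → GradedPiece p e m := fun m R =>
    Submodule.Quotient.mk ⟨b R, (milnor_mem_mayPower_iff hb R.1).2 R.2.ge⟩
  have hg : ∀ m, LinearIndependent (GaloisField p e) (g m) := by
    intro m
    rw [linearIndependent_iff']
    intro s c h R hR
    have h1 : (∑ i ∈ s, c i • b i.1) ∈ mayPower p e (m + 1) := by
      have h2 : ∑ i ∈ s, c i • g m i = Submodule.Quotient.mk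
          (∑ i ∈ s, c i • (⟨b i.1, (milnor_mem_mayPower_iff hb i.1).2 i.2.ge⟩ : mayPower p e m)) := by
        rw [← Submodule.mkQ_apply, map_sum]
        simp only [map_smul]
        rfl
      rw [h2, Submodule.Quotient.mk_eq_zero, Submodule.submoduleOf, Submodule.mem_comap, map_sum] at h
      exact h
    rw [mem_mayPower_iff_repr hb] at h1
    by_contra hc
    have h3 := h1 R.1 (by
      rw [map_sum, Finsupp.finsetSum_apply, Finset.sum_eq_single_of_mem R hR]
      · simpa using hc
      · intro S _ hS
        rw [map_smul, Module.Basis.repr_self, Finsupp.smul_apply, Finsupp.single_eq_of_ne, smul_zero]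
        exact fun h => hS (Subtype.ext h.symm))
    rw [R.2] at h3
    omega
  have hgspan : ∀ m, ∀ x : GradedPiece p e m,
      x ∈ Submodule.span (GaloisField p e) (Set.range (g m)) := by
    intro m x
    obtain ⟨⟨θ, hθ⟩, rfl⟩ := Submodule.Quotient.mk_surjective _ x
    have hsupp := (mem_mayPower_iff_repr hb).1 hθ
    have h1 : (⟨θ, hθ⟩ : mayPower p e m) = ∑ R ∈ (b.repr θ).support.attach,
        b.repr θ R.1 • ⟨b R.1, (milnor_mem_mayPower_iff hb R.1).2
          (hsupp R.1 (Finsupp.mem_support_iff.1 R.2))⟩ := by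
      apply Subtype.ext
      simp only [AddSubmonoidClass.coe_finsetSum, SetLike.val_smul]
      rw [Finset.sum_attach (b.repr θ).support fun R => b.repr θ R • b R]
      exact (b.linearCombination_repr θ).symm
    rw [h1, ← Submodule.mkQ_apply, map_sum]
    refine Submodule.sum_mem _ fun R _ => ?_
    rw [map_smul]
    refine Submodule.smul_mem _ _ ?_
    by_cases hR : mayWeight p R.1 = m
    · exact Submodule.subset_span ⟨⟨R.1, hR⟩, rfl⟩
    · rw [Submodule.mkQ_apply, (Submodule.Quotient.mk_eq_zero _).2]
      · exact Submodule.zero_mem _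
      · rw [Submodule.submoduleOf, Submodule.mem_comap]
        refine (milnor_mem_mayPower_iff hb R.1).2 ?_
        have := hsupp R.1 (Finsupp.mem_support_iff.1 R.2)
        omega
  have hinit : ∀ R, initialForm p e (b R) = DirectSum.lof (GaloisField p e) ℕ (GradedPiece p e)
      (mayWeight p R) (g _ ⟨R, rfl⟩) := fun R =>
    initialForm_eq _ (by rw [milnor_mem_mayPower_iff hb]; omega)
  have hLI : LinearIndependent (GaloisField p e) fun R => initialForm p e (b R) := by
    have h1 := (DFinsupp.linearIndependent_single g hg).comp
      (fun R : ℕ+ →₀ ℕ => (⟨mayWeight p R, ⟨R, rfl⟩⟩ : Σ m, {R // mayWeight p R = m}))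
      (fun R S h => by
        have := congrArg (fun x : Σ m, {R // mayWeight p R = m} => x.2.1) h
        exact this)
    rw [funext hinit]
    exact h1
  have hspan : ⊤ ≤ Submodule.span (GaloisField p e)
      (Set.range fun R => initialForm p e (b R)) := by
    rintro x -
    induction x using DirectSum.induction_on with
    | zero => exact Submodule.zero_mem _
    | add x y hx hy => exact Submodule.add_mem _ hx hy
    | of m x =>
      have h1 := Submodule.mem_map_of_mem
        (f := DirectSum.lof (GaloisField p e) ℕ (GradedPiece p e) m) (hgspan m x)
      rw [Submodule.map_span] at h1
      refine Submodule.span_mono ?_ h1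
      rintro _ ⟨_, ⟨⟨R, rfl⟩, rfl⟩, rfl⟩
      exact ⟨R, hinit R⟩
  exact ⟨Module.Basis.mk hLI hspan, fun R => by rw [Module.Basis.mk_apply]⟩

end Bases

/-! ### The Y- and Z-bases and their classes -/

section PstBases

theorem sortByKey_pairwise {α L : Type*} [LinearOrder L] (key : α ↪ L) (S : Finset α) :
    (sortByKey key S).Pairwise fun a b => key a < key b := by
  have : IsTrans α (fun a b => key a ≤ key b) := ⟨fun _ _ _ => le_trans⟩
  have : Std.Antisymm (fun a b : α => key a ≤ key b) :=
    ⟨fun _ _ h h' => key.injective (le_antisymm h h')⟩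
  have : Std.Total (fun a b : α => key a ≤ key b) := ⟨fun _ _ => le_total _ _⟩
  have h1 : (sortByKey key S).Pairwise fun a b => key a ≤ key b := Finset.pairwise_sort _ _
  have h2 : (sortByKey key S).Nodup := Finset.sort_nodup _ _
  exact (h1.and h2).imp fun {a b} h => lt_of_le_of_ne h.1 fun h' => h.2 (key.injective h')

theorem coe_sortByKey {α L : Type*} [LinearOrder L] (key : α ↪ L) (S : Finset α) :
    (sortByKey key S : Multiset α) = S.val := by
  have : IsTrans α (fun a b => key a ≤ key b) := ⟨fun _ _ _ => le_trans⟩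
  have : Std.Antisymm (fun a b : α => key a ≤ key b) :=
    ⟨fun _ _ h h' => key.injective (le_antisymm h h')⟩
  have : Std.Total (fun a b : α => key a ≤ key b) := ⟨fun _ _ => le_total _ _⟩
  exact Finset.sort_eq _ _

theorem sortByKey_sum {α L M : Type*} [LinearOrder L] [AddCommMonoid M] (key : α ↪ L)
    (S : Finset α) (f : α → M) : ((sortByKey key S).map f).sum = ∑ a ∈ S, f a := by
  rw [← Multiset.sum_coe, ← Multiset.map_coe, coe_sortByKey]
  rfl

theorem sortByKey_prod {α L M : Type*} [LinearOrder L] [CommMonoid M] (key : α ↪ L)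
    (S : Finset α) (f : α → M) : ((sortByKey key S).map f).prod = ∏ a ∈ S, f a := by
  rw [← Multiset.prod_coe, ← Multiset.map_coe, coe_sortByKey]
  rfl

variable {p e : ℕ} [Fact p.Prime]

theorem factorialCoeff_ne_zero (k : PstExponent p) :
    (factorialCoeff p k : GaloisField p e) ≠ 0 := by
  have hp : p.Prime := Fact.out
  rw [Ne, CharP.cast_eq_zero_iff (GaloisField p e) p, factorialCoeff, Finsupp.prod,
    hp.prime.dvd_finsetProd_iff]
  rintro ⟨a, -, ha⟩
  exact (k.2 a).not_ge ((hp.dvd_factorial).1 ha)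

variable [NeZero e] {L : Type*} [LinearOrder L] {key : ℕ × ℕ+ ↪ L}
  {b : Module.Basis (ℕ+ →₀ ℕ) (GaloisField p e) (SteenrodAlgebra p e)}

theorem action_pstMonomial_sub_mem (hkey : ∀ s t i, key (s, t) < key (s + e * t, i))
    (hb : ∀ R, action p e (b R) = milnorOp (GaloisField p e) (p ^ e) R) (k : PstExponent p) :
    action p e (pstMonomial p key b k) -
        (factorialCoeff p k : GaloisField p e) •
          milnorOp (GaloisField p e) (p ^ e) (milnorIndex p k) ∈
      milnorSpan (GaloisField p e) p e (mayWeight p (milnorIndex p k) + 1)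
        (milnorDeg (p ^ e) (milnorIndex p k)) := by
  have h := list_prod_milnorOp (K := GaloisField p e) key hkey (sortByKey key k.1.support)
    (sortByKey_pairwise _ _) k.1 k.2
  rw [sortByKey_sum, sortByKey_prod] at h
  rw [show ∑ a ∈ k.1.support, Finsupp.single a (k.1 a) = k.1 from Finsupp.sum_single k.1] at h
  rw [pstMonomial, map_list_prod, List.map_map]
  have h2 : (⇑(action p e) ∘ fun a : ℕ × ℕ+ => b (Finsupp.single a.2 (p ^ a.1)) ^ k.1 a) =
      fun a => milnorOp (GaloisField p e) (p ^ e) (Finsupp.single a.2 (p ^ a.1)) ^ k.1 a := by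
    funext a
    rw [Function.comp_apply, map_pow, hb]
  rw [h2]
  exact h

theorem pstMonomial_sub_mem (hkey : ∀ s t i, key (s, t) < key (s + e * t, i))
    (hb : ∀ R, action p e (b R) = milnorOp (GaloisField p e) (p ^ e) R) (k : PstExponent p) :
    pstMonomial p key b k - (factorialCoeff p k : GaloisField p e) • b (milnorIndex p k) ∈
      mayPower p e (mayWeight p (milnorIndex p k) + 1) := by
  rw [mem_mayPower_iff, map_sub, map_smul, hb]
  exact milnorSpan_le_weightSpan _ _ (action_pstMonomial_sub_mem hkey hb k)

/-- Since `c_k` is invertible and the error has higher weight in the same degree, downward induction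
on the weight gives spanning. Independence follows by the dimension count, with `milnorIndex`
matching degrees. -/
theorem exists_pstBasis (hkey : ∀ s t i, key (s, t) < key (s + e * t, i))
    (hb : ∀ R, action p e (b R) = milnorOp (GaloisField p e) (p ^ e) R) :
    ∃ y : Module.Basis (PstExponent p) (GaloisField p e) (SteenrodAlgebra p e),
      ∀ k, y k = pstMonomial p key b k := by
  have hsub := action_pstMonomial_sub_mem hkey hb
  have hspan : ∀ R, milnorOp (GaloisField p e) (p ^ e) R ∈ Submodule.span (GaloisField p e)
      (Set.range fun k => action p e (pstMonomial p key b k)) := by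
    intro R
    obtain ⟨n, hn⟩ : ∃ n, milnorDeg (p ^ e) R - mayWeight p R = n := ⟨_, rfl⟩
    induction n using Nat.strong_induction_on generalizing R with
    | _ n ih =>
    obtain ⟨k, rfl⟩ := (milnorIndex_bijective p).2 R
    refine (Submodule.smul_mem_iff _ (factorialCoeff_ne_zero (e := e) k)).1 ?_
    have h1 : milnorSpan (GaloisField p e) p e (mayWeight p (milnorIndex p k) + 1)
        (milnorDeg (p ^ e) (milnorIndex p k)) ≤ Submodule.span (GaloisField p e)
          (Set.range fun k => action p e (pstMonomial p key b k)) := by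
      rw [milnorSpan, Submodule.span_le]
      rintro _ ⟨T, ⟨hT1, hT2⟩, rfl⟩
      have := mayWeight_le_milnorDeg (two_le_prime_pow p e) p T
      exact ih _ (by omega) T rfl
    have h2 := Submodule.sub_mem _ (Submodule.subset_span (R := GaloisField p e)
      (s := Set.range fun k => action p e (pstMonomial p key b k)) ⟨k, rfl⟩) (h1 (hsub k))
    rwa [sub_sub_cancel] at h2
  refine basis_of_action p e _ ?_ hspan
  refine linearIndependent_of_graded_span (linearIndependent_milnorOp (two_le_prime_pow p e))
    (milnorDeg (p ^ e)) (finite_milnorDeg_le (two_le_prime_pow p e))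
    (milnorIndex_bijective p).1 (fun k => ?_) hspan
  have h1 := Submodule.add_mem _ (milnorSpan_anti (Nat.zero_le _) (hsub k))
    (Submodule.smul_mem _ (factorialCoeff p k : GaloisField p e)
      (milnorOp_mem_milnorSpan (m := 0) (Nat.zero_le _) rfl))
  rw [sub_add_cancel] at h1
  exact Submodule.span_mono (Set.image_mono fun T hT => hT.2) h1

theorem mayFiltration_milnor
    (hb : ∀ R, action p e (b R) = milnorOp (GaloisField p e) (p ^ e) R) (R : ℕ+ →₀ ℕ) :
    mayFiltration p e (b R) = mayWeight p R :=
  mayFiltration_eq ((milnor_mem_mayPower_iff hb R).2 le_rfl)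
    (by rw [milnor_mem_mayPower_iff hb]; omega)

theorem mayFiltration_lt (hkey : ∀ s t i, key (s, t) < key (s + e * t, i))
    (hb : ∀ R, action p e (b R) = milnorOp (GaloisField p e) (p ^ e) R) (k : PstExponent p) :
    mayFiltration p e (b (milnorIndex p k)) < mayFiltration p e (pstMonomial p key b k -
      (factorialCoeff p k : GaloisField p e) • b (milnorIndex p k)) := by
  rw [mayFiltration_milnor hb]
  refine lt_of_lt_of_le ?_ (le_mayFiltration (pstMonomial_sub_mem hkey hb k))
  rw [Nat.cast_lt]
  exact Nat.lt_succ_self _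

theorem initialForm_pstMonomial (hkey : ∀ s t i, key (s, t) < key (s + e * t, i))
    (hb : ∀ R, action p e (b R) = milnorOp (GaloisField p e) (p ^ e) R) (k : PstExponent p) :
    initialForm p e (pstMonomial p key b k) =
      (factorialCoeff p k : GaloisField p e) • initialForm p e (b (milnorIndex p k)) := by
  set c := (factorialCoeff p k : GaloisField p e)
  set m := mayWeight p (milnorIndex p k) with hm
  have hsub := pstMonomial_sub_mem hkey hb k
  have h1 : b (milnorIndex p k) ∈ mayPower p e m := (milnor_mem_mayPower_iff hb _).2 le_rfl
  have h2 : b (milnorIndex p k) ∉ mayPower p e (m + 1) := by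
    rw [milnor_mem_mayPower_iff hb]; omega
  have hle : mayPower p e (m + 1) ≤ mayPower p e m := fun x hx =>
    Ideal.pow_le_pow_right (Nat.le_succ m) hx
  have h3 : pstMonomial p key b k ∈ mayPower p e m := by
    have := Submodule.add_mem _ (hle hsub) (Submodule.smul_mem _ c h1)
    rwa [sub_add_cancel] at this
  have h4 : pstMonomial p key b k ∉ mayPower p e (m + 1) := by
    intro h
    have := Submodule.sub_mem _ h hsub
    rw [sub_sub_cancel] at this
    -- Invertibility of `c_k` keeps the product from having higher filtration, so both classes live
    -- in degree `m`.
    exact h2 ((Submodule.smul_mem_iff _ (factorialCoeff_ne_zero k)).1 this)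
  rw [initialForm_eq h3 h4, initialForm_eq h1 h2, ← map_smul]
  congr 1
  rw [← Submodule.Quotient.mk_smul, Submodule.Quotient.eq]
  exact hsub

end PstBases

end Steenrod

/-! ### Assembly of the bases -/

theorem proposition6p1 (p e : ℕ) [Fact p.Prime] [NeZero e] :
    ∃ (milnor : Module.Basis (ℕ+ →₀ ℕ) (GaloisField p e) (Steenrod.SteenrodAlgebra p e))
      (yBasis zBasis :
        Module.Basis (Steenrod.PstExponent p) (GaloisField p e) (Steenrod.SteenrodAlgebra p e))
      (milnorE yE zE :
        Module.Basis (Steenrod.PstExponent p) (GaloisField p e) (Steenrod.E0 p e)),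
      -- the Milnor, Y- and Z-bases of the algebra
      (∀ R θ, Steenrod.IsMilnorElement p e R θ ↔ θ = milnor R) ∧
      (∀ k, yBasis k = Steenrod.pstMonomial p (Steenrod.yKey e) milnor k) ∧
      (∀ k, zBasis k = Steenrod.pstMonomial p (Steenrod.zKey e) milnor k) ∧
      -- the correspondence between them, and the scalars
      Function.Bijective (Steenrod.milnorIndex p) ∧
      (∀ k, (Steenrod.factorialCoeff p k : GaloisField p e) ≠ 0) ∧
      -- agreement up to elements of higher May filtration
      (∀ k, Steenrod.mayFiltration p e (milnor (Steenrod.milnorIndex p k)) <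
        Steenrod.mayFiltration p e (yBasis k -
          (Steenrod.factorialCoeff p k : GaloisField p e) •
            milnor (Steenrod.milnorIndex p k))) ∧
      (∀ k, Steenrod.mayFiltration p e (milnor (Steenrod.milnorIndex p k)) <
        Steenrod.mayFiltration p e (zBasis k -
          (Steenrod.factorialCoeff p k : GaloisField p e) •
            milnor (Steenrod.milnorIndex p k))) ∧
      -- the classes of the three bases are bases of the associated graded space, and agree
      (∀ k, milnorE k = Steenrod.initialForm p e (milnor (Steenrod.milnorIndex p k))) ∧
      (∀ k, yE k = Steenrod.initialForm p e (yBasis k)) ∧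
      (∀ k, zE k = Steenrod.initialForm p e (zBasis k)) ∧
      (∀ k, yE k = zE k) ∧
      (∀ k, yE k = (Steenrod.factorialCoeff p k : GaloisField p e) • milnorE k) := by
  classical
  obtain ⟨b, hb⟩ := Steenrod.exists_milnorBasis p e
  obtain ⟨y, hy⟩ := Steenrod.exists_pstBasis (Steenrod.yKey_lt e) hb
  obtain ⟨z, hz⟩ := Steenrod.exists_pstBasis (Steenrod.zKey_lt e) hb
  obtain ⟨E, hE⟩ := Steenrod.exists_basis_initialForm hb
  let M := E.reindex (Equiv.ofBijective _ (Steenrod.milnorIndex_bijective p)).symm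
  have hM : ∀ k, M k = Steenrod.initialForm p e (b (Steenrod.milnorIndex p k)) := fun k => by
    simp [M, hE]
  have hc : ∀ k, IsUnit (Steenrod.factorialCoeff p k : GaloisField p e) := fun k =>
    (Steenrod.factorialCoeff_ne_zero k).isUnit
  have hMc : ∀ k, M.isUnitSMul hc k = (Steenrod.factorialCoeff p k : GaloisField p e) •
      Steenrod.initialForm p e (b (Steenrod.milnorIndex p k)) := fun k => by
    rw [Module.Basis.isUnitSMul_apply, hM]
  -- The Milnor classes rescaled by the units `c_k` serve as both the Y- and the Z-classes, so the
  -- equality of the latter two is definitional.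
  refine ⟨b, y, z, M, M.isUnitSMul hc, M.isUnitSMul hc,
    Steenrod.isMilnorElement_iff p e hb, hy, hz, Steenrod.milnorIndex_bijective p,
    Steenrod.factorialCoeff_ne_zero, ?_, ?_, hM, ?_, ?_, fun _ => rfl, ?_⟩
  · intro k
    rw [hy]
    exact Steenrod.mayFiltration_lt (Steenrod.yKey_lt e) hb k
  · intro k
    rw [hz]
    exact Steenrod.mayFiltration_lt (Steenrod.zKey_lt e) hb k
  · intro k
    rw [hy, hMc, Steenrod.initialForm_pstMonomial (Steenrod.yKey_lt e) hb]
  · intro k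
    rw [hz, hMc, Steenrod.initialForm_pstMonomial (Steenrod.zKey_lt e) hb]
  · intro k
    rw [hMc, hM]
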